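/- **Theorem (Reversible spectral match for monotone kernels).** Let $0<m<1$ and let $h:\mathbb R\to[0,\infty)$ be a probability density with $h(x)=0$ for $x<0$ which has a nonincreasing representative on $(0,\infty)$. Put $\check h(x)=h(-x)$, $\widehat f(\omega)=\int e^{-\mathrm i\omega\cdot t}f(t)\,dt$ (and likewise for finite signed measures), and $$\rho_h(x)=\frac{h(|x|)-m(h*\check h)(x)}{2-m}\quad\text{for a.e. }x,\qquad p_n=\frac{(2n-2)!}{2^{2n-1}\,n!\,(n-1)!}\,\frac{[m(2-m)]^n}{m}\quad(n\ge1).$$ 1. $\rho_h$ has an even probability density representative, $\widehat{\rho_h}$ is real-valued, $p_n>0$ for all $n\ge 1$ and $\sum_{n\ge1}p_n=1$. Moreover $1-m(2-m)\widehat{\rho_h}(\omega)=|1-m\widehat h(\omega)|^2\ge(1-m)^2>0$ for all $\omega\in\mathbb R$. 2. There is an even probability density $\varphi_h$ such that, whenever $K$ has law $\mathbb P(K=n)=p_n$ ($n\ge1$), $Y_1,Y_2,\dots$ are i.i.d. with density any even density representative of $\rho_h$, and $K$ is independent of $(Y_k)_{k\ge1}$, the random sum $Y=\sum_{k=1}^KY_k$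 has density $\varphi_h$. Furthermore, for all $\omega$, $$\widehat{\varphi_h}(\omega)=\frac{1-\sqrt{1-m(2-m)\widehat{\rho_h}(\omega)}}{m}\ \text{ (positive square root)},\qquad |1-m\widehat{\varphi_h}(\omega)|^2=|1-m\widehat h(\omega)|^2 .$$ For a probability density $f$ on $\mathbb R$ and $\nu>0$, let $N_f$ denote the stationary Poisson branching-cluster process with immigrant rate $\nu$ and offspring density $mf$: immigrants form a homogeneous Poisson process of rate $\nu$; each immigrant, independently, is the root of a Galton–Watson family tree in which every individual has a Poisson($m$) number of children, displaced from their parent independently with density $f$; $N_f$ is the counting measure of the positions of all individuals. For a stationary point process $N$ whose counts of bounded sets have finite moments of order $n$, the complete and factorial cumulant measures of order $n$ are the joint cumulants of $N(A_1),\dots,N(A_n)$ and the corresponding combinations of the factorial moment measures; the reduced measure $M^{\mathrm{red}}$ of such a measure $M$ on $\mathbb R^n$ is determined by $\int F\,dM=\int_{\mathbb R}\int_{\mathbb R^{n-1}}F(t,t+\tau_1,\dots,t+\tau_{n-1})\,M^{\mathrm{red}}(d\tau)\,dt$. Put $\lambda=\nu/(1-m)$. Then for every $\nu>0$: 3. $N_{\varphi_h}$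 is stationary and reversible, i.e. the reflected process $A\mapsto N_{\varphi_h}(-A)$ has the same law as $N_{\varphi_h}$. 4. $N_{\varphi_h}$ and $N_h$ both have intensity $\lambda$. Their reduced complete covariance measures exist as finite signed measures and are equal, and their common Fourier–Stieltjes transform (full Bartlett spectrum) is $\lambda/|1-m\widehat h(\omega)|^2$. 5. For $N_{\varphi_h}$ the reduced complete covariance measure (with real transform $\Gamma$) and the reduced complete and factorial third cumulant measures exist as finite signed measures, and the Fourier–Stieltjes transforms $B_{\mathrm{comp}}$, $B_{\mathrm{fac}}$ of the latter two are real-valued. If the reduced factorial third cumulant measure has a density $c_3\in L^1(\mathbb R^2)$, then $\widehat{c_3}$ is real-valued. The complete third cumulant differs only by real diagonal terms: $$B_{\mathrm{comp}}(\omega_1,\omega_2)=B_{\mathrm{fac}}(\omega_1,\omega_2)+\Gamma(\omega_1)+\Gamma(\omega_2)+\Gamma(\omega_1+\omega_2)-2\lambda .$$ -/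

import Mathlib

open MeasureTheory ProbabilityTheory
open scoped NNReal ENNReal Convolution

/-! ### Densities and Fourier transforms -/

/-- `f` is a (Borel) probability density on the line. -/
structure IsProbDensity (f : ℝ → ℝ) : Prop where
  measurable : Measurable f
  nonneg : ∀ x, 0 ≤ f x
  integrable : Integrable f
  integral_eq_one : ∫ x, f x = 1

/-- `f` is an even probability density. -/
def IsEvenProbDensity (f : ℝ → ℝ) : Prop :=
  IsProbDensity f ∧ ∀ x, f (-x) = f x

/-- The measure `f(x) dx`. -/
noncomputable def densityMeasure (f : ℝ → ℝ) : Measure ℝ :=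
  volume.withDensity fun x => ENNReal.ofReal (f x)

/-- `f̂(ω) = ∫ e^{-iωt} f(t) dt`. -/
noncomputable def fourierR (f : ℝ → ℝ) (ω : ℝ) : ℂ :=
  ∫ t : ℝ, Complex.exp (-((ω * t : ℝ) : ℂ) * Complex.I) * (f t : ℂ)

/-- `f̂(ω₁, ω₂) = ∫∫ e^{-i(ω₁τ₁ + ω₂τ₂)} f(τ₁, τ₂) dτ₁ dτ₂`. -/
noncomputable def fourierR2 (f : ℝ × ℝ → ℝ) (ω₁ ω₂ : ℝ) : ℂ :=
  ∫ τ : ℝ × ℝ, Complex.exp (-((ω₁ * τ.1 + ω₂ * τ.2 : ℝ) : ℂ) * Complex.I) * (f τ : ℂ)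

/-- Fourier–Stieltjes transform of a finite signed measure on `ℝ`. -/
noncomputable def fourierStieltjes (γ : SignedMeasure ℝ) (ω : ℝ) : ℂ :=
  ∫ᵛ τ, Complex.exp (-((ω * τ : ℝ) : ℂ) * Complex.I) ∂<•γ

/-- Fourier–Stieltjes transform of a finite signed measure on `ℝ²`. -/
noncomputable def fourierStieltjes2 (γ : SignedMeasure (ℝ × ℝ)) (ω₁ ω₂ : ℝ) : ℂ :=
  ∫ᵛ τ, Complex.exp (-((ω₁ * τ.1 + ω₂ * τ.2 : ℝ) : ℂ) * Complex.I) ∂<•γ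

/-! ### The symmetric building block and the random-sum weights -/

/-- `ρ_h(x) = (h(|x|) - m (h ∗ ȟ)(x)) / (2 - m)`, where `ȟ(x) = h(-x)`. -/
noncomputable def rhoKernel (m : ℝ) (h : ℝ → ℝ) (x : ℝ) : ℝ :=
  (h |x| - m * (h ⋆[ContinuousLinearMap.mul ℝ ℝ, volume] fun y => h (-y)) x) / (2 - m)

/-- `p_n = (2n-2)! / (2^{2n-1} n! (n-1)!) * [m(2-m)]^n / m`; only used for `n ≥ 1`. -/
noncomputable def catalanWeight (m : ℝ) (n : ℕ) : ℝ :=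
  ((2 * n - 2).factorial : ℝ) /
      (2 ^ (2 * n - 1) * (n.factorial : ℝ) * ((n - 1).factorial : ℝ)) *
    ((m * (2 - m)) ^ n / m)

/-- `r` is an even probability density, equal almost everywhere to `ρ_h`. -/
def IsEvenRepresentative (m : ℝ) (h r : ℝ → ℝ) : Prop :=
  IsEvenProbDensity r ∧ r =ᵐ[volume] rhoKernel m h

/-- On the probability space `(Ω, P)`: `K` has law `P(K = n) = p_n`, `n ≥ 1`; the `Y_k` are
i.i.d. with density `r`; and `K` is independent of the sequence `(Y_k)`. -/
structure IsRandomSumData {Ω : Type*} [MeasurableSpace Ω] (P : Measure Ω) (m : ℝ) (r : ℝ → ℝ)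
    (K : Ω → ℕ) (Y : ℕ → Ω → ℝ) : Prop where
  measurable_K : Measurable K
  measurable_Y : ∀ k, Measurable (Y k)
  law_K : ∀ n, 1 ≤ n → P {ω | K ω = n} = ENNReal.ofReal (catalanWeight m n)
  law_Y : ∀ k, P.map (Y k) = densityMeasure r
  indep_Y : iIndepFun Y P
  indep_K_Y : IndepFun K (fun ω k => Y k ω) P

/-! ### Point processes: reversibility, stationarity, intensity

A point process is a random measure `N : Ω → Measure ℝ` (a random counting measure, atoms counted
with multiplicity). Its law is the push-forward of `P` to `Measure ℝ`, which carries the σ-algebra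
generated by the evaluations `μ ↦ μ A`. -/

section PointProcess

variable {Ω : Type*} [MeasurableSpace Ω]

/-- All translates of `N` have the same law as `N`. -/
def IsStationaryProcess (P : Measure Ω) (N : Ω → Measure ℝ) : Prop :=
  ∀ u : ℝ, IdentDistrib (fun ω => (N ω).map fun x => x + u) N P P

/-- The reflected process `A ↦ N (-A)` has the same law as `N`. -/
def IsReversibleProcess (P : Measure Ω) (N : Ω → Measure ℝ) : Prop :=
  IdentDistrib (fun ω => (N ω).map fun x => -x) N P P

/-- `E N(A) = l |A|` for every Borel set `A`. -/
def HasIntensity (P : Measure Ω) (N : Ω → Measure ℝ) (l : ℝ) : Prop :=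
  AEMeasurable N P ∧
    ∀ A : Set ℝ, MeasurableSet A → ∫⁻ ω, N ω A ∂P = ENNReal.ofReal l * volume A

/-! ### Second- and third-order moment and cumulant measures

These measures on `ℝ²` and `ℝ³` are recorded through their values on products of bounded Borel
sets, which determine them. -/

/-- Finite `k`-th moments of the counts of bounded Borel sets. -/
def HasFiniteMoments (k : ℕ) (P : Measure Ω) (N : Ω → Measure ℝ) : Prop :=
  AEMeasurable N P ∧
    ∀ A : Set ℝ, MeasurableSet A → Bornology.IsBounded A → ∫⁻ ω, (N ω A) ^ k ∂P < ∞

/-- The complete covariance measure: `γ₂(A × B) = E[N(A) N(B)] - E[N(A)] E[N(B)]`. -/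
noncomputable def completeCumulant2 (P : Measure Ω) (N : Ω → Measure ℝ) (A B : Set ℝ) : ℝ :=
  (∫ ω, (N ω).real A * (N ω).real B ∂P) - (∫ ω, (N ω).real A ∂P) * ∫ ω, (N ω).real B ∂P

/-- The complete third cumulant measure: `γ₃(A × B × C)` is the joint cumulant of the three
random variables `N(A)`, `N(B)`, `N(C)`. -/
noncomputable def completeCumulant3 (P : Measure Ω) (N : Ω → Measure ℝ) (A B C : Set ℝ) : ℝ :=
  (∫ ω, (N ω).real A * (N ω).real B * (N ω).real C ∂P)
    - (∫ ω, (N ω).real A * (N ω).real B ∂P) * (∫ ω, (N ω).real C ∂P)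
    - (∫ ω, (N ω).real A * (N ω).real C ∂P) * (∫ ω, (N ω).real B ∂P)
    - (∫ ω, (N ω).real B * (N ω).real C ∂P) * (∫ ω, (N ω).real A ∂P)
    + 2 * (∫ ω, (N ω).real A ∂P) * (∫ ω, (N ω).real B ∂P) * (∫ ω, (N ω).real C ∂P)

/-- For a counting measure `μ = ∑ᵢ δ_{xᵢ}`, the number of pairs of atoms `(xᵢ, xⱼ) ∈ A × B` with
distinct labels `i ≠ j` (all ordered pairs, minus the diagonal). -/
noncomputable def factorialProd2 (μ : Measure ℝ) (A B : Set ℝ) : ℝ :=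
  μ.real A * μ.real B - μ.real (A ∩ B)

/-- For a counting measure `μ = ∑ᵢ δ_{xᵢ}`, the number of triples of atoms in `A × B × C` with
pairwise distinct labels (by inclusion–exclusion over the diagonals). -/
noncomputable def factorialProd3 (μ : Measure ℝ) (A B C : Set ℝ) : ℝ :=
  μ.real A * μ.real B * μ.real C
    - μ.real (A ∩ B) * μ.real C - μ.real (A ∩ C) * μ.real B - μ.real (B ∩ C) * μ.real A
    + 2 * μ.real (A ∩ B ∩ C)

/-- The factorial moment measure `α₂(A × B)`. -/
noncomputable def factorialMoment2 (P : Measure Ω) (N : Ω → Measure ℝ) (A B : Set ℝ) : ℝ :=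
  ∫ ω, factorialProd2 (N ω) A B ∂P

/-- The factorial moment measure `α₃(A × B × C)`. -/
noncomputable def factorialMoment3 (P : Measure Ω) (N : Ω → Measure ℝ) (A B C : Set ℝ) : ℝ :=
  ∫ ω, factorialProd3 (N ω) A B C ∂P

/-- The factorial third cumulant measure, from the factorial moment measures by the
moment–cumulant formula. -/
noncomputable def factorialCumulant3 (P : Measure Ω) (N : Ω → Measure ℝ) (A B C : Set ℝ) : ℝ :=
  factorialMoment3 P N A B C
    - factorialMoment2 P N A B * (∫ ω, (N ω).real C ∂P)
    - factorialMoment2 P N A C * (∫ ω, (N ω).real B ∂P)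
    - factorialMoment2 P N B C * (∫ ω, (N ω).real A ∂P)
    + 2 * (∫ ω, (N ω).real A ∂P) * (∫ ω, (N ω).real B ∂P) * (∫ ω, (N ω).real C ∂P)

/-- The finite signed measure `γ` on `ℝ` is the reduced form of the measure `M` on `ℝ²`:
`∫ F dM = ∫ ∫ F(t, t + τ) γ(dτ) dt` for indicators `F` of products of bounded Borel sets. -/
def IsReduced2 (M : Set ℝ → Set ℝ → ℝ) (γ : SignedMeasure ℝ) : Prop :=
  ∀ A B : Set ℝ, MeasurableSet A → MeasurableSet B →
    Bornology.IsBounded A → Bornology.IsBounded B →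
    M A B = ∫ t in A, γ {τ | t + τ ∈ B}

/-- The finite signed measure `γ` on `ℝ²` is the reduced form of the measure `M` on `ℝ³`:
`∫ F dM = ∫ ∫ F(t, t + τ₁, t + τ₂) γ(dτ₁, dτ₂) dt` for indicators `F` of products of bounded
Borel sets. -/
def IsReduced3 (M : Set ℝ → Set ℝ → Set ℝ → ℝ) (γ : SignedMeasure (ℝ × ℝ)) : Prop :=
  ∀ A B C : Set ℝ, MeasurableSet A → MeasurableSet B → MeasurableSet C →
    Bornology.IsBounded A → Bornology.IsBounded B → Bornology.IsBounded C →
    M A B C = ∫ t in A, γ {τ | t + τ.1 ∈ B ∧ t + τ.2 ∈ C}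

/-- `γ` is the reduced complete covariance measure of `N`. -/
def IsReducedCovariance (P : Measure Ω) (N : Ω → Measure ℝ) (γ : SignedMeasure ℝ) : Prop :=
  HasFiniteMoments 2 P N ∧ IsReduced2 (completeCumulant2 P N) γ

/-- `γ` is the reduced complete third cumulant measure of `N`. -/
def IsReducedCompleteThird (P : Measure Ω) (N : Ω → Measure ℝ) (γ : SignedMeasure (ℝ × ℝ)) :
    Prop :=
  HasFiniteMoments 3 P N ∧ IsReduced3 (completeCumulant3 P N) γ

/-- `κ` is the reduced factorial third cumulant measure of `N`. -/
def IsReducedFactorialThird (P : Measure Ω) (N : Ω → Measure ℝ) (κ : SignedMeasure (ℝ × ℝ)) :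
    Prop :=
  HasFiniteMoments 3 P N ∧ IsReduced3 (factorialCumulant3 P N) κ

/-! ### The Poisson branching-cluster process -/

/-- The random points `U₀, U₁, …` form a homogeneous Poisson process of rate `ν` on the line: the
numbers of points in disjoint Borel sets of finite length are independent, and Poisson with mean
`ν |A|`. -/
structure IsPoissonPoints (P : Measure Ω) (ν : ℝ) (U : ℕ → Ω → ℝ) : Prop where
  measurable : ∀ j, Measurable (U j)
  law_count : ∀ A : Set ℝ, MeasurableSet A → volume A ≠ ∞ →
    P.map (fun ω => Measure.sum (fun j => Measure.dirac (U j ω)) A) =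
      (poissonMeasure (ν.toNNReal * (volume A).toNNReal)).map (fun n : ℕ => (n : ℝ≥0∞))
  indep_count : ∀ (n : ℕ) (A : Fin n → Set ℝ), (∀ i, MeasurableSet (A i)) →
    (∀ i, volume (A i) ≠ ∞) → Pairwise (fun i j => Disjoint (A i) (A j)) →
    iIndepFun (fun i ω => Measure.sum (fun j => Measure.dirac (U j ω)) (A i)) P

end PointProcess

/-- Possible vertices of a family tree are words: `[]` is the root, and `i :: v` is the
descendant `v` of the `i`-th child of the root. Given offspring numbers `ξ`, this says that the
vertex belongs to the tree: every letter is smaller than the offspring number of the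
vertex reached before it. -/
def InTree (ξ : List ℕ → ℕ) : List ℕ → Prop
  | [] => True
  | i :: v => i < ξ [] ∧ InTree (fun w => ξ (i :: w)) v

/-- Position of a vertex relative to the root, when `D v` is the displacement of the vertex `v`
from its parent (`D []` is not used). -/
def treePosition (D : List ℕ → ℝ) : List ℕ → ℝ
  | [] => 0
  | i :: v => D [i] + treePosition (fun w => D (i :: w)) v

open Classical in
/-- The rooted cluster: the counting measure of the positions of all vertices of the tree. -/
noncomputable def rootedCluster (ξ : List ℕ → ℕ) (D : List ℕ → ℝ) : Measure ℝ :=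
  Measure.sum fun v : List ℕ => if InTree ξ v then Measure.dirac (treePosition D v) else 0

/-- The superposition `∑ⱼ ϑ_{Uⱼ} Cⱼ` of the clusters, translated by the immigrant positions. -/
noncomputable def clusterProcess {Ω : Type*} (U : ℕ → Ω → ℝ) (ξ : ℕ → List ℕ → Ω → ℕ)
    (D : ℕ → List ℕ → Ω → ℝ) (ω : Ω) : Measure ℝ :=
  Measure.sum fun j : ℕ =>
    (rootedCluster (fun v => ξ j v ω) (fun v => D j v ω)).map fun x => x + U j ω

/-- The data of a stationary Poisson branching-cluster process with immigrant rate `ν` and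
offspring displacement intensity `m f(x) dx`: the immigrants `U` form a Poisson process of rate
`ν`; independently of it, every individual (vertex `v` in the cluster of the `j`-th immigrant) has
a Poisson(`m`) number `ξ j v` of children, and its displacement `D j v` from its parent has
density `f`; all these numbers and displacements are independent. (A Poisson process of intensity
`m f(x) dx` is a Poisson(`m`) number of independent points with density `f`.) The process itself is
`clusterProcess U ξ D`. -/
structure IsBranchingData {Ω : Type*} [MeasurableSpace Ω] (P : Measure Ω) (ν m : ℝ) (f : ℝ → ℝ)
    (U : ℕ → Ω → ℝ) (ξ : ℕ → List ℕ → Ω → ℕ) (D : ℕ → List ℕ → Ω → ℝ) : Prop where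
  poisson : IsPoissonPoints P ν U
  measurable_ξ : ∀ j v, Measurable (ξ j v)
  measurable_D : ∀ j v, Measurable (D j v)
  law : ∀ j v, P.map (fun ω => (ξ j v ω, D j v ω)) =
    (poissonMeasure m.toNNReal).prod (densityMeasure f)
  indep : iIndepFun (fun (p : ℕ × List ℕ) ω => (ξ p.1 p.2 ω, D p.1 p.2 ω)) P
  indep_immigrants : IndepFun (fun ω j => U j ω)
    (fun ω (p : ℕ × List ℕ) => (ξ p.1 p.2 ω, D p.1 p.2 ω)) P

/-! Three ingredients meet in the identity `1 - m φ̂ = |1 - m ĥ|`.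

The building block. Since `h` vanishes on the negative axis, `h(|x|) = h(x) + h(-x)` for `x ≠ 0`, so
the transform of `ρ_h` is `(ĥ + conj ĥ - m |ĥ|²) / (2 - m)`, and completing the product gives `1 -
m(2 - m) ρ̂ = |1 - m ĥ|²`. Monotonicity enters only through positivity: for `x > 0` the
autocorrelation `∫ h(t) h(t - x) dt` lives on `t > x`, where `h(t) ≤ h(x)`, hence it is at most
`h(x)` (`autocorr_le`).

The random sum. The power series of `1 - √(1 - z)` has positive coefficients, Catalan numbers over
powers of two, and converges on `|z| ≤ 1` (`hasSum_sqrtCoeff_mul_pow`). Hence `y ↦ (1 - √(1 - m(2 -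
m) y)) / m` is a probability generating function. Evaluating it at `ρ̂` gives the characteristic
function of a random sum of variables with density `ρ_h`, whose law has an even density `φ`
(`exists_density_compoundLaw`).

The process. The clusters form a Poisson process of pairs (root position, family tree), so the
Laplace functional is `exp(-∫ (1 - e^{-G}))`, where `G` is the sum of the test function over one
cluster (`IsBranchingData.lintegral_expNeg`). Laplace functionals determine laws
(`identDistrib_of_laplace`); stationarity is therefore translation invariance of Lebesgue measure,
and reversibility follows because reversing every displacement preserves the tree law when the
density is even. Differentiating the Laplace transform shows that the cumulants of `∫ g dN` are the
integrals of powers of `G` (`moments_of_laplace`); these are finite because the total progeny has a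
finite third moment (`lintegral_total_pow_three_lt_top`). Polarization gives the cumulant measures,
and expanding products of cluster sums over pairs or triples of vertices, then integrating out the
root position, identifies the reduced measures as `ν` times laws of vertex displacements.

For second order, let `S(ω)` be the Fourier transform of a rooted cluster. Decomposition at the root
gives `E S = 1 + m f̂ E S` and `E|S|² = |E S|² + m E|S|²`, so the reduced covariance has transform
`ν / ((1 - m) |1 - m f̂|²)`. It depends on `f` only through `|1 - m f̂|`, which agrees for `h` and
`φ` (`pairMeasure_congr`). For third order, the triple displacement law is symmetric by tree
reflection (`tripleLaw_map_neg`), so its transform is real, and the factorial measure differs from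
it by images of the covariance on the diagonals and a mass at the origin. `IsReduced2.unique` and
`IsReduced3.unique` transfer these facts to arbitrary reduced measures. -/

section SpectralMatch

open Filter Topology Set

/-! ### The exponential `x ↦ e⁻ˣ` on `[0, ∞]` -/

/-- `e^{-x}` for `x ∈ [0, ∞]`. -/
noncomputable def expNeg (x : ℝ≥0∞) : ℝ≥0∞ := EReal.exp (-(x : EReal))

/-- A right inverse of `expNeg` on `[0, 1]`. -/
noncomputable def negLog (y : ℝ≥0∞) : ℝ≥0∞ := (-(ENNReal.log y)).toENNReal

lemma continuous_expNeg : Continuous expNeg :=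
  ENNReal.continuous_exp.comp (continuous_neg.comp continuous_coe_ennreal_ereal)

lemma measurable_expNeg : Measurable expNeg := continuous_expNeg.measurable

lemma measurable_negLog : Measurable negLog :=
  measurable_ereal_toENNReal.comp ENNReal.measurable_log.neg

@[simp] lemma expNeg_zero : expNeg 0 = 1 := by simp [expNeg]

@[simp] lemma expNeg_top : expNeg ∞ = 0 := by simp [expNeg]

lemma expNeg_antitone : Antitone expNeg := fun x y hxy => by
  unfold expNeg
  apply EReal.exp_monotone
  simpa using hxy

lemma expNeg_le_one (x : ℝ≥0∞) : expNeg x ≤ 1 := by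
  simpa using expNeg_antitone (zero_le (a := x))

lemma expNeg_ne_top (x : ℝ≥0∞) : expNeg x ≠ ∞ := ne_top_of_le_ne_top (by simp) (expNeg_le_one x)

lemma expNeg_add (x y : ℝ≥0∞) : expNeg (x + y) = expNeg x * expNeg y := by
  unfold expNeg
  rw [← EReal.exp_add, EReal.coe_ennreal_add, EReal.neg_add]
  · rfl
  · exact Or.inl (by simp)
  · exact Or.inr (by simp)

lemma expNeg_sum {ι : Type*} (s : Finset ι) (f : ι → ℝ≥0∞) :
    expNeg (∑ i ∈ s, f i) = ∏ i ∈ s, expNeg (f i) := by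
  classical
  induction s using Finset.induction_on with
  | empty => simp
  | insert a s ha ih => rw [Finset.sum_insert ha, Finset.prod_insert ha, expNeg_add, ih]

lemma expNeg_nsmul (n : ℕ) (x : ℝ≥0∞) : expNeg (n * x) = expNeg x ^ n := by
  simpa using expNeg_sum (Finset.range n) fun _ => x

lemma expNeg_ofReal {r : ℝ} (hr : 0 ≤ r) :
    expNeg (ENNReal.ofReal r) = ENNReal.ofReal (Real.exp (-r)) := by
  unfold expNeg
  rw [EReal.coe_ennreal_ofReal, max_eq_left hr, ← EReal.coe_neg, EReal.exp_coe]

lemma expNeg_negLog {y : ℝ≥0∞} (hy : y ≤ 1) : expNeg (negLog y) = y := by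
  unfold expNeg negLog
  rw [EReal.coe_toENNReal, neg_neg, ENNReal.exp_log]
  simpa using hy

lemma expNeg_injective : Function.Injective expNeg := fun x y h => by
  unfold expNeg at h
  have := EReal.exp_strictMono.injective h
  simpa using this

lemma tendsto_expNeg_sum_range (f : ℕ → ℝ≥0∞) :
    Tendsto (fun n => expNeg (∑ i ∈ Finset.range n, f i)) atTop (𝓝 (expNeg (∑' i, f i))) :=
  (continuous_expNeg.tendsto _).comp ENNReal.summable.hasSum.tendsto_sum_nat

/-- Expectations of `e^{-∑ Xᵢ}` factorise over an independent sequence. -/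
lemma lintegral_expNeg_tsum {Ω : Type*} [MeasurableSpace Ω] {P : Measure Ω}
    [IsProbabilityMeasure P] {X : ℕ → Ω → ℝ≥0∞} (hX : ∀ i, Measurable (X i))
    (h : iIndepFun X P) :
    ∫⁻ ω, expNeg (∑' i, X i ω) ∂P = expNeg (∑' i, negLog (∫⁻ ω, expNeg (X i ω) ∂P)) := by
  have hle : ∀ i, ∫⁻ ω, expNeg (X i ω) ∂P ≤ 1 := fun i =>
    (lintegral_mono fun ω => expNeg_le_one _).trans (by simp)
  have h1 : Tendsto (fun n => ∫⁻ ω, expNeg (∑ i ∈ Finset.range n, X i ω) ∂P) atTop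
      (𝓝 (∫⁻ ω, expNeg (∑' i, X i ω) ∂P)) :=
    tendsto_lintegral_of_dominated_convergence (fun _ => 1)
      (fun n => measurable_expNeg.comp (Finset.measurable_sum _ fun i _ => hX i))
      (fun n => Eventually.of_forall fun ω => expNeg_le_one _) (by simp)
      (Eventually.of_forall fun ω => tendsto_expNeg_sum_range _)
  refine tendsto_nhds_unique h1 ?_
  -- Independence factorises the finite partial sums. Writing each factor as `expNeg` of its
  -- `negLog` turns the product back into a sum, so the same limit theorem handles both sides.
  have h2 : ∀ n, ∫⁻ ω, expNeg (∑ i ∈ Finset.range n, X i ω) ∂P =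
      expNeg (∑ i ∈ Finset.range n, negLog (∫⁻ ω, expNeg (X i ω) ∂P)) := fun n => by
    simp_rw [expNeg_sum]
    rw [lintegral_prod_eq_prod_lintegral_of_indepFun (Finset.range n)
      (fun i ω => expNeg (X i ω)) (h.comp (fun _ => expNeg) fun _ => measurable_expNeg)
      fun i => measurable_expNeg.comp (hX i)]
    exact Finset.prod_congr rfl fun i _ => (expNeg_negLog (hle i)).symm
  simp_rw [h2]
  exact tendsto_expNeg_sum_range _

/-! ### The Laplace functional of Poisson points -/

/-- The exponential series in `r * y`, damped by `e^{-r}`. The bound on `y` keeps the subtraction `1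
- y` from being truncated. -/
lemma lintegral_pow_poissonMeasure (r : ℝ≥0) (y : ℝ≥0∞) (hy : y ≤ 1) :
    ∫⁻ n : ℕ, y ^ n ∂poissonMeasure r = expNeg (r * (1 - y)) := by
  have hyt : y ≠ ∞ := ne_top_of_le_ne_top (by simp) hy
  lift y to ℝ≥0 using hyt
  have hy' : (y : ℝ) ≤ 1 := by exact_mod_cast hy
  rw [lintegral_countable']
  simp_rw [poissonMeasure_singleton]
  have h0 : (r : ℝ≥0∞) * (1 - y) = ENNReal.ofReal (r * (1 - y)) := by
    rw [ENNReal.ofReal_mul (by positivity), ENNReal.ofReal_sub _ (by positivity)]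
    simp
  rw [h0, expNeg_ofReal (by have := r.2; nlinarith)]
  have hs : HasSum (fun n : ℕ => (y : ℝ) ^ n * (Real.exp (-r) * r ^ n / n.factorial))
      (Real.exp (-(r * (1 - y)))) := by
    have := (NormedSpace.expSeries_div_hasSum_exp (𝔸 := ℝ) ((r : ℝ) * y)).mul_left
      (Real.exp (-r))
    rw [← Real.exp_eq_exp_ℝ, ← Real.exp_add] at this
    have h2 : -(r : ℝ) + r * y = -(r * (1 - y)) := by ring
    rw [h2] at this
    have h3 : (fun i : ℕ => Real.exp (-r) * (((r : ℝ) * y) ^ i / i.factorial)) =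
        fun n : ℕ => (y : ℝ) ^ n * (Real.exp (-r) * r ^ n / n.factorial) := by
      ext n; rw [mul_pow]; ring
    rw [h3] at this
    exact this
  rw [← hs.tsum_eq, ENNReal.ofReal_tsum_of_nonneg (fun n => by positivity) hs.summable]
  congr 1 with n
  rw [ENNReal.ofReal_mul (by positivity), ENNReal.ofReal_pow (by positivity)]
  simp

section Poisson

variable {Ω : Type*} [MeasurableSpace Ω] {P : Measure Ω} {ν : ℝ} {U : ℕ → Ω → ℝ}

/-- The counting measure of a sequence of points. -/
noncomputable def pointMeasure (u : ℕ → ℝ) : Measure ℝ := Measure.sum fun j => Measure.dirac (u j)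

lemma lintegral_pointMeasure (u : ℕ → ℝ) {f : ℝ → ℝ≥0∞} (hf : Measurable f) :
    ∫⁻ x, f x ∂pointMeasure u = ∑' j, f (u j) := by
  simp [pointMeasure, lintegral_sum_measure, lintegral_dirac' _ hf]

lemma measurable_pointMeasure_apply (hU : ∀ j, Measurable (U j)) {A : Set ℝ}
    (hA : MeasurableSet A) : Measurable fun ω => pointMeasure (fun j => U j ω) A := by
  simp only [pointMeasure, Measure.sum_apply _ hA, Measure.dirac_apply' _ hA]
  exact Measurable.tsum fun j => (measurable_const.indicator hA).comp (hU j)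

/-- The number of points in `A` is Poisson with mean `ν |A|`, so this is its generating function at
`expNeg c`. -/
lemma IsPoissonPoints.lintegral_expNeg_mul_apply (h : IsPoissonPoints P ν U)
    {A : Set ℝ} (hA : MeasurableSet A) (hA' : volume A ≠ ∞) (c : ℝ≥0∞) :
    ∫⁻ ω, expNeg (c * pointMeasure (fun j => U j ω) A) ∂P =
      expNeg (ENNReal.ofReal ν * ((1 - expNeg c) * volume A)) := by
  have hm := measurable_pointMeasure_apply h.measurable hA
  have h1 : ∫⁻ y, expNeg (c * y) ∂(P.map fun ω => pointMeasure (fun j => U j ω) A) =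
      ∫⁻ ω, expNeg (c * pointMeasure (fun j => U j ω) A) ∂P :=
    lintegral_map (measurable_expNeg.comp (measurable_const.mul measurable_id)) hm
  have h2 := h.law_count A hA hA'
  rw [← h1]
  unfold pointMeasure
  have hmul : Measurable fun y => expNeg (c * y) :=
    measurable_expNeg.comp (measurable_const.mul measurable_id)
  rw [h2, lintegral_map hmul (measurable_of_countable _)]
  have h3 : ∀ n : ℕ, expNeg (c * ((n : ℝ≥0) : ℝ≥0∞)) = expNeg c ^ n := fun n => by
    rw [mul_comm]; exact_mod_cast expNeg_nsmul n c
  have h4 : ∀ n : ℕ, expNeg (c * (n : ℝ≥0∞)) = expNeg c ^ n := fun n => by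
    rw [mul_comm]; exact_mod_cast expNeg_nsmul n c
  simp only [h4]
  rw [lintegral_pow_poissonMeasure _ _ (expNeg_le_one c)]
  congr 1
  rw [ENNReal.coe_mul, ENNReal.coe_toNNReal hA', ENNReal.ofReal, mul_assoc, mul_comm (volume A)]

/-- The nonzero level sets of `f` are disjoint and of finite volume, so their counts are independent
and the expectation is a product of one-set transforms. -/
lemma IsPoissonPoints.lintegral_expNeg_simpleFunc [IsProbabilityMeasure P]
    (h : IsPoissonPoints P ν U)
    (f : SimpleFunc ℝ ℝ≥0∞) (hf : ∀ y ≠ 0, volume (f ⁻¹' {y}) ≠ ∞) :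
    ∫⁻ ω, expNeg (∑' j, f (U j ω)) ∂P =
      expNeg (ENNReal.ofReal ν * ∫⁻ x, (1 - expNeg (f x))) := by
  classical
  let n := f.range.card
  let e : Fin n ≃ f.range := f.range.equivFin.symm
  -- The level set of `0` may have infinite volume; it contributes nothing to either side, so the
  -- empty set takes its place.
  let A : Fin n → Set ℝ := fun i => if (e i : ℝ≥0∞) = 0 then ∅ else f ⁻¹' {(e i : ℝ≥0∞)}
  have hA : ∀ i, MeasurableSet (A i) := fun i => by
    by_cases hi : (e i : ℝ≥0∞) = 0
    · simp [A, hi]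
    · simp only [A, hi, if_false]; exact f.measurableSet_preimage _
  have hAv : ∀ i, volume (A i) ≠ ∞ := fun i => by
    by_cases hi : (e i : ℝ≥0∞) = 0
    · simp [A, hi]
    · simp only [A, hi, if_false]; exact hf _ hi
  have hAd : Pairwise fun i j => Disjoint (A i) (A j) := fun i j hij => by
    refine Set.disjoint_left.2 fun x hx hx' => ?_
    by_cases hi : (e i : ℝ≥0∞) = 0
    · simp [A, hi] at hx
    by_cases hj : (e j : ℝ≥0∞) = 0
    · simp [A, hj] at hx'
    simp only [A, hi, hj, if_false, mem_preimage, mem_singleton_iff] at hx hx'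
    exact hij (e.injective (Subtype.ext (hx.symm.trans hx')))
  have hsum : ∀ (F : ℝ≥0∞ → ℝ≥0∞) (μ : Measure ℝ), F 0 = 0 →
      ∑ y ∈ f.range, F y * μ (f ⁻¹' {y}) = ∑ i, F (e i) * μ (A i) := fun F μ hF => by
    rw [← Finset.sum_coe_sort, ← e.sum_comp]
    refine Finset.sum_congr rfl fun i _ => ?_
    by_cases hi : (e i : ℝ≥0∞) = 0
    · simp [hi, hF]
    · simp [A, hi]
  have h1 : ∀ ω, ∑' j, f (U j ω) = ∑ i, (e i : ℝ≥0∞) * pointMeasure (fun j => U j ω) (A i) :=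
    fun ω => by
      rw [← lintegral_pointMeasure (fun j => U j ω) f.measurable,
        f.lintegral_eq_lintegral, SimpleFunc.lintegral]
      exact hsum id _ rfl
  have h2 : ∫⁻ x, (1 - expNeg (f x)) = ∑ i, (1 - expNeg (e i)) * volume (A i) := by
    have := (f.map fun y => 1 - expNeg y).lintegral_eq_lintegral volume
    rw [SimpleFunc.map_lintegral] at this
    rw [← hsum (fun y => 1 - expNeg y) volume (by simp), ← this]
    rfl
  simp_rw [h1, expNeg_sum, h2, Finset.mul_sum, expNeg_sum]
  rw [lintegral_prod_eq_prod_lintegral_of_indepFun Finset.univ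
    (fun i ω => expNeg ((e i : ℝ≥0∞) * pointMeasure (fun j => U j ω) (A i)))]
  · exact Finset.prod_congr rfl fun i _ => h.lintegral_expNeg_mul_apply (hA i) (hAv i) _
  · exact (h.indep_count n A hA hAv hAd).comp (fun i y => expNeg ((e i : ℝ≥0∞) * y))
      fun i => measurable_expNeg.comp (measurable_const.mul measurable_id)
  · exact fun i => measurable_expNeg.comp
      (measurable_const.mul (measurable_pointMeasure_apply h.measurable (hA i)))

/-- The Laplace functional of a homogeneous Poisson process. -/
theorem IsPoissonPoints.lintegral_expNeg_tsum [IsProbabilityMeasure P]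
    (h : IsPoissonPoints P ν U) {f : ℝ → ℝ≥0∞} (hf : Measurable f) :
    ∫⁻ ω, expNeg (∑' j, f (U j ω)) ∂P =
      expNeg (ENNReal.ofReal ν * ∫⁻ x, (1 - expNeg (f x))) := by
  -- Cutting the simple approximations off outside `[-n, n]` gives nonzero level sets of finite
  -- volume and keeps monotone convergence to `f`.
  let g : ℕ → SimpleFunc ℝ ℝ≥0∞ := fun n =>
    (SimpleFunc.eapprox f n).restrict (Icc (-(n : ℝ)) n)
  have hg : ∀ n x, g n x = (Icc (-(n : ℝ)) n).indicator (SimpleFunc.eapprox f n) x := fun n x => by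
    simp [g, SimpleFunc.restrict_apply _ measurableSet_Icc]
  have hmono : ∀ x, Monotone fun n => g n x := fun x n k hnk => by
    simp only [hg]
    have hnk' : (n : ℝ) ≤ k := by exact_mod_cast hnk
    refine (Set.indicator_le_indicator_of_subset (Icc_subset_Icc (by linarith) hnk')
      (fun _ => zero_le) x).trans (Set.indicator_le_indicator ?_)
    exact SimpleFunc.monotone_eapprox f hnk x
  have hlim : ∀ x, Tendsto (fun n => g n x) atTop (𝓝 (f x)) := fun x => by
    have h1 : Tendsto (fun n => SimpleFunc.eapprox f n x) atTop (𝓝 (f x)) := by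
      rw [← SimpleFunc.iSup_eapprox_apply hf x]
      exact tendsto_atTop_iSup fun n k hnk => SimpleFunc.monotone_eapprox f hnk x
    refine h1.congr' ?_
    obtain ⟨N, hN⟩ := exists_nat_ge |x|
    filter_upwards [eventually_ge_atTop N] with n hn
    have hn' : (N : ℝ) ≤ n := by exact_mod_cast hn
    rw [hg, Set.indicator_of_mem]
    exact abs_le.1 (hN.trans hn')
  have hfin : ∀ n, ∀ y ≠ 0, volume (g n ⁻¹' {y}) ≠ ∞ := fun n y hy => by
    refine ne_top_of_le_ne_top (b := volume (Icc (-(n : ℝ)) n)) (by simp) (measure_mono ?_)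
    intro x hx
    by_contra hx'
    simp only [mem_preimage, mem_singleton_iff, hg, Set.indicator_of_notMem hx'] at hx
    exact hy hx.symm
  have hL : Tendsto (fun n => ∫⁻ ω, expNeg (∑' j, g n (U j ω)) ∂P) atTop
      (𝓝 (∫⁻ ω, expNeg (∑' j, f (U j ω)) ∂P)) := by
    refine tendsto_lintegral_of_dominated_convergence (fun _ => 1)
      (fun n => measurable_expNeg.comp (Measurable.tsum
        fun j => (g n).measurable.comp (h.measurable j)))
      (fun n => Eventually.of_forall fun ω => expNeg_le_one _) (by simp)
      (Eventually.of_forall fun ω => (continuous_expNeg.tendsto _).comp ?_)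
    simp_rw [← lintegral_pointMeasure (fun j => U j ω) (SimpleFunc.measurable _),
      ← lintegral_pointMeasure (fun j => U j ω) hf]
    exact lintegral_tendsto_of_tendsto_of_monotone (fun n => (g n).measurable.aemeasurable)
      (Eventually.of_forall hmono) (Eventually.of_forall hlim)
  refine tendsto_nhds_unique hL ?_
  simp_rw [h.lintegral_expNeg_simpleFunc (g _) (hfin _)]
  refine (continuous_expNeg.tendsto _).comp (ENNReal.Tendsto.const_mul ?_ (Or.inr (by simp)))
  refine lintegral_tendsto_of_tendsto_of_monotone
    (fun n => (measurable_const.sub (measurable_expNeg.comp (g n).measurable)).aemeasurable)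
    (Eventually.of_forall fun x n k hnk => ?_) (Eventually.of_forall fun x => ?_)
  · exact tsub_le_tsub_left (expNeg_antitone (hmono x hnk)) _
  · exact ENNReal.Tendsto.sub tendsto_const_nhds ((continuous_expNeg.tendsto _).comp (hlim x))
      (Or.inl (by simp))

end Poisson

/-! ### Random measures are determined in law by their Laplace functionals -/

/-- Finite measures on a finite-dimensional cube are determined by their moments. -/
theorem ext_of_moments_unitInterval {ι : Type*} [Fintype ι] {μ μ' : Measure (ι → unitInterval)}
    [IsFiniteMeasure μ] [IsFiniteMeasure μ']
    (h : ∀ k : ι → ℕ, ∫ x, ∏ i, (x i : ℝ) ^ k i ∂μ = ∫ x, ∏ i, (x i : ℝ) ^ k i ∂μ') :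
    μ = μ' := by
  classical
  let coord : ι → BoundedContinuousFunction (ι → unitInterval) ℝ := fun i =>
    BoundedContinuousFunction.mkOfCompact ⟨fun x => (x i : ℝ), by fun_prop⟩
  let S : Subalgebra ℝ (BoundedContinuousFunction (ι → unitInterval) ℝ) :=
    Algebra.adjoin ℝ (range coord)
  let A : StarSubalgebra ℝ (BoundedContinuousFunction (ι → unitInterval) ℝ) :=
    { S with star_mem' := fun {a} ha => (show star a = a from by ext x; simp).symm ▸ ha }
  -- The algebra generated by the coordinates is spanned by monomials, on which the integrals agree
  -- by hypothesis. It separates points, so it determines a finite measure.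
  have hmono : ∀ g ∈ Submonoid.closure (range coord),
      ∃ k : ι → ℕ, ∀ x, g x = ∏ i, (x i : ℝ) ^ k i := fun g hg => by
    induction hg using Submonoid.closure_induction with
    | mem g hg =>
      obtain ⟨i, rfl⟩ := hg
      refine ⟨Pi.single i 1, fun x => ?_⟩
      rw [Finset.prod_eq_single i]
      · simp [coord]
      · intro j _ hj
        simp [hj]
      · simp
    | one => exact ⟨0, fun x => by simp⟩
    | mul g g' _ _ hg hg' =>
      obtain ⟨k, hk⟩ := hg
      obtain ⟨k', hk'⟩ := hg'
      exact ⟨k + k', fun x => by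
        simp [hk, hk', pow_add, Finset.prod_mul_distrib]⟩
  refine ext_of_forall_mem_subalgebra_integral_eq_of_polish (𝕜 := ℝ) (A := A) ?_ ?_
  · intro x y hxy
    obtain ⟨i, hi⟩ := Function.ne_iff.1 hxy
    refine ⟨fun x => (x i : ℝ), ⟨BoundedContinuousFunction.toContinuousMapStarₐ ℝ (coord i),
      ⟨coord i, Algebra.subset_adjoin (mem_range_self i), rfl⟩, rfl⟩, ?_⟩
    simpa [Subtype.ext_iff] using hi
  · intro g hg
    have hg' : g ∈ Submodule.span ℝ (Submonoid.closure (range coord) :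
        Set (BoundedContinuousFunction (ι → unitInterval) ℝ)) := by
      rw [← Algebra.adjoin_eq_span]
      exact hg
    clear hg
    induction hg' using Submodule.span_induction with
    | mem g hg =>
      obtain ⟨k, hk⟩ := hmono g hg
      simp_rw [hk]
      exact h k
    | zero => simp
    | add g g' _ _ ih ih' =>
      simp only [BoundedContinuousFunction.coe_add, Pi.add_apply]
      rw [integral_add (g.integrable _) (g'.integrable _),
        integral_add (g.integrable _) (g'.integrable _), ih, ih']
    | smul c g _ ih =>
      simp only [BoundedContinuousFunction.coe_smul, smul_eq_mul]
      rw [integral_const_mul, integral_const_mul, ih]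

/-- The numbers `e^{-μ(A)} ∈ [0, 1]`, for all Borel sets `A`. -/
noncomputable def expNegCoords (μ : Measure ℝ) (A : {A : Set ℝ // MeasurableSet A}) :
    unitInterval :=
  ⟨(expNeg (μ A)).toReal, ENNReal.toReal_nonneg,
    by simpa using ENNReal.toReal_mono (by simp) (expNeg_le_one (μ A))⟩

lemma measurable_expNegCoords : Measurable expNegCoords := by
  refine measurable_pi_iff.2 fun A => Measurable.subtype_mk ?_
  exact (measurable_expNeg.comp (Measure.measurable_coe A.2)).ennreal_toReal

/-- Each evaluation `μ A` is recovered as `negLog` of the coordinate at `A`, so these coordinates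
generate the whole σ-algebra. A law on measures is thus determined by its image in a product of unit
intervals. -/
lemma instMeasurableSpace_le_comap_expNegCoords :
    (Measure.instMeasurableSpace : MeasurableSpace (Measure ℝ)) ≤
      MeasurableSpace.comap expNegCoords inferInstance := by
  unfold Measure.instMeasurableSpace
  refine iSup₂_le fun A hA => ?_
  have h : (fun μ : Measure ℝ => μ A) =
      (fun t => negLog (ENNReal.ofReal t)) ∘
        (fun x : {A : Set ℝ // MeasurableSet A} → unitInterval => (x ⟨A, hA⟩ : ℝ)) ∘
          expNegCoords := by
    ext μ
    simp only [Function.comp_apply, expNegCoords]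
    rw [ENNReal.ofReal_toReal (expNeg_ne_top _)]
    exact expNeg_injective (expNeg_negLog (expNeg_le_one _)).symm
  rw [h, ← Function.comp_assoc, ← MeasurableSpace.comap_comp]
  refine MeasurableSpace.comap_mono ?_
  rw [← measurable_iff_comap_le]
  exact (measurable_negLog.comp ENNReal.measurable_ofReal).comp
    (measurable_subtype_coe.comp (measurable_pi_apply _))

/-- A monomial in the numbers `e^{-μ(Aᵢ)}` with exponents `kᵢ` equals `e^{-∫ g dμ}` for the step
function `g = ∑ kᵢ 1_{Aᵢ}`; mixed moments of the coordinates are therefore values of the Laplace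
functional. -/
lemma integral_expNegCoords_map {Ω : Type*} [MeasurableSpace Ω] {P : Measure Ω}
    {N : Ω → Measure ℝ} (hN : Measurable N)
    (I : Finset {A : Set ℝ // MeasurableSet A}) (k : I → ℕ) :
    ∫ x, ∏ i, (x i : ℝ) ^ k i ∂(((P.map N).map expNegCoords).map I.restrict) =
      (∫⁻ ω, expNeg (∫⁻ x, ∑ i : I, ((i : {A : Set ℝ // MeasurableSet A}) : Set ℝ).indicator
        (fun _ => (k i : ℝ≥0∞)) x ∂N ω) ∂P).toReal := by
  have hC := measurable_expNegCoords
  rw [integral_map (Finset.measurable_restrict I).aemeasurable, integral_map hC.aemeasurable,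
    integral_map hN.aemeasurable, ← integral_toReal]
  · refine integral_congr_ae (Eventually.of_forall fun ω => ?_)
    simp only [Finset.restrict, expNegCoords]
    rw [lintegral_finsetSum _ fun i _ => measurable_const.indicator i.1.2]
    simp_rw [lintegral_indicator_const (Subtype.prop (_ : {A : Set ℝ // MeasurableSet A})),
      expNeg_sum, expNeg_nsmul, ENNReal.toReal_prod, ENNReal.toReal_pow]
  · refine (measurable_expNeg.comp ?_).aemeasurable
    refine (Measure.measurable_lintegral ?_).comp hN
    exact Finset.measurable_sum _ fun i _ => measurable_const.indicator i.1.2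
  · exact Eventually.of_forall fun ω => (expNeg_ne_top _).lt_top
  · have : Measurable fun x : {A : Set ℝ // MeasurableSet A} → unitInterval =>
        ∏ i, (I.restrict x i : ℝ) ^ k i := by
      refine Finset.measurable_prod _ fun i _ => Measurable.pow_const ?_ _
      exact measurable_subtype_coe.comp (measurable_pi_apply _)
    exact (this.comp hC).aestronglyMeasurable
  · have : Measurable fun x : {A : Set ℝ // MeasurableSet A} → unitInterval =>
        ∏ i, (I.restrict x i : ℝ) ^ k i := by
      refine Finset.measurable_prod _ fun i _ => Measurable.pow_const ?_ _
      exact measurable_subtype_coe.comp (measurable_pi_apply _)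
    exact this.aestronglyMeasurable
  · have : Measurable fun x : I → unitInterval => ∏ i, (x i : ℝ) ^ k i := by
      refine Finset.measurable_prod _ fun i _ => Measurable.pow_const ?_ _
      exact measurable_subtype_coe.comp (measurable_pi_apply _)
    exact this.aestronglyMeasurable

/-- Laplace functionals at step functions give all moments of the finite-dimensional projections,
the projections determine the law on the infinite product of unit intervals, and the coordinates
generate the σ-algebra on measures. -/
theorem identDistrib_of_laplace {Ω Ω' : Type*} [MeasurableSpace Ω] [MeasurableSpace Ω']
    {P : Measure Ω} {P' : Measure Ω'} [IsProbabilityMeasure P] [IsProbabilityMeasure P']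
    {N : Ω → Measure ℝ} {N' : Ω' → Measure ℝ} (hN : Measurable N) (hN' : Measurable N')
    (h : ∀ f : ℝ → ℝ≥0∞, Measurable f →
      ∫⁻ ω, expNeg (∫⁻ x, f x ∂N ω) ∂P = ∫⁻ ω, expNeg (∫⁻ x, f x ∂N' ω) ∂P') :
    IdentDistrib N N' P P' := by
  refine ⟨hN.aemeasurable, hN'.aemeasurable, ?_⟩
  have hC := measurable_expNegCoords
  have : IsProbabilityMeasure (P.map N) := Measure.isProbabilityMeasure_map hN.aemeasurable
  have : IsProbabilityMeasure (P'.map N') := Measure.isProbabilityMeasure_map hN'.aemeasurable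
  have : IsProbabilityMeasure ((P.map N).map expNegCoords) :=
    Measure.isProbabilityMeasure_map hC.aemeasurable
  have : IsProbabilityMeasure ((P'.map N').map expNegCoords) :=
    Measure.isProbabilityMeasure_map hC.aemeasurable
  have hproj : (P.map N).map expNegCoords = (P'.map N').map expNegCoords := by
    refine IsProjectiveLimit.unique
      (P := fun I : Finset {A : Set ℝ // MeasurableSet A} =>
        ((P'.map N').map expNegCoords).map I.restrict) (fun I => ?_) (fun I => rfl)
    have := Measure.isProbabilityMeasure_map (μ := (P.map N).map expNegCoords)
      (Finset.measurable_restrict I).aemeasurable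
    have := Measure.isProbabilityMeasure_map (μ := (P'.map N').map expNegCoords)
      (Finset.measurable_restrict I).aemeasurable
    refine ext_of_moments_unitInterval fun k => ?_
    rw [integral_expNegCoords_map hN, integral_expNegCoords_map hN', h]
    exact Finset.measurable_sum _ fun i _ => measurable_const.indicator i.1.2
  ext S hS
  obtain ⟨T, hT, rfl⟩ := instMeasurableSpace_le_comap_expNegCoords S hS
  rw [← Measure.map_apply hC hT, hproj, Measure.map_apply hC hT]

/-! ### Random trees -/

/-- A product measure indexed by words is the product of its root coordinate and of the independent
branches. -/
lemma infinitePi_list_map {α : Type*} [MeasurableSpace α] (μ : Measure α)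
    [IsProbabilityMeasure μ] :
    (Measure.infinitePi fun _ : List ℕ => μ).map
        (fun x => (x [], fun (i : ℕ) (w : List ℕ) => x (i :: w))) =
      μ.prod (Measure.infinitePi fun _ : ℕ => Measure.infinitePi fun _ : List ℕ => μ) := by
  have hind : iIndepFun (fun (v : List ℕ) (x : List ℕ → α) => x v)
      (Measure.infinitePi fun _ : List ℕ => μ) :=
    iIndepFun_infinitePi (X := fun _ x => x) fun _ => measurable_id
  have hI : IndepFun (fun x : List ℕ → α => x [])
      (fun (x : List ℕ → α) (p : ℕ × List ℕ) => x (p.1 :: p.2))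
      (Measure.infinitePi fun _ : List ℕ => μ) := by
    have h := indep_iSup_of_disjoint
      (m := fun v : List ℕ => MeasurableSpace.comap (fun x : List ℕ → α => x v) inferInstance)
      (fun v => (measurable_pi_apply v).comap_le) hind (S := {[]}) (T := {[]}ᶜ)
      disjoint_compl_right
    refine indep_of_indep_of_le_left (indep_of_indep_of_le_right h ?_) ?_
    · rw [← measurable_iff_comap_le]
      refine @measurable_pi_iff _ _ _ (_) _ _ |>.2 fun p => ?_
      rw [measurable_iff_comap_le]
      exact le_iSup₂_of_le (p.1 :: p.2) (by simp) le_rfl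
    · exact le_iSup₂_of_le ([] : List ℕ) rfl le_rfl
  have h1 := (indepFun_iff_map_prod_eq_prod_map_map (measurable_pi_apply _).aemeasurable
    (measurable_pi_iff.2 fun p => measurable_pi_apply _).aemeasurable).1 hI
  rw [Measure.infinitePi_map_eval, Measure.map_infinitePi_infinitePi_of_inj
    (f := fun p : ℕ × List ℕ => p.1 :: p.2) (fun p q h => by
      obtain ⟨h1, h2⟩ := List.cons.inj h; exact Prod.ext h1 h2)] at h1
  have h2 := congrArg (Measure.map (Prod.map id (MeasurableEquiv.curry ℕ (List ℕ) α))) h1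
  rw [Measure.map_map (by fun_prop) (by fun_prop), ← Measure.map_prod_map _ _ (by fun_prop)
    (by fun_prop), Measure.infinitePi_map_curry (fun _ _ => μ), Measure.map_id] at h2
  exact h2

/-- Offspring number and displacement of every word. -/
abbrev TreeData := List ℕ → ℕ × ℝ

namespace TreeData

/-- The `i`-th branch at the root. -/
def branch (x : TreeData) (i : ℕ) : TreeData := fun w => x (i :: w)

/-- Membership of a word in the family tree. -/
def Mem (x : TreeData) (v : List ℕ) : Prop := InTree (fun w => (x w).1) v

/-- Position of a vertex relative to the root. -/
noncomputable def pos (x : TreeData) (v : List ℕ) : ℝ := treePosition (fun w => (x w).2) v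

/-- The tree with all displacements reversed. -/
def reflect (x : TreeData) : TreeData := fun v => ((x v).1, -(x v).2)

/-- The number of vertices in the first `n` generations. -/
def size : ℕ → TreeData → ℕ
  | 0, _ => 0
  | n + 1, x => 1 + ∑ i ∈ Finset.range (x []).1, size n (x.branch i)

@[simp] lemma mem_nil (x : TreeData) : x.Mem [] := trivial

lemma mem_cons (x : TreeData) (i : ℕ) (w : List ℕ) :
    x.Mem (i :: w) ↔ i < (x []).1 ∧ (x.branch i).Mem w := Iff.rfl

@[simp] lemma pos_nil (x : TreeData) : x.pos [] = 0 := rfl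

lemma pos_cons (x : TreeData) (i : ℕ) (w : List ℕ) :
    x.pos (i :: w) = (x.branch i []).2 + (x.branch i).pos w := rfl

@[fun_prop] lemma measurable_branch (i : ℕ) : Measurable fun x : TreeData => x.branch i :=
  measurable_pi_iff.2 fun w => measurable_pi_apply (i :: w)

lemma measurable_reflect : Measurable reflect :=
  measurable_pi_iff.2 fun w => (measurable_fst.comp (measurable_pi_apply w)).prodMk
    (measurable_snd.comp (measurable_pi_apply w)).neg

lemma measurableSet_mem (v : List ℕ) : MeasurableSet {x : TreeData | x.Mem v} := by
  induction v with
  | nil => simp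
  | cons i w ih =>
    simp only [mem_cons]
    refine MeasurableSet.inter ?_ (measurable_branch i ih)
    exact (measurable_fst.comp (measurable_pi_apply ([] : List ℕ))) measurableSet_Ioi

lemma measurable_pos (v : List ℕ) : Measurable fun x : TreeData => x.pos v := by
  induction v with
  | nil => exact measurable_const
  | cons i w ih =>
    simp only [pos_cons]
    exact (measurable_snd.comp (measurable_pi_apply ([i]))).add (ih.comp (measurable_branch i))

lemma measurable_size (n : ℕ) : Measurable (size n) := by
  induction n with
  | zero => exact measurable_const
  | succ n ih =>
    have h : Measurable fun p : ℕ × (ℕ → ℕ) => 1 + ∑ i ∈ Finset.range p.1, p.2 i :=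
      measurable_from_prod_countable_right fun k => by
        change Measurable fun p : ℕ → ℕ => 1 + ∑ i ∈ Finset.range k, p i
        fun_prop
    exact h.comp ((measurable_fst.comp (measurable_pi_apply ([] : List ℕ))).prodMk
      (measurable_pi_iff.2 fun i => ih.comp (measurable_branch i)))

@[simp] lemma pos_reflect (x : TreeData) (v : List ℕ) : x.reflect.pos v = -x.pos v := by
  induction v generalizing x with
  | nil => simp
  | cons i w ih =>
    rw [pos_cons, pos_cons]
    have : x.reflect.branch i = (x.branch i).reflect := rfl
    rw [this, ih]
    simp only [reflect]
    ring

open Classical in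
/-- Sum of `g` over the positions of all vertices. -/
noncomputable def vsum (g : ℝ → ℝ≥0∞) (x : TreeData) : ℝ≥0∞ :=
  ∑' v, if x.Mem v then g (x.pos v) else 0

/-- The number of vertices. -/
noncomputable def total (x : TreeData) : ℝ≥0∞ := vsum (fun _ => 1) x

lemma measurable_ite_mem {β γ : Type*} [MeasurableSpace β] [MeasurableSpace γ] [Zero γ]
    {T : β → TreeData} (hT : Measurable T) (v : List ℕ) [∀ b, Decidable ((T b).Mem v)]
    {g : β → γ} (hg : Measurable g) : Measurable fun b => if (T b).Mem v then g b else 0 :=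
  Measurable.ite (hT (measurableSet_mem v)) hg measurable_const

lemma measurable_vsum {β : Type*} [MeasurableSpace β] {g : β → ℝ → ℝ≥0∞} {T : β → TreeData}
    (hg : Measurable fun p : β × ℝ => g p.1 p.2) (hT : Measurable T) :
    Measurable fun b => vsum (g b) (T b) := by
  classical
  refine Measurable.tsum fun v => ?_
  exact measurable_ite_mem hT v (hg.comp (measurable_id.prodMk ((measurable_pos v).comp hT)))

lemma measurable_total : Measurable total := measurable_vsum measurable_const measurable_id

lemma lintegral_rootedCluster (x : TreeData) {g : ℝ → ℝ≥0∞} (hg : Measurable g) :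
    ∫⁻ y, g y ∂rootedCluster (fun v => (x v).1) (fun v => (x v).2) = vsum g x := by
  classical
  rw [rootedCluster, lintegral_sum_measure, vsum]
  congr 1 with v
  by_cases h : InTree (fun v => (x v).1) v
  · rw [if_pos h, if_pos (show x.Mem v from h), lintegral_dirac' _ hg]
    rfl
  · rw [if_neg h, if_neg (show ¬x.Mem v from h), lintegral_zero_measure]

lemma vsum_reflect (x : TreeData) (g : ℝ → ℝ≥0∞) :
    vsum g x.reflect = vsum (fun y => g (-y)) x := by
  simp only [vsum, pos_reflect]
  rfl

/-- A nonempty word is uniquely a first letter followed by a word: a sum over vertices splits into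
the root and the branches. -/
lemma hasSum_list {E : Type*} [AddCommMonoid E] [TopologicalSpace E] [ContinuousAdd E]
    {F : List ℕ → E} {a : E} (h : HasSum (fun p : ℕ × List ℕ => F (p.1 :: p.2)) a) :
    HasSum F (F [] + a) := by
  have hinj : Function.Injective fun p : ℕ × List ℕ => p.1 :: p.2 := fun p q h => by
    obtain ⟨h1, h2⟩ := List.cons.inj h
    exact Prod.ext h1 h2
  have hc : IsCompl ({[]} : Set (List ℕ)) (range fun p : ℕ × List ℕ => p.1 :: p.2) := by
    constructor
    · rw [Set.disjoint_left]
      rintro v rfl ⟨p, hp⟩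
      simp at hp
    · rw [codisjoint_iff]
      refine eq_univ_iff_forall.2 fun v => ?_
      cases v with
      | nil => exact Or.inl rfl
      | cons i w => exact Or.inr ⟨(i, w), rfl⟩
  refine HasSum.add_isCompl hc (hasSum_unique _) ?_
  exact (hinj.hasSum_range_iff).2 h

lemma ennreal_tsum_list (F : List ℕ → ℝ≥0∞) :
    ∑' v, F v = F [] + ∑' i, ∑' w, F (i :: w) := by
  rw [← ENNReal.tsum_prod]
  exact (hasSum_list ENNReal.summable.hasSum).tsum_eq

open Classical in
lemma size_eq_tsum (n : ℕ) (x : TreeData) :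
    (size n x : ℝ≥0∞) = ∑' v, if x.Mem v ∧ v.length < n then 1 else 0 := by
  induction n generalizing x with
  | zero => simp [size]
  | succ n ih =>
    rw [ennreal_tsum_list]
    simp only [size, mem_nil, List.length_nil, Nat.zero_lt_succ, and_self, if_true, Nat.cast_add,
      Nat.cast_one, Nat.cast_sum, ih]
    congr 1
    rw [tsum_eq_sum (s := Finset.range (x []).1)]
    · refine Finset.sum_congr rfl fun i hi => ?_
      congr 1 with w
      simp [mem_cons, Finset.mem_range.1 hi]
    · intro i hi
      simp only [Finset.mem_range] at hi
      simp [mem_cons, hi]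

lemma tendsto_size (x : TreeData) :
    Tendsto (fun n => (size n x : ℝ≥0∞)) atTop (𝓝 x.total) := by
  classical
  let : MeasurableSpace (List ℕ) := ⊤
  have : MeasurableSingletonClass (List ℕ) := ⟨fun _ => trivial⟩
  have h : ∀ n, (size n x : ℝ≥0∞) = ∫⁻ v, (if x.Mem v ∧ v.length < n then 1 else 0)
      ∂Measure.count := fun n => by rw [size_eq_tsum, lintegral_count]
  simp_rw [h]
  rw [total, vsum, ← lintegral_count]
  refine lintegral_tendsto_of_tendsto_of_monotone
    (fun n => (measurable_of_countable _).aemeasurable) (Eventually.of_forall fun v n k hnk => ?_)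
    (Eventually.of_forall fun v => tendsto_const_nhds.congr' ?_)
  · dsimp only
    split_ifs with h1 h2
    · exact le_rfl
    · exact absurd ⟨h1.1, h1.2.trans_le hnk⟩ h2
    · simp
    · exact le_rfl
  · filter_upwards [eventually_gt_atTop v.length] with n hn
    simp [hn]

lemma size_mono (x : TreeData) : Monotone fun n => size n x := by
  classical
  intro n k hnk
  have : (size n x : ℝ≥0∞) ≤ size k x := by
    rw [size_eq_tsum, size_eq_tsum]
    refine ENNReal.tsum_le_tsum fun v => ?_
    split_ifs with h1 h2
    · exact le_rfl
    · exact absurd ⟨h1.1, h1.2.trans_le hnk⟩ h2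
    · simp
    · exact le_rfl
  exact_mod_cast this

end TreeData

open TreeData

/-! ### The law of the random tree -/

/-- Law of the offspring number and the displacement of one individual. -/
noncomputable def nodeLaw (m : ℝ≥0) (κ : Measure ℝ) : Measure (ℕ × ℝ) := (poissonMeasure m).prod κ

/-- Law of the random family tree. -/
noncomputable def treeLaw (m : ℝ≥0) (κ : Measure ℝ) : Measure TreeData :=
  Measure.infinitePi fun _ => nodeLaw m κ

section TreeLaw

variable {m : ℝ≥0} {κ : Measure ℝ} [IsProbabilityMeasure κ]

instance : IsProbabilityMeasure (nodeLaw m κ) := by unfold nodeLaw; infer_instance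

instance : IsProbabilityMeasure (treeLaw m κ) := by unfold treeLaw; infer_instance

lemma treeLaw_map_root_branches :
    (treeLaw m κ).map (fun x => (x [], x.branch)) =
      (nodeLaw m κ).prod (Measure.infinitePi fun _ : ℕ => treeLaw m κ) :=
  infinitePi_list_map (nodeLaw m κ)

lemma measurable_root_branches : Measurable fun x : TreeData => (x [], x.branch) :=
  (measurable_pi_apply _).prodMk (measurable_pi_iff.2 fun i => measurable_branch i)

/-- Reflection acts on each node separately and preserves the node law when `κ` is symmetric. -/
lemma treeLaw_map_reflect (hκ : κ.map (fun x => -x) = κ) :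
    (treeLaw m κ).map reflect = treeLaw m κ := by
  have h := Measure.infinitePi_map_pi (fun _ : List ℕ => nodeLaw m κ)
    (f := fun _ (p : ℕ × ℝ) => (p.1, -p.2)) (fun _ => by fun_prop)
  have h2 : (nodeLaw m κ).map (fun p : ℕ × ℝ => (p.1, -p.2)) = nodeLaw m κ := by
    have h3 := Measure.map_prod_map (poissonMeasure m) κ (f := id) (g := fun x => -x)
      measurable_id measurable_neg
    rw [hκ, Measure.map_id] at h3
    exact h3.symm
  simp only [h2] at h
  exact h

/-- Integration over the root and the branches. -/
lemma lintegral_treeLaw {F : (ℕ × ℝ) × (ℕ → TreeData) → ℝ≥0∞} (hF : Measurable F) :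
    ∫⁻ x, F (x [], x.branch) ∂treeLaw m κ =
      ∫⁻ p, ∫⁻ T, F (p, T) ∂(Measure.infinitePi fun _ : ℕ => treeLaw m κ) ∂nodeLaw m κ := by
  rw [← lintegral_map hF measurable_root_branches, treeLaw_map_root_branches,
    lintegral_prod _ hF.aemeasurable]

lemma lintegral_nodeLaw_fst (F : ℕ → ℝ≥0∞) :
    ∫⁻ p, F p.1 ∂nodeLaw m κ = ∫⁻ n, F n ∂poissonMeasure m := by
  have hF : Measurable fun p : ℕ × ℝ => F p.1 := (measurable_of_countable F).comp measurable_fst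
  rw [nodeLaw, lintegral_prod _ hF.aemeasurable]
  simp

lemma measurable_mul_prod_branches {φ : TreeData → ℝ≥0∞} (hφ : Measurable φ) (c : ℝ≥0∞) :
    Measurable fun q : (ℕ × ℝ) × (ℕ → TreeData) =>
      c * ∏ i ∈ Finset.range q.1.1, φ (q.2 i) := by
  have h1 : Measurable fun r : ℕ × (ℕ → TreeData) => c * ∏ i ∈ Finset.range r.1, φ (r.2 i) :=
    measurable_from_prod_countable_right fun k => measurable_const.mul
      (Finset.measurable_prod (Finset.range k) fun i _ =>
        (hφ.comp (measurable_pi_apply i) : Measurable fun T : ℕ → TreeData => φ (T i)))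
  have h2 : Measurable fun q : (ℕ × ℝ) × (ℕ → TreeData) => (q.1.1, q.2) :=
    (measurable_fst.comp measurable_fst).prodMk measurable_snd
  exact h1.comp h2

/-- Exponential moments of the generation sizes. -/
lemma lintegral_pow_size_le {a s : ℝ} (ha : 1 ≤ a) (hs : 1 ≤ s)
    (h : s * Real.exp (m * (a - 1)) ≤ a) (n : ℕ) :
    ∫⁻ x, ENNReal.ofReal (s ^ size n x) ∂treeLaw m κ ≤ ENNReal.ofReal a := by
  induction n with
  | zero =>
    simp only [size, pow_zero, lintegral_const, measure_univ, mul_one]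
    exact ENNReal.ofReal_le_ofReal ha
  | succ n ih =>
    -- The branches are independent copies, so one more generation replaces `g` by `s E[g^K]` with
    -- `K` Poisson. This is monotone in `g`, and the hypothesis says that it maps `a` below `a`.
    set g : ℝ≥0∞ := ∫⁻ x, ENNReal.ofReal (s ^ size n x) ∂treeLaw m κ with hg
    have hmeas : Measurable fun x : TreeData => ENNReal.ofReal (s ^ size n x) :=
      (measurable_of_countable fun k : ℕ => ENNReal.ofReal (s ^ k)).comp (measurable_size n)
    have hprod' : ∀ k, Measurable fun T : ℕ → TreeData =>
        ∏ i ∈ Finset.range k, ENNReal.ofReal (s ^ size n (T i)) := fun k =>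
      Finset.measurable_prod _ fun i _ => hmeas.comp (measurable_pi_apply i)
    let F : (ℕ × ℝ) × (ℕ → TreeData) → ℝ≥0∞ := fun q =>
      ENNReal.ofReal s * ∏ i ∈ Finset.range q.1.1, ENNReal.ofReal (s ^ size n (q.2 i))
    have hF : Measurable F := measurable_mul_prod_branches hmeas _
    have h1 : ∀ x : TreeData, ENNReal.ofReal (s ^ size (n + 1) x) = F (x [], x.branch) :=
      fun x => by
        simp only [size, F]
        rw [pow_add, pow_one, ENNReal.ofReal_mul (by linarith), ← Finset.prod_pow_eq_pow_sum,
          ENNReal.ofReal_prod_of_nonneg fun i _ => by positivity]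
    simp_rw [h1]
    rw [lintegral_treeLaw hF]
    have h2 : ∀ p : ℕ × ℝ, ∫⁻ T, F (p, T) ∂(Measure.infinitePi fun _ : ℕ => treeLaw m κ) =
        ENNReal.ofReal s * g ^ p.1 := fun p => by
      simp only [F]
      rw [lintegral_const_mul _ (hprod' p.1)]
      congr 1
      rw [lintegral_prod_eq_prod_lintegral_of_indepFun (Finset.range p.1)
        (fun i (T : ℕ → TreeData) => ENNReal.ofReal (s ^ size n (T i)))
        (iIndepFun_infinitePi (X := fun _ x => ENNReal.ofReal (s ^ size n x)) fun _ => hmeas)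
        fun i => hmeas.comp (measurable_pi_apply i)]
      have h3 : ∀ i : ℕ, ∫⁻ T : ℕ → TreeData, ENNReal.ofReal (s ^ size n (T i))
          ∂(Measure.infinitePi fun _ : ℕ => treeLaw m κ) = g := fun i => by
        exact (measurePreserving_eval_infinitePi (fun _ : ℕ => treeLaw m κ) i).lintegral_comp hmeas
      simp [h3]
    simp_rw [h2]
    calc ∫⁻ p, ENNReal.ofReal s * g ^ p.1 ∂nodeLaw m κ
        = ENNReal.ofReal s * ∫⁻ k, g ^ k ∂poissonMeasure m := by
          have : Measurable fun p : ℕ × ℝ => g ^ p.1 :=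
            (measurable_of_countable fun k : ℕ => g ^ k).comp measurable_fst
          rw [lintegral_const_mul _ this, lintegral_nodeLaw_fst fun k => g ^ k]
      _ ≤ ENNReal.ofReal s * ∫⁻ k, (ENNReal.ofReal a) ^ k ∂poissonMeasure m := by
          gcongr
      _ = ENNReal.ofReal (s * Real.exp (m * (a - 1))) := by
          rw [ENNReal.ofReal_mul (by linarith)]
          congr 1
          rw [lintegral_countable']
          simp_rw [poissonMeasure_singleton]
          have := (NormedSpace.expSeries_div_hasSum_exp (𝔸 := ℝ) ((m : ℝ) * a)).mul_left
            (Real.exp (-m))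
          rw [← Real.exp_eq_exp_ℝ, ← Real.exp_add] at this
          have h4 : -(m : ℝ) + m * a = m * (a - 1) := by ring
          rw [h4] at this
          rw [← this.tsum_eq, ENNReal.ofReal_tsum_of_nonneg (fun n => by positivity) this.summable]
          congr 1 with k
          rw [← ENNReal.ofReal_pow (by linarith), ← ENNReal.ofReal_mul (by positivity), mul_pow]
          congr 1
          ring
      _ ≤ ENNReal.ofReal a := ENNReal.ofReal_le_ofReal h

/-- In the subcritical case, the number of vertices has a finite third moment. -/
theorem lintegral_total_pow_three_lt_top (hm₀ : 0 < m) (hm : m < 1) :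
    ∫⁻ x, x.total ^ 3 ∂treeLaw m κ < ∞ := by
  have hm₀' : (0 : ℝ) < m := by exact_mod_cast hm₀
  have hm' : (m : ℝ) < 1 := by exact_mod_cast hm
  -- The exponent `log a - m (a - 1)` is largest at `a = 1/m`, and `c` is its value there. With `s =
  -- e^c` the condition `s e^{m(a-1)} ≤ a` becomes an equality; `c > 0` because `log m < m - 1`.
  set c : ℝ := Real.log (m : ℝ)⁻¹ - (1 - m) with hc
  have hcpos : 0 < c := by
    have := Real.add_one_lt_exp (x := (m : ℝ) - 1) (by linarith)
    rw [hc, Real.log_inv]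
    have h2 := Real.log_lt_sub_one_of_pos hm₀' hm'.ne
    linarith
  -- The constant comes from `t³ / 3! ≤ e^t` at `t = c * size n x`; the bound is uniform in `n`.
  have hbound : ∀ n, ∫⁻ x, (size n x : ℝ≥0∞) ^ 3 ∂treeLaw m κ ≤
      ENNReal.ofReal (6 / c ^ 3) * ENNReal.ofReal ((m : ℝ)⁻¹) := fun n => by
    have h1 := lintegral_pow_size_le (m := m) (κ := κ) (a := (m : ℝ)⁻¹) (s := Real.exp c)
      (by rw [one_le_inv₀ hm₀']; exact hm'.le) (Real.one_le_exp hcpos.le)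
      (by rw [← Real.exp_add, mul_sub, mul_inv_cancel₀ hm₀'.ne', hc, mul_one]
          simp only [sub_add_cancel]
          rw [Real.exp_log (by positivity)]) n
    refine le_trans ?_ (mul_le_mul_right h1 _)
    have hmeas : Measurable fun x : TreeData => ENNReal.ofReal (Real.exp c ^ size n x) :=
      (measurable_of_countable fun k : ℕ => ENNReal.ofReal (Real.exp c ^ k)).comp
        (measurable_size n)
    rw [← lintegral_const_mul _ hmeas]
    refine lintegral_mono fun x => ?_
    rw [← ENNReal.ofReal_mul (by positivity), ← ENNReal.ofReal_natCast, ← ENNReal.ofReal_pow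
      (by positivity)]
    refine ENNReal.ofReal_le_ofReal ?_
    rw [← Real.exp_nat_mul]
    have := Real.pow_div_factorial_le_exp (x := size n x * c) (by positivity) 3
    rw [div_mul_eq_mul_div, le_div_iff₀ (by positivity)]
    rw [div_le_iff₀ (by positivity)] at this
    norm_num [Nat.factorial] at this
    nlinarith
  have hlim : Tendsto (fun n => ∫⁻ x, (size n x : ℝ≥0∞) ^ 3 ∂treeLaw m κ) atTop
      (𝓝 (∫⁻ x, x.total ^ 3 ∂treeLaw m κ)) := by
    refine lintegral_tendsto_of_tendsto_of_monotone (fun n => ?_)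
      (Eventually.of_forall fun x n k hnk => ?_) (Eventually.of_forall fun x => ?_)
    · exact ((measurable_of_countable fun k : ℕ => (k : ℝ≥0∞) ^ 3).comp
        (measurable_size n)).aemeasurable
    · have := size_mono x hnk
      dsimp only at this ⊢
      gcongr
    · exact ((ENNReal.continuous_pow 3).tendsto _).comp (tendsto_size x)
  refine (le_of_tendsto' hlim hbound).trans_lt ?_
  exact ENNReal.mul_lt_top ENNReal.ofReal_lt_top ENNReal.ofReal_lt_top

end TreeLaw

open TreeData

/-! ### The Laplace functional of the branching-cluster process -/

lemma IsProbDensity.isProbabilityMeasure {f : ℝ → ℝ} (hf : IsProbDensity f) :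
    IsProbabilityMeasure (densityMeasure f) := by
  refine ⟨?_⟩
  rw [densityMeasure, withDensity_apply _ MeasurableSet.univ, Measure.restrict_univ,
    ← ofReal_integral_eq_lintegral_ofReal hf.integrable (Eventually.of_forall hf.nonneg),
    hf.integral_eq_one, ENNReal.ofReal_one]

section Laplace

variable {Ω : Type*} [MeasurableSpace Ω] {P : Measure Ω} {ν m : ℝ} {f : ℝ → ℝ}
  {U : ℕ → Ω → ℝ} {ξ : ℕ → List ℕ → Ω → ℕ} {D : ℕ → List ℕ → Ω → ℝ}

/-- The family trees of the immigrants. -/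
def treesOf (ξ : ℕ → List ℕ → Ω → ℕ) (D : ℕ → List ℕ → Ω → ℝ) (ω : Ω) (j : ℕ) : TreeData :=
  fun v => (ξ j v ω, D j v ω)

omit [MeasurableSpace Ω] in
lemma lintegral_clusterProcess (ω : Ω) {g : ℝ → ℝ≥0∞} (hg : Measurable g) :
    ∫⁻ y, g y ∂(clusterProcess U ξ D ω) =
      ∑' j, vsum (fun y => g (y + U j ω)) (treesOf ξ D ω j) := by
  rw [clusterProcess, lintegral_sum_measure]
  congr 1 with j
  rw [lintegral_map hg (by fun_prop)]
  exact lintegral_rootedCluster (treesOf ξ D ω j) (hg.comp (measurable_add_const (U j ω)))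

lemma IsBranchingData.measurable_treesOf (h : IsBranchingData P ν m f U ξ D) :
    Measurable (treesOf ξ D) :=
  measurable_pi_iff.2 fun j => measurable_pi_iff.2 fun v =>
    (h.measurable_ξ j v).prodMk (h.measurable_D j v)

lemma measurable_vsum_shift {β : Type*} [MeasurableSpace β] {g : ℝ → ℝ≥0∞} (hg : Measurable g)
    {a : β → ℝ} (ha : Measurable a) {T : β → TreeData} (hT : Measurable T) :
    Measurable fun b => vsum (fun y => g (y + a b)) (T b) :=
  measurable_vsum (g := fun b y => g (y + a b))
    (hg.comp (measurable_snd.add (ha.comp measurable_fst))) hT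

lemma IsBranchingData.measurable_lintegral (h : IsBranchingData P ν m f U ξ D) {g : ℝ → ℝ≥0∞}
    (hg : Measurable g) : Measurable fun ω => ∫⁻ y, g y ∂(clusterProcess U ξ D ω) := by
  simp_rw [lintegral_clusterProcess _ hg]
  exact Measurable.tsum fun j => measurable_vsum_shift hg (h.poisson.measurable j)
    ((measurable_pi_apply j).comp h.measurable_treesOf)

lemma IsBranchingData.measurable_superposition (h : IsBranchingData P ν m f U ξ D) :
    Measurable (clusterProcess U ξ D) := by
  refine Measure.measurable_of_measurable_coe _ fun A hA => ?_
  simp_rw [← lintegral_indicator_one hA]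
  exact h.measurable_lintegral (measurable_one.indicator hA)

lemma IsBranchingData.map_trees [IsProbabilityMeasure P] (hf : IsProbDensity f)
    (h : IsBranchingData P ν m f U ξ D) :
    P.map (treesOf ξ D) =
      Measure.infinitePi fun _ : ℕ => treeLaw m.toNNReal (densityMeasure f) := by
  have := hf.isProbabilityMeasure
  have h1 := h.indep.map_fun_eq_infinitePi_map
    fun p : ℕ × List ℕ => (h.measurable_ξ p.1 p.2).prodMk (h.measurable_D p.1 p.2)
  simp only [h.law] at h1
  have h2 := congrArg (Measure.map (MeasurableEquiv.curry ℕ (List ℕ) (ℕ × ℝ))) h1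
  rw [Measure.map_map (MeasurableEquiv.measurable _)
    (measurable_pi_iff.2 fun p : ℕ × List ℕ =>
      (h.measurable_ξ p.1 p.2).prodMk (h.measurable_D p.1 p.2)),
    Measure.infinitePi_map_curry
      fun _ _ => (poissonMeasure m.toNNReal).prod (densityMeasure f)] at h2
  exact h2

lemma IsBranchingData.map_points_trees [IsProbabilityMeasure P] (hf : IsProbDensity f)
    (h : IsBranchingData P ν m f U ξ D) :
    P.map (fun ω => ((fun j => U j ω), treesOf ξ D ω)) =
      (P.map fun ω j => U j ω).prod
        (Measure.infinitePi fun _ : ℕ => treeLaw m.toNNReal (densityMeasure f)) := by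
  have h1 : IndepFun (fun ω j => U j ω) (treesOf ξ D) P :=
    h.indep_immigrants.comp (φ := id)
      (ψ := fun (x : ℕ × List ℕ → ℕ × ℝ) (j : ℕ) (v : List ℕ) => x (j, v)) measurable_id
      (measurable_pi_iff.2 fun j => measurable_pi_iff.2 fun v => measurable_pi_apply (j, v))
  rw [(indepFun_iff_map_prod_eq_prod_map_map
    (measurable_pi_iff.2 h.poisson.measurable).aemeasurable
    h.measurable_treesOf.aemeasurable).1 h1, h.map_trees hf]

/-- Laplace functional of one cluster with root at `u`. -/
noncomputable def clusterLaplace (μ : Measure TreeData) (g : ℝ → ℝ≥0∞) (u : ℝ) : ℝ≥0∞ :=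
  ∫⁻ x, expNeg (vsum (fun y => g (y + u)) x) ∂μ

lemma clusterLaplace_le_one (μ : Measure TreeData) [IsProbabilityMeasure μ] (g : ℝ → ℝ≥0∞)
    (u : ℝ) : clusterLaplace μ g u ≤ 1 :=
  (lintegral_mono fun _ => expNeg_le_one _).trans (by simp)

lemma measurable_clusterLaplace (μ : Measure TreeData) [SFinite μ] {g : ℝ → ℝ≥0∞}
    (hg : Measurable g) : Measurable (clusterLaplace μ g) := by
  refine Measurable.lintegral_prod_right' (f := fun p : ℝ × TreeData =>
    expNeg (vsum (fun y => g (y + p.1)) p.2)) ?_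
  exact measurable_expNeg.comp (measurable_vsum_shift hg measurable_fst measurable_snd)

/-- For fixed immigrant positions the clusters are independent. Writing the product of their
transforms as `e^{-∑ⱼ f(uⱼ)}` makes the Laplace functional of the Poisson points applicable with `f`
the `negLog` of `clusterLaplace`. -/
lemma lintegral_infinitePi_expNeg_tsum (μ : Measure TreeData) [IsProbabilityMeasure μ]
    {g : ℝ → ℝ≥0∞} (hg : Measurable g) (u : ℕ → ℝ) :
    ∫⁻ T, expNeg (∑' j, vsum (fun y => g (y + u j)) (T j)) ∂(Measure.infinitePi fun _ : ℕ => μ) =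
      expNeg (∑' j, negLog (clusterLaplace μ g (u j))) := by
  have hm : ∀ j, Measurable fun x : TreeData => vsum (fun y => g (y + u j)) x := fun j =>
    measurable_vsum_shift hg measurable_const measurable_id
  rw [lintegral_expNeg_tsum
    (X := fun j (T : ℕ → TreeData) => vsum (fun y => g (y + u j)) (T j))
    (fun j => (hm j).comp (measurable_pi_apply j))
    (iIndepFun_infinitePi (X := fun j x => vsum (fun y => g (y + u j)) x) hm)]
  congr 2 with j
  congr 1
  exact (measurePreserving_eval_infinitePi (fun _ : ℕ => μ) j).lintegral_comp
    (measurable_expNeg.comp (hm j))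

/-- The Laplace functional of the branching-cluster process. -/
theorem IsBranchingData.lintegral_expNeg [IsProbabilityMeasure P] (hf : IsProbDensity f)
    (h : IsBranchingData P ν m f U ξ D) {g : ℝ → ℝ≥0∞} (hg : Measurable g) :
    ∫⁻ ω, expNeg (∫⁻ y, g y ∂(clusterProcess U ξ D ω)) ∂P =
      expNeg (ENNReal.ofReal ν *
        ∫⁻ u, (1 - clusterLaplace (treeLaw m.toNNReal (densityMeasure f)) g u)) := by
  have := hf.isProbabilityMeasure
  set μ := treeLaw m.toNNReal (densityMeasure f) with hμ
  let F : (ℕ → ℝ) × (ℕ → TreeData) → ℝ≥0∞ := fun q =>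
    expNeg (∑' j, vsum (fun y => g (y + q.1 j)) (q.2 j))
  have hF : Measurable F := measurable_expNeg.comp <| Measurable.tsum fun j =>
    measurable_vsum_shift hg ((measurable_pi_apply j).comp measurable_fst)
      ((measurable_pi_apply j).comp measurable_snd)
  have hU : Measurable fun ω j => U j ω := measurable_pi_iff.2 h.poisson.measurable
  have : IsProbabilityMeasure (P.map fun ω j => U j ω) :=
    Measure.isProbabilityMeasure_map hU.aemeasurable
  have hL : Measurable fun u => negLog (clusterLaplace μ g u) :=
    measurable_negLog.comp (measurable_clusterLaplace μ hg)
  calc ∫⁻ ω, expNeg (∫⁻ y, g y ∂(clusterProcess U ξ D ω)) ∂P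
      = ∫⁻ ω, F ((fun j => U j ω), treesOf ξ D ω) ∂P := by
        simp_rw [lintegral_clusterProcess _ hg, F]
    _ = ∫⁻ u, ∫⁻ T, F (u, T) ∂(Measure.infinitePi fun _ : ℕ => μ) ∂(P.map fun ω j => U j ω) := by
        rw [← lintegral_map hF (hU.prodMk h.measurable_treesOf), h.map_points_trees hf,
          lintegral_prod _ hF.aemeasurable]
    _ = ∫⁻ u, expNeg (∑' j, negLog (clusterLaplace μ g (u j))) ∂(P.map fun ω j => U j ω) := by
        simp_rw [F, lintegral_infinitePi_expNeg_tsum μ hg]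
    _ = ∫⁻ ω, expNeg (∑' j, negLog (clusterLaplace μ g (U j ω))) ∂P := by
        have : Measurable fun u : ℕ → ℝ => expNeg (∑' j, negLog (clusterLaplace μ g (u j))) :=
          measurable_expNeg.comp (Measurable.tsum fun j => hL.comp (measurable_pi_apply j))
        rw [lintegral_map this hU]
    _ = _ := by
        rw [h.poisson.lintegral_expNeg_tsum hL]
        simp only [expNeg_negLog (clusterLaplace_le_one μ g _)]

/-- Stationarity. -/
theorem IsBranchingData.isStationaryProcess [IsProbabilityMeasure P] (hf : IsProbDensity f)
    (h : IsBranchingData P ν m f U ξ D) : IsStationaryProcess P (clusterProcess U ξ D) := by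
  intro a
  have hN := h.measurable_superposition
  refine identDistrib_of_laplace ((Measure.measurable_map _ (measurable_add_const a)).comp hN) hN
    fun g hg => ?_
  have hg' : Measurable fun x => g (x + a) := hg.comp (measurable_add_const a)
  simp_rw [lintegral_map hg (measurable_add_const a)]
  rw [h.lintegral_expNeg hf hg', h.lintegral_expNeg hf hg]
  congr 2
  rw [← lintegral_add_right_eq_self (fun u => 1 - clusterLaplace
    (treeLaw m.toNNReal (densityMeasure f)) g u) a]
  simp only [clusterLaplace, add_assoc]

lemma IsEvenProbDensity.map_neg (hf : IsEvenProbDensity f) :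
    (densityMeasure f).map (fun x => -x) = densityMeasure f := by
  have hm : Measurable fun x => ENNReal.ofReal (f x) := hf.1.measurable.ennreal_ofReal
  refine Measure.ext_of_lintegral _ fun g hg => ?_
  have hg' : Measurable fun x => g (-x) := hg.comp measurable_neg
  rw [lintegral_map hg measurable_neg, densityMeasure,
    lintegral_withDensity_eq_lintegral_mul _ hm hg',
    lintegral_withDensity_eq_lintegral_mul _ hm hg,
    ← (Measure.measurePreserving_neg volume).lintegral_comp (hm.mul hg)]
  simp [hf.2]

/-- Reversing all displacements preserves the tree law and turns the mirror image of a cluster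
rooted at `u` into a cluster rooted at `-u`. -/
lemma clusterLaplace_neg {m : ℝ≥0} {κ : Measure ℝ} [IsProbabilityMeasure κ]
    (hκ : κ.map (fun x => -x) = κ) {g : ℝ → ℝ≥0∞} (hg : Measurable g) (u : ℝ) :
    clusterLaplace (treeLaw m κ) (fun x => g (-x)) u = clusterLaplace (treeLaw m κ) g (-u) := by
  have hmp : MeasurePreserving reflect (treeLaw m κ) (treeLaw m κ) :=
    ⟨measurable_reflect, treeLaw_map_reflect hκ⟩
  have hm : Measurable fun x : TreeData => expNeg (vsum (fun y => g (y + -u)) x) :=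
    measurable_expNeg.comp (measurable_vsum_shift hg measurable_const measurable_id)
  unfold clusterLaplace
  rw [← hmp.lintegral_comp hm]
  simp only [vsum_reflect, neg_add]

/-- Reversibility, for an even offspring density. -/
theorem IsBranchingData.isReversibleProcess [IsProbabilityMeasure P] (hf : IsEvenProbDensity f)
    (h : IsBranchingData P ν m f U ξ D) : IsReversibleProcess P (clusterProcess U ξ D) := by
  have := hf.1.isProbabilityMeasure
  have hN := h.measurable_superposition
  refine identDistrib_of_laplace ((Measure.measurable_map _ measurable_neg).comp hN) hN
    fun g hg => ?_
  have hg' : Measurable fun x => g (-x) := hg.comp measurable_neg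
  simp_rw [lintegral_map hg measurable_neg]
  rw [h.lintegral_expNeg hf.1 hg', h.lintegral_expNeg hf.1 hg]
  simp_rw [clusterLaplace_neg hf.map_neg hg]
  congr 2
  have hm : Measurable fun u => 1 - clusterLaplace (treeLaw m.toNNReal (densityMeasure f)) g u :=
    measurable_const.sub (measurable_clusterLaplace _ hg)
  exact (Measure.measurePreserving_neg volume).lintegral_comp hm

end Laplace

/-! ### Moments from Laplace transforms -/

section LaplaceMoments

variable {S : Type*} [MeasurableSpace S] {μ : Measure S} {G : S → ℝ}

/-- Split `e^{-st}` into two halves: one absorbs `t^k`, the other reduces the remaining factor `t`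
to `1 - e^{-st/2}`. The right side stays integrable over infinite measures such as the cluster
intensity. -/
lemma pow_mul_exp_neg_le {k : ℕ} {s t : ℝ} (hs : 0 < s) (ht : 0 ≤ t) :
    t ^ (k + 1) * Real.exp (-(s * t)) ≤
      (k.factorial / (s / 2) ^ k / (s / 2)) * (1 - Real.exp (-(s / 2 * t))) := by
  have h1 : t ^ k * Real.exp (-(s / 2 * t)) ≤ k.factorial / (s / 2) ^ k := by
    have := Real.pow_div_factorial_le_exp (x := s / 2 * t) (by positivity) k
    rw [Real.exp_neg, le_div_iff₀ (by positivity), ← div_eq_mul_inv, div_mul_eq_mul_div,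
      div_le_iff₀ (Real.exp_pos _)]
    rw [div_le_iff₀ (by positivity), mul_pow] at this
    linarith
  have h2 : t * Real.exp (-(s / 2 * t)) ≤ (1 - Real.exp (-(s / 2 * t))) / (s / 2) := by
    rw [le_div_iff₀ (by positivity)]
    have := Real.add_one_le_exp (s / 2 * t)
    have h3 : Real.exp (s / 2 * t) * Real.exp (-(s / 2 * t)) = 1 := by
      rw [← Real.exp_add]; simp
    nlinarith [Real.exp_pos (-(s / 2 * t))]
  have h3 : t ^ (k + 1) * Real.exp (-(s * t)) =
      (t ^ k * Real.exp (-(s / 2 * t))) * (t * Real.exp (-(s / 2 * t))) := by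
    have : -(s * t) = -(s / 2 * t) + -(s / 2 * t) := by ring
    rw [this, Real.exp_add]; ring
  have h4 : 0 ≤ t * Real.exp (-(s / 2 * t)) := by positivity
  calc _ = _ := h3
    _ ≤ _ := mul_le_mul h1 h2 h4 (by positivity)
    _ = _ := by ring

lemma integrable_pow_mul_exp_neg (hG : Measurable G) (hG0 : ∀ x, 0 ≤ G x)
    (hint : ∀ s : ℝ, 0 < s → Integrable (fun x => 1 - Real.exp (-(s * G x))) μ)
    (k : ℕ) {s : ℝ} (hs : 0 < s) :
    Integrable (fun x => G x ^ (k + 1) * Real.exp (-(s * G x))) μ := by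
  refine Integrable.mono' ((hint (s / 2) (by positivity)).const_mul
    (k.factorial / (s / 2) ^ k / (s / 2))) (by fun_prop) (Eventually.of_forall fun x => ?_)
  have := hG0 x
  rw [Real.norm_of_nonneg (by positivity)]
  exact pow_mul_exp_neg_le hs (hG0 x)

lemma hasDerivAt_integral_one_sub_exp_neg (hG : Measurable G) (hG0 : ∀ x, 0 ≤ G x)
    (hint : ∀ s : ℝ, 0 < s → Integrable (fun x => 1 - Real.exp (-(s * G x))) μ)
    {s : ℝ} (hs : 0 < s) :
    HasDerivAt (fun s => ∫ x, (1 - Real.exp (-(s * G x))) ∂μ)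
      (∫ x, G x * Real.exp (-(s * G x)) ∂μ) s := by
  -- On the neighbourhood `(s/2, ∞)` of `s` the derivative is dominated by its value at `s/2`.
  have hb := integrable_pow_mul_exp_neg hG hG0 hint 0 (s := s / 2) (by positivity)
  refine (hasDerivAt_integral_of_dominated_loc_of_deriv_le
    (F := fun s x => 1 - Real.exp (-(s * G x))) (F' := fun s x => G x * Real.exp (-(s * G x)))
    (Ioi_mem_nhds (half_lt_self hs))
    (Eventually.of_forall fun t => by fun_prop) (hint s hs) (by fun_prop)
    (Eventually.of_forall fun x t ht => ?_) hb (Eventually.of_forall fun x t ht => ?_)).2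
  · have := hG0 x
    rw [Real.norm_of_nonneg (by positivity), zero_add, pow_one]
    gcongr
    exact (mem_Ioi.1 ht).le
  · have h1 : HasDerivAt (fun t : ℝ => -(t * G x)) (-G x) t := by
      simpa using ((hasDerivAt_id t).mul_const (G x)).fun_neg
    refine (h1.exp.const_sub 1).congr_deriv ?_
    ring

lemma hasDerivAt_integral_pow_mul_exp_neg (hG : Measurable G) (hG0 : ∀ x, 0 ≤ G x)
    (hint : ∀ s : ℝ, 0 < s → Integrable (fun x => 1 - Real.exp (-(s * G x))) μ)
    (k : ℕ) {s : ℝ} (hs : 0 < s) :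
    HasDerivAt (fun s => ∫ x, G x ^ (k + 1) * Real.exp (-(s * G x)) ∂μ)
      (-∫ x, G x ^ (k + 2) * Real.exp (-(s * G x)) ∂μ) s := by
  have hb := integrable_pow_mul_exp_neg hG hG0 hint (k + 1) (s := s / 2) (by positivity)
  rw [← integral_neg]
  refine (hasDerivAt_integral_of_dominated_loc_of_deriv_le
    (F := fun s x => G x ^ (k + 1) * Real.exp (-(s * G x)))
    (F' := fun s x => -(G x ^ (k + 2) * Real.exp (-(s * G x))))
    (Ioi_mem_nhds (half_lt_self hs))
    (Eventually.of_forall fun t => by fun_prop) (integrable_pow_mul_exp_neg hG hG0 hint k hs)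
    (by fun_prop)
    (Eventually.of_forall fun x t ht => ?_) hb (Eventually.of_forall fun x t ht => ?_)).2
  · have := hG0 x
    rw [norm_neg, Real.norm_of_nonneg (by positivity)]
    gcongr
    exact (mem_Ioi.1 ht).le
  · have h1 : HasDerivAt (fun t : ℝ => -(t * G x)) (-G x) t := by
      simpa using ((hasDerivAt_id t).mul_const (G x)).fun_neg
    refine (h1.exp.const_mul (G x ^ (k + 1))).congr_deriv ?_
    ring

lemma tendsto_one_div_nat_zero : Tendsto (fun n : ℕ => 1 / ((n : ℝ) + 1)) atTop (𝓝 0) :=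
  tendsto_one_div_add_atTop_nhds_zero_nat

lemma tendsto_pow_mul_exp_neg (t : ℝ) (k : ℕ) :
    Tendsto (fun n : ℕ => t ^ k * Real.exp (-(1 / ((n : ℝ) + 1) * t))) atTop (𝓝 (t ^ k)) := by
  have h1 : Tendsto (fun n : ℕ => t ^ k * Real.exp (-(1 / ((n : ℝ) + 1) * t))) atTop
      (𝓝 (t ^ k * Real.exp (-(0 * t)))) :=
    tendsto_const_nhds.mul ((Real.continuous_exp.tendsto _).comp
      ((tendsto_one_div_nat_zero.mul_const t).neg))
  simpa using h1

lemma tendsto_integral_pow_mul_exp_neg (hG : Measurable G) (hG0 : ∀ x, 0 ≤ G x) (k : ℕ)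
    (hk : Integrable (fun x => G x ^ k) μ) :
    Tendsto (fun n : ℕ => ∫ x, G x ^ k * Real.exp (-(1 / ((n : ℝ) + 1) * G x)) ∂μ) atTop
      (𝓝 (∫ x, G x ^ k ∂μ)) := by
  refine tendsto_integral_of_dominated_convergence (fun x => G x ^ k)
    (fun n => by fun_prop) hk (fun n => Eventually.of_forall fun x => ?_)
    (Eventually.of_forall fun x => tendsto_pow_mul_exp_neg _ k)
  have := hG0 x
  rw [Real.norm_of_nonneg (by positivity)]
  refine mul_le_of_le_one_right (by positivity) (Real.exp_le_one_iff.2 ?_)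
  have : 0 ≤ 1 / ((n : ℝ) + 1) * G x := by positivity
  linarith

/-- The damped integrands increase as the damping `1/(n+1)` tends to `0`, so monotone convergence
yields integrability of the limit together with its value. -/
lemma integral_eq_of_tendsto_exp_neg (hG : Measurable G) (hG0 : ∀ x, 0 ≤ G x) (k : ℕ) {R : ℝ}
    (hi : ∀ n : ℕ, Integrable (fun x => G x ^ k * Real.exp (-(1 / ((n : ℝ) + 1) * G x))) μ)
    (h : Tendsto (fun n : ℕ => ∫ x, G x ^ k * Real.exp (-(1 / ((n : ℝ) + 1) * G x)) ∂μ) atTop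
      (𝓝 R)) : Integrable (fun x => G x ^ k) μ ∧ ∫ x, G x ^ k ∂μ = R := by
  have hnn : ∀ (n : ℕ) x, 0 ≤ G x ^ k * Real.exp (-(1 / ((n : ℝ) + 1) * G x)) := fun n x => by
    have := hG0 x; positivity
  have hR : 0 ≤ R := ge_of_tendsto' h fun n => integral_nonneg (hnn n)
  have h1 : Tendsto (fun n : ℕ => ∫⁻ x, ENNReal.ofReal
      (G x ^ k * Real.exp (-(1 / ((n : ℝ) + 1) * G x))) ∂μ) atTop
      (𝓝 (∫⁻ x, ENNReal.ofReal (G x ^ k) ∂μ)) := by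
    refine lintegral_tendsto_of_tendsto_of_monotone (fun n => by fun_prop)
      (Eventually.of_forall fun x n n' hnn' => ENNReal.ofReal_le_ofReal ?_)
      (Eventually.of_forall fun x => (ENNReal.continuous_ofReal.tendsto _).comp
        (tendsto_pow_mul_exp_neg _ k))
    have := hG0 x
    have : (n : ℝ) ≤ n' := by exact_mod_cast hnn'
    gcongr
  have h2 : ∫⁻ x, ENNReal.ofReal (G x ^ k) ∂μ = ENNReal.ofReal R := by
    refine tendsto_nhds_unique h1 ?_
    simp_rw [← ofReal_integral_eq_lintegral_ofReal (hi _) (Eventually.of_forall (hnn _))]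
    exact (ENNReal.continuous_ofReal.tendsto _).comp h
  have hp : ∀ x, 0 ≤ G x ^ k := fun x => pow_nonneg (hG0 x) k
  constructor
  · refine ⟨by fun_prop, ?_⟩
    rw [hasFiniteIntegral_iff_ofReal (Eventually.of_forall hp), h2]
    exact ENNReal.ofReal_lt_top
  · rw [integral_eq_lintegral_of_nonneg_ae (Eventually.of_forall hp) (by fun_prop), h2,
      ENNReal.toReal_ofReal hR]

/-- The first three moments of a nonnegative random variable whose Laplace transform is that of a
Poisson integral. -/
theorem moments_of_laplace {Ω : Type*} [MeasurableSpace Ω] {P : Measure Ω}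
    [IsProbabilityMeasure P] {X : Ω → ℝ} (hX : Measurable X) (hX0 : ∀ ω, 0 ≤ X ω)
    (hG : Measurable G) (hG0 : ∀ x, 0 ≤ G x) (hG1 : Integrable G μ)
    (hG2 : Integrable (fun x => G x ^ 2) μ) (hG3 : Integrable (fun x => G x ^ 3) μ)
    (h : ∀ s : ℝ, 0 < s → ∫ ω, Real.exp (-(s * X ω)) ∂P =
      Real.exp (-∫ x, (1 - Real.exp (-(s * G x))) ∂μ)) :
    Integrable (fun ω => X ω ^ 3) P ∧ ∫ ω, X ω ∂P = ∫ x, G x ∂μ ∧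
      ∫ ω, X ω ^ 2 ∂P = (∫ x, G x ∂μ) ^ 2 + ∫ x, G x ^ 2 ∂μ ∧
      ∫ ω, X ω ^ 3 ∂P = (∫ x, G x ∂μ) ^ 3 + 3 * (∫ x, G x ∂μ) * (∫ x, G x ^ 2 ∂μ)
        + ∫ x, G x ^ 3 ∂μ := by
  have hiG : ∀ s : ℝ, 0 < s → Integrable (fun x => 1 - Real.exp (-(s * G x))) μ := fun s hs => by
    refine (hG1.const_mul s).mono' (by fun_prop) (Eventually.of_forall fun x => ?_)
    have h1 : Real.exp (-(s * G x)) ≤ 1 := Real.exp_le_one_iff.2 (by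
      have := mul_nonneg hs.le (hG0 x); linarith)
    rw [Real.norm_of_nonneg (by linarith)]
    linarith [Real.add_one_le_exp (-(s * G x))]
  have hiE : ∀ s : ℝ, 0 < s → Integrable (fun ω => Real.exp (-(s * X ω))) P := fun s hs => by
    refine (integrable_const (1 : ℝ)).mono' (by fun_prop) (Eventually.of_forall fun x => ?_)
    rw [Real.norm_of_nonneg (by positivity)]
    exact Real.exp_le_one_iff.2 (by have := mul_nonneg hs.le (hX0 x); linarith)
  have hiX : ∀ s : ℝ, 0 < s → Integrable (fun ω => 1 - Real.exp (-(s * X ω))) P := fun s hs =>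
    (integrable_const 1).sub (hiE s hs)
  set E : ℝ → ℝ := fun s => Real.exp (-∫ x, (1 - Real.exp (-(s * G x))) ∂μ) with hE
  set A1 : ℝ → ℝ := fun s => ∫ x, G x ^ (0 + 1) * Real.exp (-(s * G x)) ∂μ with hA1
  set A2 : ℝ → ℝ := fun s => ∫ x, G x ^ (1 + 1) * Real.exp (-(s * G x)) ∂μ with hA2
  set A3 : ℝ → ℝ := fun s => ∫ x, G x ^ (2 + 1) * Real.exp (-(s * G x)) ∂μ with hA3
  set B1 : ℝ → ℝ := fun s => ∫ x, X x ^ (0 + 1) * Real.exp (-(s * X x)) ∂P with hB1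
  set B2 : ℝ → ℝ := fun s => ∫ x, X x ^ (1 + 1) * Real.exp (-(s * X x)) ∂P with hB2
  set B3 : ℝ → ℝ := fun s => ∫ x, X x ^ (2 + 1) * Real.exp (-(s * X x)) ∂P with hB3
  -- Repeated differentiation of `E e^{-sX} = E(s)` gives the damped moments `B1 = A1 E`, `B2 = (A2
  -- + A1²) E` and `B3 = (A3 + 3 A1 A2 + A1³) E`. Working at `s > 0` avoids presupposing moments of
  -- `X`; these appear in the limit `s → 0`.
  have dE : ∀ s, 0 < s → HasDerivAt E (-(A1 s * E s)) s := fun s hs => by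
    have := (hasDerivAt_integral_one_sub_exp_neg hG hG0 hiG hs).fun_neg.exp
    refine this.congr_deriv ?_
    simp only [hA1, hE, zero_add, pow_one]
    ring
  have dA1 : ∀ s, 0 < s → HasDerivAt A1 (-A2 s) s := fun s hs =>
    hasDerivAt_integral_pow_mul_exp_neg hG hG0 hiG 0 hs
  have dA2 : ∀ s, 0 < s → HasDerivAt A2 (-A3 s) s := fun s hs =>
    hasDerivAt_integral_pow_mul_exp_neg hG hG0 hiG 1 hs
  have dB1 : ∀ s, 0 < s → HasDerivAt B1 (-B2 s) s := fun s hs =>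
    hasDerivAt_integral_pow_mul_exp_neg hX hX0 hiX 0 hs
  have dB2 : ∀ s, 0 < s → HasDerivAt B2 (-B3 s) s := fun s hs =>
    hasDerivAt_integral_pow_mul_exp_neg hX hX0 hiX 1 hs
  have e1 : ∀ s, 0 < s → B1 s = A1 s * E s := fun s hs => by
    have d0 := hasDerivAt_integral_one_sub_exp_neg hX hX0 hiX hs
    have d1 : HasDerivAt (fun s => ∫ ω, (1 - Real.exp (-(s * X ω))) ∂P) (A1 s * E s) s := by
      have := (dE s hs).const_sub 1
      rw [neg_neg] at this
      refine this.congr_of_eventuallyEq ?_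
      filter_upwards [Ioi_mem_nhds hs] with t ht
      rw [integral_sub (integrable_const _) (hiE t ht), h t ht]
      simp [hE]
    have := d0.unique d1
    simpa [hB1] using this
  have e2 : ∀ s, 0 < s → B2 s = (A2 s + A1 s ^ 2) * E s := fun s hs => by
    have d1 := ((dA1 s hs).mul (dE s hs)).congr_of_eventuallyEq
      (f₁ := B1) (by filter_upwards [Ioi_mem_nhds hs] with t ht using e1 t ht)
    have := (dB1 s hs).unique d1
    linarith
  have e3 : ∀ s, 0 < s → B3 s = (A3 s + 3 * A1 s * A2 s + A1 s ^ 3) * E s := fun s hs => by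
    have d1 := (((dA2 s hs).add ((dA1 s hs).pow 2)).mul (dE s hs)).congr_of_eventuallyEq
      (f₁ := B2) (by filter_upwards [Ioi_mem_nhds hs] with t ht using e2 t ht)
    have := (dB2 s hs).unique d1
    simp only [Pi.add_apply, Pi.pow_apply] at this
    have h2 : B3 s = -(-B3 s) := by ring
    rw [h2, this]
    push_cast
    ring
  have hs : ∀ n : ℕ, 0 < 1 / ((n : ℝ) + 1) := fun n => by positivity
  have l1 : Tendsto (fun n : ℕ => A1 (1 / ((n : ℝ) + 1))) atTop (𝓝 (∫ x, G x ∂μ)) := by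
    have := tendsto_integral_pow_mul_exp_neg (μ := μ) hG hG0 (0 + 1) (by simpa using hG1)
    simpa [hA1] using this
  have l2 : Tendsto (fun n : ℕ => A2 (1 / ((n : ℝ) + 1))) atTop (𝓝 (∫ x, G x ^ 2 ∂μ)) :=
    tendsto_integral_pow_mul_exp_neg (μ := μ) hG hG0 2 hG2
  have l3 : Tendsto (fun n : ℕ => A3 (1 / ((n : ℝ) + 1))) atTop (𝓝 (∫ x, G x ^ 3 ∂μ)) :=
    tendsto_integral_pow_mul_exp_neg (μ := μ) hG hG0 3 hG3
  have lE : Tendsto (fun n : ℕ => E (1 / ((n : ℝ) + 1))) atTop (𝓝 1) := by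
    have h0 : Tendsto (fun n : ℕ => ∫ x, (1 - Real.exp (-(1 / ((n : ℝ) + 1) * G x))) ∂μ) atTop
        (𝓝 0) := by
      have hup : Tendsto (fun n : ℕ => 1 / ((n : ℝ) + 1) * ∫ x, G x ∂μ) atTop (𝓝 0) := by
        simpa using tendsto_one_div_nat_zero.mul_const (∫ x, G x ∂μ)
      refine squeeze_zero (fun n => integral_nonneg fun x => ?_) (fun n => ?_) hup
      · have h1 : Real.exp (-(1 / ((n : ℝ) + 1) * G x)) ≤ 1 := Real.exp_le_one_iff.2 (by
          have := mul_nonneg (hs n).le (hG0 x); linarith)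
        simpa using h1
      · rw [← integral_const_mul]
        refine integral_mono (hiG _ (hs n)) (hG1.const_mul _) fun x => ?_
        dsimp only
        linarith [Real.add_one_le_exp (-(1 / ((n : ℝ) + 1) * G x))]
    have := (Real.continuous_exp.tendsto _).comp h0.neg
    simpa [hE, Function.comp_def] using this
  have i1 := integral_eq_of_tendsto_exp_neg (μ := P) hX hX0 1
    (R := ∫ x, G x ∂μ) (fun n => integrable_pow_mul_exp_neg hX hX0 hiX 0 (hs n)) (by
      have := l1.mul lE
      rw [mul_one] at this
      exact this.congr fun n => (e1 _ (hs n)).symm)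
  have i2 := integral_eq_of_tendsto_exp_neg (μ := P) hX hX0 2
    (R := ∫ x, G x ^ 2 ∂μ + (∫ x, G x ∂μ) ^ 2)
    (fun n => integrable_pow_mul_exp_neg hX hX0 hiX 1 (hs n)) (by
      have := (l2.add (l1.pow 2)).mul lE
      rw [mul_one] at this
      exact this.congr fun n => (e2 _ (hs n)).symm)
  have i3 := integral_eq_of_tendsto_exp_neg (μ := P) hX hX0 3
    (R := ∫ x, G x ^ 3 ∂μ + 3 * (∫ x, G x ∂μ) * (∫ x, G x ^ 2 ∂μ) + (∫ x, G x ∂μ) ^ 3)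
    (fun n => integrable_pow_mul_exp_neg hX hX0 hiX 2 (hs n)) (by
      have := ((l3.add ((l1.const_mul 3).mul l2)).add (l1.pow 3)).mul lE
      rw [mul_one] at this
      exact this.congr fun n => (e3 _ (hs n)).symm)
  refine ⟨i3.1, by simpa using i1.2, ?_, ?_⟩
  · rw [i2.2, add_comm]
  · rw [i3.2]; ring

end LaplaceMoments

/-! ### Moments of linear statistics of the process -/

/-- Bounded integrable test functions. -/
structure IsTestFun (g : ℝ → ℝ≥0∞) : Prop where
  measurable : Measurable g
  lintegral_lt_top : ∫⁻ x, g x < ∞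
  bounded : ∃ M : ℝ≥0∞, M ≠ ∞ ∧ ∀ x, g x ≤ M

lemma IsTestFun.add {g g' : ℝ → ℝ≥0∞} (hg : IsTestFun g) (hg' : IsTestFun g') :
    IsTestFun fun x => g x + g' x := by
  obtain ⟨M, hM, hgM⟩ := hg.bounded
  obtain ⟨M', hM', hgM'⟩ := hg'.bounded
  refine ⟨hg.measurable.add hg'.measurable, ?_, M + M', ENNReal.add_ne_top.2 ⟨hM, hM'⟩,
    fun x => add_le_add (hgM x) (hgM' x)⟩
  rw [lintegral_add_left hg.measurable]
  exact ENNReal.add_lt_top.2 ⟨hg.lintegral_lt_top, hg'.lintegral_lt_top⟩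

lemma isTestFun_indicator {A : Set ℝ} (hA : MeasurableSet A) (hb : Bornology.IsBounded A) :
    IsTestFun (A.indicator 1) := by
  refine ⟨measurable_one.indicator hA, ?_, 1, by simp, fun x => ?_⟩
  · rw [lintegral_indicator_one hA]
    exact hb.measure_lt_top
  · exact Set.indicator_le_self' (by simp) x

lemma one_sub_expNeg_le (y : ℝ≥0∞) : 1 - expNeg y ≤ y := by
  rcases eq_or_ne y ∞ with rfl | hy
  · simp
  · rw [← ENNReal.ofReal_toReal hy, expNeg_ofReal ENNReal.toReal_nonneg, ← ENNReal.ofReal_one,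
      ← ENNReal.ofReal_sub _ (by positivity)]
    refine ENNReal.ofReal_le_ofReal ?_
    linarith [Real.add_one_le_exp (-y.toReal)]

lemma expNeg_toReal {y : ℝ≥0∞} (hy : y ≠ ∞) : (expNeg y).toReal = Real.exp (-y.toReal) := by
  rw [← ENNReal.ofReal_toReal hy, expNeg_ofReal ENNReal.toReal_nonneg,
    ENNReal.toReal_ofReal (by positivity), ENNReal.toReal_ofReal ENNReal.toReal_nonneg]

/-- Sum of `g` over the cluster with root at `p.1` and family tree `p.2`. -/
noncomputable def clusterSum (g : ℝ → ℝ≥0∞) (p : ℝ × TreeData) : ℝ≥0∞ :=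
  vsum (fun y => g (y + p.1)) p.2

/-- Intensity of the Poisson process of clusters. -/
noncomputable def clusterIntensity (ν : ℝ) (μ : Measure TreeData) : Measure (ℝ × TreeData) :=
  (ENNReal.ofReal ν • volume).prod μ

lemma measurable_clusterSum {g : ℝ → ℝ≥0∞} (hg : Measurable g) : Measurable (clusterSum g) :=
  measurable_vsum_shift hg measurable_fst measurable_snd

lemma clusterSum_add (g g' : ℝ → ℝ≥0∞) (p : ℝ × TreeData) :
    clusterSum (fun x => g x + g' x) p = clusterSum g p + clusterSum g' p := by
  classical
  unfold clusterSum vsum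
  rw [← ENNReal.tsum_add]
  congr 1 with v
  split_ifs <;> simp

lemma clusterSum_const_mul (c : ℝ≥0∞) (g : ℝ → ℝ≥0∞) (p : ℝ × TreeData) :
    clusterSum (fun x => c * g x) p = c * clusterSum g p := by
  classical
  unfold clusterSum vsum
  rw [← ENNReal.tsum_mul_left]
  congr 1 with v
  split_ifs <;> simp

lemma clusterSum_le {g : ℝ → ℝ≥0∞} {M : ℝ≥0∞} (hM : ∀ x, g x ≤ M) (p : ℝ × TreeData) :
    clusterSum g p ≤ M * p.2.total := by
  classical
  unfold clusterSum total vsum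
  rw [← ENNReal.tsum_mul_left]
  refine ENNReal.tsum_le_tsum fun v => ?_
  split_ifs
  · simpa using hM _
  · simp

/-- By translation invariance every vertex contributes the same integral of `g`. -/
lemma lintegral_vsum_shift {g : ℝ → ℝ≥0∞} (hg : Measurable g) (x : TreeData) :
    ∫⁻ u, clusterSum g (u, x) = x.total * ∫⁻ y, g y := by
  classical
  unfold clusterSum total vsum
  have hm : ∀ v, Measurable fun u : ℝ => if x.Mem v then g (x.pos v + u) else 0 := fun v => by
    split_ifs
    · exact hg.comp (measurable_const_add _)
    · exact measurable_const
  rw [lintegral_tsum fun v => (hm v).aemeasurable, ← ENNReal.tsum_mul_right]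
  congr 1 with v
  split_ifs
  · rw [one_mul]
    exact lintegral_add_left_eq_self g (x.pos v)
  · simp

lemma lintegral_clusterIntensity {ν : ℝ} {μ : Measure TreeData} [SFinite μ]
    {F : ℝ × TreeData → ℝ≥0∞} (hF : Measurable F) :
    ∫⁻ p, F p ∂clusterIntensity ν μ = ENNReal.ofReal ν * ∫⁻ x, ∫⁻ u, F (u, x) ∂volume ∂μ := by
  rw [clusterIntensity, lintegral_prod_symm' _ hF]
  simp_rw [lintegral_smul_measure, smul_eq_mul]
  rw [lintegral_const_mul]
  exact Measurable.lintegral_prod_left' hF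

lemma one_le_total (x : TreeData) : 1 ≤ x.total := by
  classical
  unfold total vsum
  refine le_trans ?_ (ENNReal.le_tsum [])
  simp

/-- Of the `k + 1` factors, `k` are bounded by `M * total` and the last is integrated over the root
position, which leaves `total ^ (k + 1) ≤ total ^ 3`. -/
lemma lintegral_clusterSum_pow_lt_top {ν : ℝ} {μ : Measure TreeData} [SFinite μ]
    (hμ : ∫⁻ x, x.total ^ 3 ∂μ < ∞) {g : ℝ → ℝ≥0∞} (hg : IsTestFun g) {k : ℕ} (hk : k ≤ 2) :
    ∫⁻ p, clusterSum g p ^ (k + 1) ∂clusterIntensity ν μ < ∞ := by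
  obtain ⟨M, hM, hgM⟩ := hg.bounded
  have hm := measurable_clusterSum hg.measurable
  rw [lintegral_clusterIntensity (hm.pow_const _)]
  refine ENNReal.mul_lt_top ENNReal.ofReal_lt_top ?_
  calc ∫⁻ x, ∫⁻ u, clusterSum g (u, x) ^ (k + 1) ∂volume ∂μ
      ≤ ∫⁻ x, M ^ k * (∫⁻ y, g y) * x.total ^ 3 ∂μ := lintegral_mono fun x => ?_
    _ = M ^ k * (∫⁻ y, g y) * ∫⁻ x, x.total ^ 3 ∂μ :=
        lintegral_const_mul _ (measurable_total.pow_const 3)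
    _ < ∞ := ENNReal.mul_lt_top (ENNReal.mul_lt_top (ENNReal.pow_lt_top hM.lt_top)
        hg.lintegral_lt_top) hμ
  calc ∫⁻ u, clusterSum g (u, x) ^ (k + 1)
      ≤ ∫⁻ u, (M * x.total) ^ k * clusterSum g (u, x) := lintegral_mono fun u => by
        rw [pow_succ]
        gcongr
        exact clusterSum_le hgM (u, x)
    _ = (M * x.total) ^ k * (x.total * ∫⁻ y, g y) := by
        have hmx : Measurable fun u => clusterSum g (u, x) := hm.comp measurable_prodMk_right
        rw [lintegral_const_mul _ hmx, lintegral_vsum_shift hg.measurable]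
    _ = M ^ k * (∫⁻ y, g y) * x.total ^ (k + 1) := by rw [mul_pow]; ring
    _ ≤ M ^ k * (∫⁻ y, g y) * x.total ^ 3 := by
        gcongr
        · exact one_le_total x
        · omega

section ClusterMoments

variable {Ω : Type*} [MeasurableSpace Ω] {P : Measure Ω} [IsProbabilityMeasure P] {ν m : ℝ}
  {f : ℝ → ℝ} {U : ℕ → Ω → ℝ} {ξ : ℕ → List ℕ → Ω → ℕ} {D : ℕ → List ℕ → Ω → ℝ}

/-- Law of the family tree of an immigrant. -/
noncomputable abbrev offspringLaw (m : ℝ) (f : ℝ → ℝ) : Measure TreeData :=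
  treeLaw m.toNNReal (densityMeasure f)

lemma IsProbDensity.offspringLaw_total (hf : IsProbDensity f) (hm₀ : 0 < m) (hm₁ : m < 1) :
    ∫⁻ x, x.total ^ 3 ∂offspringLaw m f < ∞ := by
  have := hf.isProbabilityMeasure
  exact lintegral_total_pow_three_lt_top (by simpa using hm₀) (by
    rw [← NNReal.coe_lt_coe, Real.coe_toNNReal _ hm₀.le]; simpa using hm₁)

lemma IsBranchingData.lintegral_expNeg' (hf : IsProbDensity f)
    (h : IsBranchingData P ν m f U ξ D) {g : ℝ → ℝ≥0∞} (hg : Measurable g) :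
    ∫⁻ ω, expNeg (∫⁻ y, g y ∂(clusterProcess U ξ D ω)) ∂P =
      expNeg (∫⁻ p, (1 - expNeg (clusterSum g p)) ∂clusterIntensity ν (offspringLaw m f)) := by
  have := hf.isProbabilityMeasure
  have hm := measurable_expNeg.comp (measurable_clusterSum hg)
  rw [h.lintegral_expNeg hf hg]
  congr 1
  have hm' : Measurable fun p => 1 - expNeg (clusterSum g p) := measurable_const.sub hm
  rw [clusterIntensity, lintegral_prod _ hm'.aemeasurable, lintegral_smul_measure, smul_eq_mul]
  congr 2 with u
  have hmu : Measurable fun x => expNeg (clusterSum g (u, x)) := hm.comp measurable_prodMk_left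
  rw [lintegral_sub hmu (ne_top_of_le_ne_top (by simp) (clusterLaplace_le_one _ g u))
    (Eventually.of_forall fun x => expNeg_le_one _)]
  simp [clusterLaplace, clusterSum]

/-- Let `I` be the finite mean of the cluster sums. Then `E e^{-c ∫ g dN} ≥ e^{-cI}`, while the
integrand vanishes wherever `∫ g dN = ∞` and `c > 0`. So the probability of finiteness is at least
`e^{-cI}`, which tends to `1` as `c → 0`. -/
lemma IsBranchingData.ae_lintegral_lt_top (hf : IsProbDensity f)
    (h : IsBranchingData P ν m f U ξ D) (hm₀ : 0 < m) (hm₁ : m < 1) {g : ℝ → ℝ≥0∞}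
    (hg : IsTestFun g) : ∀ᵐ ω ∂P, ∫⁻ y, g y ∂(clusterProcess U ξ D ω) < ∞ := by
  have := hf.isProbabilityMeasure
  have hmeas := h.measurable_lintegral hg.measurable
  set I := ∫⁻ p, clusterSum g p ∂clusterIntensity ν (offspringLaw m f) with hI
  have hIt : I ≠ ∞ := by
    have := lintegral_clusterSum_pow_lt_top (ν := ν) (hf.offspringLaw_total hm₀ hm₁) hg
      (k := 0) (by simp)
    simpa using this.ne
  have hset : MeasurableSet {ω | ∫⁻ y, g y ∂(clusterProcess U ξ D ω) < ∞} :=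
    measurableSet_lt hmeas measurable_const
  have hle : ∀ n : ℕ, expNeg (((n : ℝ≥0∞) + 1)⁻¹ * I) ≤
      P {ω | ∫⁻ y, g y ∂(clusterProcess U ξ D ω) < ∞} := fun n => by
    set c : ℝ≥0∞ := ((n : ℝ≥0∞) + 1)⁻¹ with hc
    have hc0 : c ≠ 0 := by simp [hc]
    calc expNeg (c * I)
        ≤ expNeg (∫⁻ p, (1 - expNeg (clusterSum (fun x => c * g x) p))
            ∂clusterIntensity ν (offspringLaw m f)) := by
          refine expNeg_antitone ?_
          rw [hI, ← lintegral_const_mul _ (measurable_clusterSum hg.measurable)]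
          refine lintegral_mono fun p => ?_
          rw [clusterSum_const_mul]
          exact one_sub_expNeg_le _
      _ = ∫⁻ ω, expNeg (c * ∫⁻ y, g y ∂(clusterProcess U ξ D ω)) ∂P := by
          rw [← h.lintegral_expNeg' hf (hg.measurable.const_mul c)]
          simp_rw [lintegral_const_mul _ hg.measurable]
      _ ≤ ∫⁻ ω, {ω | ∫⁻ y, g y ∂(clusterProcess U ξ D ω) < ∞}.indicator 1 ω ∂P := by
          refine lintegral_mono fun ω => ?_
          by_cases hω : ∫⁻ y, g y ∂(clusterProcess U ξ D ω) < ∞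
          · rw [Set.indicator_of_mem (by exact hω)]
            exact expNeg_le_one _
          · rw [not_lt, top_le_iff] at hω
            simp [hω, hc0]
      _ = _ := lintegral_indicator_one hset
  have hlim : Tendsto (fun n : ℕ => expNeg (((n : ℝ≥0∞) + 1)⁻¹ * I)) atTop (𝓝 1) := by
    have h1 : Tendsto (fun n : ℕ => ((n : ℝ≥0∞) + 1)⁻¹) atTop (𝓝 0) := by
      have := (tendsto_add_atTop_iff_nat 1).2 ENNReal.tendsto_inv_nat_nhds_zero
      simpa using this
    have h2 := ENNReal.Tendsto.mul_const h1 (b := I) (Or.inr hIt)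
    rw [zero_mul] at h2
    simpa [Function.comp_def] using (continuous_expNeg.tendsto 0).comp h2
  have h1 : P {ω | ∫⁻ y, g y ∂(clusterProcess U ξ D ω) < ∞} = 1 :=
    le_antisymm prob_le_one (le_of_tendsto' hlim hle)
  exact (prob_compl_eq_zero_iff hset).2 h1

/-- `∫ g dN` as a real number. -/
noncomputable def linStat (N : Measure ℝ) (g : ℝ → ℝ≥0∞) : ℝ := (∫⁻ y, g y ∂N).toReal

/-- `clusterSum` as a real number. -/
noncomputable def clusterStat (g : ℝ → ℝ≥0∞) (p : ℝ × TreeData) : ℝ := (clusterSum g p).toReal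

lemma ae_clusterSum_lt_top {ν : ℝ} {μ : Measure TreeData} [SFinite μ]
    (hμ : ∫⁻ x, x.total ^ 3 ∂μ < ∞) {g : ℝ → ℝ≥0∞} (hg : IsTestFun g) :
    ∀ᵐ p ∂clusterIntensity ν μ, clusterSum g p < ∞ := by
  have := lintegral_clusterSum_pow_lt_top (ν := ν) hμ hg (k := 0) (by simp)
  simp only [zero_add, pow_one] at this
  exact ae_lt_top (measurable_clusterSum hg.measurable) this.ne

lemma integrable_clusterStat_pow {ν : ℝ} {μ : Measure TreeData} [SFinite μ]
    (hμ : ∫⁻ x, x.total ^ 3 ∂μ < ∞) {g : ℝ → ℝ≥0∞} (hg : IsTestFun g) {k : ℕ} (hk : k ≤ 2) :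
    Integrable (fun p => clusterStat g p ^ (k + 1)) (clusterIntensity ν μ) := by
  have h1 := lintegral_clusterSum_pow_lt_top (ν := ν) hμ hg hk
  have h2 := integrable_toReal_of_lintegral_ne_top
    ((measurable_clusterSum hg.measurable).pow_const (k + 1)).aemeasurable h1.ne
  simpa [clusterStat, ENNReal.toReal_pow] using h2

/-- Moments up to order three of the linear statistics. -/
theorem IsBranchingData.moments (hf : IsProbDensity f)
    (h : IsBranchingData P ν m f U ξ D) (hm₀ : 0 < m) (hm₁ : m < 1) {g : ℝ → ℝ≥0∞}
    (hg : IsTestFun g) :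
    Integrable (fun ω => linStat (clusterProcess U ξ D ω) g ^ 3) P ∧
    ∫ ω, linStat (clusterProcess U ξ D ω) g ∂P =
      ∫ p, clusterStat g p ∂clusterIntensity ν (offspringLaw m f) ∧
    ∫ ω, linStat (clusterProcess U ξ D ω) g ^ 2 ∂P =
      (∫ p, clusterStat g p ∂clusterIntensity ν (offspringLaw m f)) ^ 2 +
        ∫ p, clusterStat g p ^ 2 ∂clusterIntensity ν (offspringLaw m f) ∧
    ∫ ω, linStat (clusterProcess U ξ D ω) g ^ 3 ∂P =
      (∫ p, clusterStat g p ∂clusterIntensity ν (offspringLaw m f)) ^ 3 +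
        3 * (∫ p, clusterStat g p ∂clusterIntensity ν (offspringLaw m f)) *
          (∫ p, clusterStat g p ^ 2 ∂clusterIntensity ν (offspringLaw m f)) +
        ∫ p, clusterStat g p ^ 3 ∂clusterIntensity ν (offspringLaw m f) := by
  have := hf.isProbabilityMeasure
  have hμ := hf.offspringLaw_total hm₀ hm₁
  have hfin := h.ae_lintegral_lt_top hf hm₀ hm₁ hg
  refine moments_of_laplace (h.measurable_lintegral hg.measurable).ennreal_toReal
    (fun _ => ENNReal.toReal_nonneg) (measurable_clusterSum hg.measurable).ennreal_toReal
    (fun _ => ENNReal.toReal_nonneg)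
    (by simpa using integrable_clusterStat_pow hμ hg (k := 0) (by simp))
    (integrable_clusterStat_pow hμ hg (k := 1) (by simp))
    (integrable_clusterStat_pow hμ hg (k := 2) (by simp)) fun s hs => ?_
  have hL := h.lintegral_expNeg' hf (hg.measurable.const_mul (ENNReal.ofReal s))
  simp_rw [lintegral_const_mul _ hg.measurable, clusterSum_const_mul] at hL
  have hmeasL : Measurable fun ω =>
      expNeg (ENNReal.ofReal s * ∫⁻ y, g y ∂(clusterProcess U ξ D ω)) :=
    measurable_expNeg.comp ((h.measurable_lintegral hg.measurable).const_mul _)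
  have hmeasR : Measurable fun p => 1 - expNeg (ENNReal.ofReal s * clusterSum g p) :=
    measurable_const.sub (measurable_expNeg.comp
      ((measurable_clusterSum hg.measurable).const_mul _))
  have e1 : ∫ ω, Real.exp (-(s * linStat (clusterProcess U ξ D ω) g)) ∂P =
      (∫⁻ ω, expNeg (ENNReal.ofReal s * ∫⁻ y, g y ∂(clusterProcess U ξ D ω)) ∂P).toReal := by
    rw [← integral_toReal hmeasL.aemeasurable
      (Eventually.of_forall fun ω => (expNeg_ne_top _).lt_top)]
    refine integral_congr_ae ?_
    filter_upwards [hfin] with ω hω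
    rw [expNeg_toReal (ENNReal.mul_ne_top (by simp) hω.ne), ENNReal.toReal_mul,
      ENNReal.toReal_ofReal hs.le]
    rfl
  have e2 : ∫ p, (1 - Real.exp (-(s * clusterStat g p)))
        ∂clusterIntensity ν (offspringLaw m f) =
      (∫⁻ p, (1 - expNeg (ENNReal.ofReal s * clusterSum g p))
        ∂clusterIntensity ν (offspringLaw m f)).toReal := by
    rw [← integral_toReal hmeasR.aemeasurable (Eventually.of_forall fun p =>
      (ENNReal.sub_ne_top (by simp)).lt_top)]
    refine integral_congr_ae ?_
    filter_upwards [ae_clusterSum_lt_top hμ hg] with p hp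
    rw [ENNReal.toReal_sub_of_le (expNeg_le_one _) (by simp),
      expNeg_toReal (ENNReal.mul_ne_top (by simp) hp.ne), ENNReal.toReal_mul,
      ENNReal.toReal_ofReal hs.le]
    rfl
  change ∫ ω, Real.exp (-(s * linStat (clusterProcess U ξ D ω) g)) ∂P =
    Real.exp (-∫ p, (1 - Real.exp (-(s * clusterStat g p)))
      ∂clusterIntensity ν (offspringLaw m f))
  rw [e1, e2, hL, expNeg_toReal]
  have hI := lintegral_clusterSum_pow_lt_top (ν := ν) hμ hg (k := 0) (by simp)
  simp only [zero_add, pow_one] at hI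
  refine ((lintegral_mono fun p => one_sub_expNeg_le _).trans_lt ?_).ne
  rw [lintegral_const_mul _ (measurable_clusterSum hg.measurable)]
  exact ENNReal.mul_lt_top (by simp) hI

end ClusterMoments

/-! ### Polarization of second and third moments -/

section Polarization

lemma integral_mul_polarization {S : Type*} [MeasurableSpace S] {μ : Measure S} {a b : S → ℝ}
    (ha : Integrable (fun x => a x ^ 2) μ) (hb : Integrable (fun x => b x ^ 2) μ)
    (hab : Integrable (fun x => (a x + b x) ^ 2) μ) :
    Integrable (fun x => a x * b x) μ ∧
      ∫ x, a x * b x ∂μ =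
        ((∫ x, (a x + b x) ^ 2 ∂μ) - (∫ x, a x ^ 2 ∂μ) - ∫ x, b x ^ 2 ∂μ) / 2 := by
  have h : (fun x => a x * b x) = fun x => ((a x + b x) ^ 2 - a x ^ 2 - b x ^ 2) / 2 := by
    ext x; ring
  rw [h]
  refine ⟨((hab.sub ha).sub hb).div_const 2, ?_⟩
  have h2 : Integrable (fun x => (a x + b x) ^ 2 - a x ^ 2) μ := hab.sub ha
  rw [integral_div, integral_sub h2 hb, integral_sub hab ha]

lemma integral_mul_mul_polarization {S : Type*} [MeasurableSpace S] {μ : Measure S}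
    {a b c : S → ℝ}
    (ha : Integrable (fun x => a x ^ 3) μ) (hb : Integrable (fun x => b x ^ 3) μ)
    (hc : Integrable (fun x => c x ^ 3) μ) (hab : Integrable (fun x => (a x + b x) ^ 3) μ)
    (hac : Integrable (fun x => (a x + c x) ^ 3) μ)
    (hbc : Integrable (fun x => (b x + c x) ^ 3) μ)
    (habc : Integrable (fun x => (a x + b x + c x) ^ 3) μ) :
    Integrable (fun x => a x * b x * c x) μ ∧
      ∫ x, a x * b x * c x ∂μ =
        ((∫ x, (a x + b x + c x) ^ 3 ∂μ) - (∫ x, (a x + b x) ^ 3 ∂μ)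
          - (∫ x, (a x + c x) ^ 3 ∂μ) - (∫ x, (b x + c x) ^ 3 ∂μ)
          + (∫ x, a x ^ 3 ∂μ) + (∫ x, b x ^ 3 ∂μ) + ∫ x, c x ^ 3 ∂μ) / 6 := by
  have h : (fun x => a x * b x * c x) = fun x => ((a x + b x + c x) ^ 3 - (a x + b x) ^ 3
      - (a x + c x) ^ 3 - (b x + c x) ^ 3 + a x ^ 3 + b x ^ 3 + c x ^ 3) / 6 := by
    ext x; ring
  rw [h]
  have i1 : Integrable (fun x => (a x + b x + c x) ^ 3 - (a x + b x) ^ 3) μ := habc.sub hab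
  have i2 : Integrable (fun x => (a x + b x + c x) ^ 3 - (a x + b x) ^ 3 - (a x + c x) ^ 3) μ :=
    i1.sub hac
  have i3 : Integrable (fun x => (a x + b x + c x) ^ 3 - (a x + b x) ^ 3 - (a x + c x) ^ 3
    - (b x + c x) ^ 3) μ := i2.sub hbc
  have i4 : Integrable (fun x => (a x + b x + c x) ^ 3 - (a x + b x) ^ 3 - (a x + c x) ^ 3
    - (b x + c x) ^ 3 + a x ^ 3) μ := i3.add ha
  have i5 : Integrable (fun x => (a x + b x + c x) ^ 3 - (a x + b x) ^ 3 - (a x + c x) ^ 3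
    - (b x + c x) ^ 3 + a x ^ 3 + b x ^ 3) μ := i4.add hb
  refine ⟨(i5.add hc).div_const 6, ?_⟩
  rw [integral_div, integral_add i5 hc, integral_add i4 hb, integral_add i3 ha,
    integral_sub i2 hbc, integral_sub i1 hac, integral_sub habc hab]

lemma integrable_pow_of_pow_three {Ω : Type*} [MeasurableSpace Ω] {P : Measure Ω}
    [IsFiniteMeasure P] {X : Ω → ℝ} (hX : Measurable X) (hX0 : ∀ ω, 0 ≤ X ω)
    (h : Integrable (fun ω => X ω ^ 3) P) {k : ℕ} (hk : k ≤ 3) :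
    Integrable (fun ω => X ω ^ k) P := by
  refine ((integrable_const (1 : ℝ)).add h).mono' (by fun_prop) (Eventually.of_forall fun ω => ?_)
  have := hX0 ω
  rw [Real.norm_of_nonneg (by positivity)]
  simp only [Pi.add_apply]
  rcases le_total (X ω) 1 with h1 | h1
  · have : X ω ^ k ≤ 1 := pow_le_one₀ (hX0 ω) h1
    have : 0 ≤ X ω ^ 3 := by positivity
    linarith
  · have : X ω ^ k ≤ X ω ^ 3 := pow_le_pow_right₀ h1 hk
    linarith

end Polarization

/-! ### Mixed moments and cumulants of the counts -/

section ClusterMoments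

variable {Ω : Type*} [MeasurableSpace Ω] {P : Measure Ω} [IsProbabilityMeasure P] {ν m : ℝ}
  {f : ℝ → ℝ} {U : ℕ → Ω → ℝ} {ξ : ℕ → List ℕ → Ω → ℕ} {D : ℕ → List ℕ → Ω → ℝ}

lemma IsBranchingData.linStat_add (hf : IsProbDensity f)
    (h : IsBranchingData P ν m f U ξ D) (hm₀ : 0 < m) (hm₁ : m < 1) {g g' : ℝ → ℝ≥0∞}
    (hg : IsTestFun g) (hg' : IsTestFun g') :
    ∀ᵐ ω ∂P, linStat (clusterProcess U ξ D ω) (fun x => g x + g' x) =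
      linStat (clusterProcess U ξ D ω) g + linStat (clusterProcess U ξ D ω) g' := by
  filter_upwards [h.ae_lintegral_lt_top hf hm₀ hm₁ hg, h.ae_lintegral_lt_top hf hm₀ hm₁ hg']
    with ω h1 h2
  rw [linStat, lintegral_add_left hg.measurable, ENNReal.toReal_add h1.ne h2.ne]
  rfl

lemma clusterStat_add {μ : Measure TreeData} [SFinite μ]
    (hμ : ∫⁻ x, x.total ^ 3 ∂μ < ∞) {g g' : ℝ → ℝ≥0∞} (hg : IsTestFun g) (hg' : IsTestFun g') :
    ∀ᵐ p ∂clusterIntensity ν μ, clusterStat (fun x => g x + g' x) p =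
      clusterStat g p + clusterStat g' p := by
  filter_upwards [ae_clusterSum_lt_top hμ hg, ae_clusterSum_lt_top hμ hg'] with p h1 h2
  rw [clusterStat, clusterSum_add, ENNReal.toReal_add h1.ne h2.ne]
  rfl

omit [IsProbabilityMeasure P] in
lemma IsBranchingData.measurable_linStat (h : IsBranchingData P ν m f U ξ D) {g : ℝ → ℝ≥0∞}
    (hg : Measurable g) : Measurable fun ω => linStat (clusterProcess U ξ D ω) g :=
  (h.measurable_lintegral hg).ennreal_toReal

lemma linStat_nonneg (N : Measure ℝ) (g : ℝ → ℝ≥0∞) : 0 ≤ linStat N g := ENNReal.toReal_nonneg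

lemma IsBranchingData.integrable_linStat_pow (hf : IsProbDensity f)
    (h : IsBranchingData P ν m f U ξ D) (hm₀ : 0 < m) (hm₁ : m < 1) {g : ℝ → ℝ≥0∞}
    (hg : IsTestFun g) {k : ℕ} (hk : k ≤ 3) :
    Integrable (fun ω => linStat (clusterProcess U ξ D ω) g ^ k) P :=
  integrable_pow_of_pow_three (h.measurable_linStat hg.measurable) (fun _ => linStat_nonneg _ _)
    (h.moments hf hm₀ hm₁ hg).1 hk

/-- Mixed second moments of linear statistics. -/
theorem IsBranchingData.integral_mul (hf : IsProbDensity f)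
    (h : IsBranchingData P ν m f U ξ D) (hm₀ : 0 < m) (hm₁ : m < 1) {a b : ℝ → ℝ≥0∞}
    (ha : IsTestFun a) (hb : IsTestFun b) :
    Integrable (fun ω => linStat (clusterProcess U ξ D ω) a *
      linStat (clusterProcess U ξ D ω) b) P ∧
    Integrable (fun p => clusterStat a p * clusterStat b p)
      (clusterIntensity ν (offspringLaw m f)) ∧
    ∫ ω, linStat (clusterProcess U ξ D ω) a * linStat (clusterProcess U ξ D ω) b ∂P =
      (∫ ω, linStat (clusterProcess U ξ D ω) a ∂P) *
        (∫ ω, linStat (clusterProcess U ξ D ω) b ∂P) +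
      ∫ p, clusterStat a p * clusterStat b p ∂clusterIntensity ν (offspringLaw m f) := by
  have := hf.isProbabilityMeasure
  have hμ := hf.offspringLaw_total hm₀ hm₁
  have hab := ha.add hb
  have eX := h.linStat_add hf hm₀ hm₁ ha hb
  have eG := clusterStat_add (ν := ν) hμ ha hb
  have mab := h.moments hf hm₀ hm₁ hab
  have ma := h.moments hf hm₀ hm₁ ha
  have mb := h.moments hf hm₀ hm₁ hb
  have eX2 : (fun ω => linStat (clusterProcess U ξ D ω) (fun x => a x + b x) ^ 2) =ᵐ[P]
      fun ω => (linStat (clusterProcess U ξ D ω) a + linStat (clusterProcess U ξ D ω) b) ^ 2 :=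
    eX.mono fun ω hω => by dsimp only; rw [hω]
  have eG2 : (fun p => clusterStat (fun x => a x + b x) p ^ 2)
      =ᵐ[clusterIntensity ν (offspringLaw m f)]
      fun p => (clusterStat a p + clusterStat b p) ^ 2 :=
    eG.mono fun p hp => by dsimp only; rw [hp]
  have pX := integral_mul_polarization (h.integrable_linStat_pow hf hm₀ hm₁ ha (k := 2) (by simp))
    (h.integrable_linStat_pow hf hm₀ hm₁ hb (k := 2) (by simp))
    ((h.integrable_linStat_pow hf hm₀ hm₁ hab (k := 2) (by simp)).congr eX2)
  have pG := integral_mul_polarization (integrable_clusterStat_pow (ν := ν) hμ ha (k := 1) (by simp))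
    (integrable_clusterStat_pow (ν := ν) hμ hb (k := 1) (by simp))
    ((integrable_clusterStat_pow (ν := ν) hμ hab (k := 1) (by simp)).congr eG2)
  refine ⟨pX.1, pG.1, ?_⟩
  have eG1 : ∫ p, clusterStat (fun x => a x + b x) p ∂clusterIntensity ν (offspringLaw m f) =
      (∫ p, clusterStat a p ∂clusterIntensity ν (offspringLaw m f)) +
        ∫ p, clusterStat b p ∂clusterIntensity ν (offspringLaw m f) := by
    rw [integral_congr_ae eG, integral_add]
    · simpa using integrable_clusterStat_pow (ν := ν) hμ ha (k := 0) (by simp)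
    · simpa using integrable_clusterStat_pow (ν := ν) hμ hb (k := 0) (by simp)
  rw [pX.2, pG.2, ← integral_congr_ae eX2, ← integral_congr_ae eG2, mab.2.2.1, ma.2.2.1, mb.2.2.1,
    ma.2.1, mb.2.1, eG1]
  ring

/-- Mixed third moments of linear statistics. -/
theorem IsBranchingData.integral_mul_mul (hf : IsProbDensity f)
    (h : IsBranchingData P ν m f U ξ D) (hm₀ : 0 < m) (hm₁ : m < 1) {a b c : ℝ → ℝ≥0∞}
    (ha : IsTestFun a) (hb : IsTestFun b) (hc : IsTestFun c) :
    Integrable (fun ω => linStat (clusterProcess U ξ D ω) a *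
      linStat (clusterProcess U ξ D ω) b * linStat (clusterProcess U ξ D ω) c) P ∧
    Integrable (fun p => clusterStat a p * clusterStat b p * clusterStat c p)
      (clusterIntensity ν (offspringLaw m f)) ∧
    ∫ ω, linStat (clusterProcess U ξ D ω) a * linStat (clusterProcess U ξ D ω) b *
        linStat (clusterProcess U ξ D ω) c ∂P =
      (∫ ω, linStat (clusterProcess U ξ D ω) a ∂P) *
        (∫ ω, linStat (clusterProcess U ξ D ω) b ∂P) *
        (∫ ω, linStat (clusterProcess U ξ D ω) c ∂P) +
      (∫ ω, linStat (clusterProcess U ξ D ω) a ∂P) *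
        (∫ p, clusterStat b p * clusterStat c p ∂clusterIntensity ν (offspringLaw m f)) +
      (∫ ω, linStat (clusterProcess U ξ D ω) b ∂P) *
        (∫ p, clusterStat a p * clusterStat c p ∂clusterIntensity ν (offspringLaw m f)) +
      (∫ ω, linStat (clusterProcess U ξ D ω) c ∂P) *
        (∫ p, clusterStat a p * clusterStat b p ∂clusterIntensity ν (offspringLaw m f)) +
      ∫ p, clusterStat a p * clusterStat b p * clusterStat c p
        ∂clusterIntensity ν (offspringLaw m f) := by
  have := hf.isProbabilityMeasure
  have hμ := hf.offspringLaw_total hm₀ hm₁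
  set Λ := clusterIntensity ν (offspringLaw m f) with hΛ
  have key : ∀ {a b : ℝ → ℝ≥0∞}, IsTestFun a → IsTestFun b →
      (∀ k : ℕ, (fun ω => linStat (clusterProcess U ξ D ω) (fun x => a x + b x) ^ k) =ᵐ[P]
        fun ω => (linStat (clusterProcess U ξ D ω) a +
          linStat (clusterProcess U ξ D ω) b) ^ k) ∧
      (∀ k : ℕ, (fun p => clusterStat (fun x => a x + b x) p ^ k) =ᵐ[Λ]
        fun p => (clusterStat a p + clusterStat b p) ^ k) ∧
      ∫ p, clusterStat (fun x => a x + b x) p ∂Λ =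
        (∫ p, clusterStat a p ∂Λ) + ∫ p, clusterStat b p ∂Λ := fun {a b} ha hb => by
    have eX := h.linStat_add hf hm₀ hm₁ ha hb
    have eG := clusterStat_add (ν := ν) hμ ha hb
    refine ⟨fun k => eX.mono fun ω hω => by dsimp only; rw [hω],
      fun k => eG.mono fun p hp => by dsimp only; rw [hp], ?_⟩
    rw [integral_congr_ae eG, integral_add]
    · simpa using integrable_clusterStat_pow (ν := ν) hμ ha (k := 0) (by simp)
    · simpa using integrable_clusterStat_pow (ν := ν) hμ hb (k := 0) (by simp)
  have hab := ha.add hb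
  have hac := ha.add hc
  have hbc := hb.add hc
  have habc := hab.add hc
  obtain ⟨Xab, Gab, Iab⟩ := key ha hb
  obtain ⟨Xac, Gac, Iac⟩ := key ha hc
  obtain ⟨Xbc, Gbc, Ibc⟩ := key hb hc
  obtain ⟨Xabc, Gabc, Iabc⟩ := key hab hc
  have Xabc3 : (fun ω => linStat (clusterProcess U ξ D ω) (fun x => a x + b x + c x) ^ 3) =ᵐ[P]
      fun ω => (linStat (clusterProcess U ξ D ω) a + linStat (clusterProcess U ξ D ω) b +
        linStat (clusterProcess U ξ D ω) c) ^ 3 := by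
    filter_upwards [Xabc 3, Xab 1] with ω h1 h2
    rw [pow_one, pow_one] at h2
    rw [h1, h2]
  have Gabc' : ∀ k, (fun p => clusterStat (fun x => a x + b x + c x) p ^ k) =ᵐ[Λ]
      fun p => (clusterStat a p + clusterStat b p + clusterStat c p) ^ k := fun k => by
    filter_upwards [Gabc k, Gab 1] with p h1 h2
    rw [pow_one, pow_one] at h2
    rw [h1, h2]
  have iX : ∀ {g : ℝ → ℝ≥0∞}, IsTestFun g →
      Integrable (fun ω => linStat (clusterProcess U ξ D ω) g ^ 3) P := fun {g} hg =>
    (h.moments hf hm₀ hm₁ hg).1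
  have iG : ∀ {g : ℝ → ℝ≥0∞}, IsTestFun g →
      Integrable (fun p => clusterStat g p ^ 3) Λ := fun {g} hg =>
    integrable_clusterStat_pow (ν := ν) hμ hg (k := 2) (by simp)
  have pX := integral_mul_mul_polarization (iX ha) (iX hb) (iX hc) ((iX hab).congr (Xab 3))
    ((iX hac).congr (Xac 3)) ((iX hbc).congr (Xbc 3)) ((iX habc).congr Xabc3)
  have pG := integral_mul_mul_polarization (iG ha) (iG hb) (iG hc) ((iG hab).congr (Gab 3))
    ((iG hac).congr (Gac 3)) ((iG hbc).congr (Gbc 3)) ((iG habc).congr (Gabc' 3))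
  refine ⟨pX.1, pG.1, ?_⟩
  have jG : ∀ {g : ℝ → ℝ≥0∞}, IsTestFun g →
      Integrable (fun p => clusterStat g p ^ 2) Λ := fun {g} hg =>
    integrable_clusterStat_pow (ν := ν) hμ hg (k := 1) (by simp)
  have qab := (integral_mul_polarization (jG ha) (jG hb) ((jG hab).congr (Gab 2))).2
  have qac := (integral_mul_polarization (jG ha) (jG hc) ((jG hac).congr (Gac 2))).2
  have qbc := (integral_mul_polarization (jG hb) (jG hc) ((jG hbc).congr (Gbc 2))).2
  -- From `(a+b+c)² = (a+b)² + (a+c)² + (b+c)² - a² - b² - c²`: the second moment of the triple sum,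
  -- which enters its third moment, reduces to those of the pairs.
  have qabc : ∫ p, clusterStat (fun x => a x + b x + c x) p ^ 2 ∂Λ =
      (∫ p, clusterStat (fun x => a x + b x) p ^ 2 ∂Λ) +
      (∫ p, clusterStat (fun x => a x + c x) p ^ 2 ∂Λ) +
      (∫ p, clusterStat (fun x => b x + c x) p ^ 2 ∂Λ) - (∫ p, clusterStat a p ^ 2 ∂Λ)
        - (∫ p, clusterStat b p ^ 2 ∂Λ) - ∫ p, clusterStat c p ^ 2 ∂Λ := by
    have e : (fun p => clusterStat (fun x => a x + b x + c x) p ^ 2) =ᵐ[Λ] fun p =>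
        ((((clusterStat (fun x => a x + b x) p ^ 2 + clusterStat (fun x => a x + c x) p ^ 2)
          + clusterStat (fun x => b x + c x) p ^ 2) - clusterStat a p ^ 2)
          - clusterStat b p ^ 2) - clusterStat c p ^ 2 := by
      filter_upwards [Gabc' 2, Gab 2, Gac 2, Gbc 2] with p h1 h2 h3 h4
      rw [h1, h2, h3, h4]
      ring
    have i1 : Integrable (fun p => clusterStat (fun x => a x + b x) p ^ 2 +
      clusterStat (fun x => a x + c x) p ^ 2) Λ := (jG hab).add (jG hac)
    have i2 : Integrable (fun p => clusterStat (fun x => a x + b x) p ^ 2 +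
      clusterStat (fun x => a x + c x) p ^ 2 + clusterStat (fun x => b x + c x) p ^ 2) Λ :=
      i1.add (jG hbc)
    have i3 : Integrable (fun p => clusterStat (fun x => a x + b x) p ^ 2 +
      clusterStat (fun x => a x + c x) p ^ 2 + clusterStat (fun x => b x + c x) p ^ 2
      - clusterStat a p ^ 2) Λ := i2.sub (jG ha)
    have i4 : Integrable (fun p => clusterStat (fun x => a x + b x) p ^ 2 +
      clusterStat (fun x => a x + c x) p ^ 2 + clusterStat (fun x => b x + c x) p ^ 2
      - clusterStat a p ^ 2 - clusterStat b p ^ 2) Λ := i3.sub (jG hb)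
    rw [integral_congr_ae e, integral_sub i4 (jG hc), integral_sub i3 (jG hb),
      integral_sub i2 (jG ha), integral_add i1 (jG hbc), integral_add (jG hab) (jG hac)]
  -- After substituting the moment formula for each of the seven sums of test functions, the claim
  -- is a polynomial identity in the cluster integrals.
  rw [pX.2, pG.2, qab, qac, qbc, ← integral_congr_ae Xabc3, ← integral_congr_ae (Xab 3),
    ← integral_congr_ae (Xac 3), ← integral_congr_ae (Xbc 3), ← integral_congr_ae (Gabc' 3),
    ← integral_congr_ae (Gab 3), ← integral_congr_ae (Gac 3), ← integral_congr_ae (Gbc 3),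
    ← integral_congr_ae (Gab 2), ← integral_congr_ae (Gac 2), ← integral_congr_ae (Gbc 2),
    (h.moments hf hm₀ hm₁ habc).2.2.2, (h.moments hf hm₀ hm₁ hab).2.2.2,
    (h.moments hf hm₀ hm₁ hac).2.2.2, (h.moments hf hm₀ hm₁ hbc).2.2.2,
    (h.moments hf hm₀ hm₁ ha).2.2.2, (h.moments hf hm₀ hm₁ hb).2.2.2,
    (h.moments hf hm₀ hm₁ hc).2.2.2, (h.moments hf hm₀ hm₁ ha).2.1,
    (h.moments hf hm₀ hm₁ hb).2.1, (h.moments hf hm₀ hm₁ hc).2.1, ← hΛ, qabc, Iabc, Iab, Iac, Ibc]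
  ring

lemma linStat_indicator (N : Measure ℝ) {A : Set ℝ} (hA : MeasurableSet A) :
    linStat N (A.indicator 1) = N.real A := by
  rw [linStat, lintegral_indicator_one hA, Measure.real]

/-- The complete covariance measure. -/
theorem IsBranchingData.completeCumulant2_eq (hf : IsProbDensity f)
    (h : IsBranchingData P ν m f U ξ D) (hm₀ : 0 < m) (hm₁ : m < 1) {A B : Set ℝ}
    (hA : MeasurableSet A) (hB : MeasurableSet B) (bA : Bornology.IsBounded A)
    (bB : Bornology.IsBounded B) :
    completeCumulant2 P (clusterProcess U ξ D) A B =
      ∫ p, clusterStat (A.indicator 1) p * clusterStat (B.indicator 1) p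
        ∂clusterIntensity ν (offspringLaw m f) := by
  have := (h.integral_mul hf hm₀ hm₁ (isTestFun_indicator hA bA) (isTestFun_indicator hB bB)).2.2
  simp only [linStat_indicator _ hA, linStat_indicator _ hB] at this
  rw [completeCumulant2, this]
  ring

/-- The complete third cumulant measure. -/
theorem IsBranchingData.completeCumulant3_eq (hf : IsProbDensity f)
    (h : IsBranchingData P ν m f U ξ D) (hm₀ : 0 < m) (hm₁ : m < 1) {A B C : Set ℝ}
    (hA : MeasurableSet A) (hB : MeasurableSet B) (hC : MeasurableSet C)
    (bA : Bornology.IsBounded A) (bB : Bornology.IsBounded B) (bC : Bornology.IsBounded C) :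
    completeCumulant3 P (clusterProcess U ξ D) A B C =
      ∫ p, clusterStat (A.indicator 1) p * clusterStat (B.indicator 1) p *
        clusterStat (C.indicator 1) p ∂clusterIntensity ν (offspringLaw m f) := by
  have tA := isTestFun_indicator hA bA
  have tB := isTestFun_indicator hB bB
  have tC := isTestFun_indicator hC bC
  have h3 := (h.integral_mul_mul hf hm₀ hm₁ tA tB tC).2.2
  have hab := (h.integral_mul hf hm₀ hm₁ tA tB).2.2
  have hac := (h.integral_mul hf hm₀ hm₁ tA tC).2.2
  have hbc := (h.integral_mul hf hm₀ hm₁ tB tC).2.2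
  simp only [linStat_indicator _ hA, linStat_indicator _ hB, linStat_indicator _ hC]
    at h3 hab hac hbc
  rw [completeCumulant3, h3, hab, hac, hbc]
  ring

/-- The factorial third cumulant measure differs from the complete one by diagonal terms. -/
theorem IsBranchingData.factorialCumulant3_eq (hf : IsProbDensity f)
    (h : IsBranchingData P ν m f U ξ D) (hm₀ : 0 < m) (hm₁ : m < 1) {A B C : Set ℝ}
    (hA : MeasurableSet A) (hB : MeasurableSet B) (hC : MeasurableSet C)
    (bA : Bornology.IsBounded A) (bB : Bornology.IsBounded B) (bC : Bornology.IsBounded C) :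
    factorialCumulant3 P (clusterProcess U ξ D) A B C =
      completeCumulant3 P (clusterProcess U ξ D) A B C
        - completeCumulant2 P (clusterProcess U ξ D) (A ∩ B) C
        - completeCumulant2 P (clusterProcess U ξ D) (A ∩ C) B
        - completeCumulant2 P (clusterProcess U ξ D) A (B ∩ C)
        + 2 * ∫ ω, (clusterProcess U ξ D ω).real (A ∩ B ∩ C) ∂P := by
  set N := clusterProcess U ξ D with hN
  have tst : ∀ {A : Set ℝ}, MeasurableSet A → Bornology.IsBounded A → IsTestFun (A.indicator 1) :=
    fun hA bA => isTestFun_indicator hA bA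
  have i1 : ∀ {A : Set ℝ}, MeasurableSet A → Bornology.IsBounded A →
      Integrable (fun ω => (N ω).real A) P := fun {A} hA bA => by
    have := h.integrable_linStat_pow hf hm₀ hm₁ (tst hA bA) (k := 1) (by simp)
    simpa only [linStat_indicator _ hA, pow_one] using this
  have i2 : ∀ {A B : Set ℝ}, MeasurableSet A → MeasurableSet B → Bornology.IsBounded A →
      Bornology.IsBounded B → Integrable (fun ω => (N ω).real A * (N ω).real B) P :=
    fun {A B} hA hB bA bB => by
      have := (h.integral_mul hf hm₀ hm₁ (tst hA bA) (tst hB bB)).1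
      simpa only [linStat_indicator _ hA, linStat_indicator _ hB] using this
  have i3 : Integrable (fun ω => (N ω).real A * (N ω).real B * (N ω).real C) P := by
    have := (h.integral_mul_mul hf hm₀ hm₁ (tst hA bA) (tst hB bB) (tst hC bC)).1
    simpa only [linStat_indicator _ hA, linStat_indicator _ hB, linStat_indicator _ hC] using this
  have bAB : Bornology.IsBounded (A ∩ B) := bA.subset inter_subset_left
  have bAC : Bornology.IsBounded (A ∩ C) := bA.subset inter_subset_left
  have bBC : Bornology.IsBounded (B ∩ C) := bB.subset inter_subset_left
  have bABC : Bornology.IsBounded (A ∩ B ∩ C) := bAB.subset inter_subset_left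
  have f2 : ∀ {A B : Set ℝ}, MeasurableSet A → MeasurableSet B → Bornology.IsBounded A →
      Bornology.IsBounded B → factorialMoment2 P N A B =
        (∫ ω, (N ω).real A * (N ω).real B ∂P) - ∫ ω, (N ω).real (A ∩ B) ∂P :=
    fun {A B} hA hB bA bB => by
      unfold factorialMoment2 factorialProd2
      rw [integral_sub (i2 hA hB bA bB) (i1 (hA.inter hB) (bA.subset inter_subset_left))]
  have f3 : factorialMoment3 P N A B C =
      (∫ ω, (N ω).real A * (N ω).real B * (N ω).real C ∂P)
        - (∫ ω, (N ω).real (A ∩ B) * (N ω).real C ∂P)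
        - (∫ ω, (N ω).real (A ∩ C) * (N ω).real B ∂P)
        - (∫ ω, (N ω).real (B ∩ C) * (N ω).real A ∂P)
        + 2 * ∫ ω, (N ω).real (A ∩ B ∩ C) ∂P := by
    unfold factorialMoment3 factorialProd3
    have j1 := i2 (hA.inter hB) hC bAB bC
    have j2 := i2 (hA.inter hC) hB bAC bB
    have j3 := i2 (hB.inter hC) hA bBC bA
    have j4 := (i1 ((hA.inter hB).inter hC) bABC).const_mul 2
    have k1 : Integrable (fun ω => (N ω).real A * (N ω).real B * (N ω).real C
      - (N ω).real (A ∩ B) * (N ω).real C) P := i3.sub j1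
    have k2 : Integrable (fun ω => (N ω).real A * (N ω).real B * (N ω).real C
      - (N ω).real (A ∩ B) * (N ω).real C - (N ω).real (A ∩ C) * (N ω).real B) P := k1.sub j2
    have k3 : Integrable (fun ω => (N ω).real A * (N ω).real B * (N ω).real C
      - (N ω).real (A ∩ B) * (N ω).real C - (N ω).real (A ∩ C) * (N ω).real B
      - (N ω).real (B ∩ C) * (N ω).real A) P := k2.sub j3
    rw [integral_add k3 j4, integral_sub k2 j3, integral_sub k1 j2, integral_sub i3 j1,
      integral_const_mul]
  rw [factorialCumulant3, f3, f2 hA hB bA bB, f2 hA hC bA bC, f2 hB hC bB bC, completeCumulant3,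
    completeCumulant2, completeCumulant2, completeCumulant2]
  simp_rw [mul_comm ((N _).real (B ∩ C)) ((N _).real A)]
  ring

/-- All counts of bounded sets have finite moments up to order three. -/
theorem IsBranchingData.hasFiniteMoments (hf : IsProbDensity f)
    (h : IsBranchingData P ν m f U ξ D) (hm₀ : 0 < m) (hm₁ : m < 1) {k : ℕ} (hk : k ≤ 3) :
    HasFiniteMoments k P (clusterProcess U ξ D) := by
  refine ⟨h.measurable_superposition.aemeasurable, fun A hA bA => ?_⟩
  have tA := isTestFun_indicator hA bA
  have h1 := h.integrable_linStat_pow hf hm₀ hm₁ tA hk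
  have h2 := h1.lintegral_lt_top
  refine lt_of_eq_of_lt (lintegral_congr_ae ?_) h2
  filter_upwards [h.ae_lintegral_lt_top hf hm₀ hm₁ tA] with ω hω
  rw [linStat, ENNReal.ofReal_pow ENNReal.toReal_nonneg, ENNReal.ofReal_toReal hω.ne,
    lintegral_indicator_one hA]

end ClusterMoments

/-! ### Characters and transforms of densities -/

section Phase

/-- `e^{-iωy}`. -/
noncomputable def phase (ω y : ℝ) : ℂ := Complex.exp (-((ω * y : ℝ) : ℂ) * Complex.I)

lemma norm_phase (ω y : ℝ) : ‖phase ω y‖ = 1 := by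
  rw [phase, ← Complex.ofReal_neg, Complex.norm_exp_ofReal_mul_I]

lemma phase_add (ω y z : ℝ) : phase ω (y + z) = phase ω y * phase ω z := by
  rw [phase, phase, phase, ← Complex.exp_add]
  congr 1
  push_cast
  ring

lemma phase_zero (ω : ℝ) : phase ω 0 = 1 := by simp [phase]

lemma phase_zero_left (y : ℝ) : phase 0 y = 1 := by simp [phase]

lemma star_phase (ω y : ℝ) : (starRingEnd ℂ) (phase ω y) = phase ω (-y) := by
  rw [phase, phase, ← Complex.exp_conj]
  simp

@[fun_prop] lemma continuous_phase (ω : ℝ) : Continuous (phase ω) := by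
  unfold phase; fun_prop

lemma fourierR_eq_integral_densityMeasure {f : ℝ → ℝ} (hf : IsProbDensity f) (ω : ℝ) :
    fourierR f ω = ∫ y, phase ω y ∂densityMeasure f := by
  rw [densityMeasure, integral_withDensity_eq_integral_toReal_smul
    hf.measurable.ennreal_ofReal (by simp)]
  refine integral_congr_ae (Eventually.of_forall fun y => ?_)
  simp only [ENNReal.toReal_ofReal (hf.nonneg y), Complex.real_smul, phase]
  ring

end Phase

/-! ### Factorial moments of the Poisson law -/

section PoissonMoments

lemma hasSum_poisson_mul (r : ℝ≥0) :
    HasSum (fun n : ℕ => Real.exp (-r) * r ^ n / n.factorial * (n : ℝ)) r := by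
  refine (hasSum_nat_add_iff' 1).1 ?_
  simp only [Finset.range_one, Finset.sum_singleton, Nat.cast_zero, mul_zero, sub_zero]
  convert! (hasSum_one_poissonMeasure r).mul_left (r : ℝ) using 2 with n
  · rw [Nat.factorial_succ]
    push_cast
    field_simp
    ring
  · rw [mul_one]

lemma hasSum_poisson_mul_pred (r : ℝ≥0) :
    HasSum (fun n : ℕ => Real.exp (-r) * r ^ n / n.factorial * ((n : ℝ) * (n - 1)))
      ((r : ℝ) ^ 2) := by
  refine (hasSum_nat_add_iff' 1).1 ?_
  simp only [Finset.range_one, Finset.sum_singleton, Nat.cast_zero, zero_mul, mul_zero, sub_zero]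
  convert! (hasSum_poisson_mul r).mul_left (r : ℝ) using 2 with n
  · rw [Nat.factorial_succ]
    push_cast
    field_simp
    ring
  · ring

/-- Conditional moments of a cluster given `n` children have this shape: a constant, one term per
child, and one term per ordered pair of distinct children. -/
lemma integral_poisson_affine (r : ℝ≥0) (a b c : ℂ) :
    ∫ n, (a + n * b + n * (n - 1) * c) ∂poissonMeasure r = a + r * b + r ^ 2 * c := by
  rw [integral_poissonMeasure]
  refine HasSum.tsum_eq ?_
  have h0 := ((hasSum_one_poissonMeasure r).mapL Complex.ofRealCLM).mul_right a
  have h1 := ((hasSum_poisson_mul r).mapL Complex.ofRealCLM).mul_right b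
  have h2 := ((hasSum_poisson_mul_pred r).mapL Complex.ofRealCLM).mul_right c
  convert! (h0.add h1).add h2 using 1
  · ext n
    simp only [Complex.real_smul, Complex.ofRealCLM_apply]
    push_cast
    ring
  · simp

end PoissonMoments

/-! ### Fourier transform of a rooted cluster -/

namespace TreeData

open Classical in
/-- Fourier transform of the rooted cluster. -/
noncomputable def spectral (ω : ℝ) (x : TreeData) : ℂ :=
  ∑' v, if x.Mem v then phase ω (x.pos v) else 0

open Classical in
-- Every vertex contributes modulus one, so absolute summability means that there are finitely many
-- vertices.
lemma summable_ite_mem_iff (x : TreeData) {F : List ℕ → ℂ} (hF : ∀ v, ‖F v‖ = 1) :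
    (Summable fun v => if x.Mem v then F v else 0) ↔ x.total ≠ ∞ := by
  have h : x.total = ∑' v, ENNReal.ofNNReal ‖if x.Mem v then F v else 0‖₊ := by
    rw [total, vsum]
    congr 1 with v
    split_ifs
    · rw [show ‖F v‖₊ = 1 from NNReal.eq (hF v)]; simp
    · simp
  rw [h, ENNReal.tsum_coe_ne_top_iff_summable, ← summable_norm_iff]
  simp_rw [← coe_nnnorm]
  exact NNReal.summable_coe

open Classical in
lemma hasSum_spectral (ω : ℝ) {x : TreeData} (hx : x.total ≠ ∞) :
    HasSum (fun v => if x.Mem v then phase ω (x.pos v) else 0) (spectral ω x) :=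
  ((summable_ite_mem_iff x fun _ => norm_phase _ _).2 hx).hasSum

/-- On an infinite tree the family is not summable and `tsum` takes its default value; these trees
are null in the subcritical case. -/
lemma spectral_of_total_eq_top (ω : ℝ) {x : TreeData} (hx : x.total = ∞) : spectral ω x = 0 :=
  tsum_eq_zero_of_not_summable
    (mt (summable_ite_mem_iff x fun _ => norm_phase _ _).1 (not_not.2 hx))

lemma measurable_spectral (ω : ℝ) : Measurable (spectral ω) := by
  classical
  have hset : MeasurableSet {x : TreeData | x.total ≠ ∞} :=
    measurable_total (measurableSet_singleton ∞).compl
  -- Setting the partial sums to zero on infinite trees makes them converge to `spectral ω`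
  -- everywhere.
  refine measurable_of_tendsto_metrizable' (atTop : Filter (Finset (List ℕ)))
    (f := fun s x => ∑ v ∈ s, {x : TreeData | x.total ≠ ∞}.indicator
      (fun x => if x.Mem v then phase ω (x.pos v) else 0) x) (fun s => ?_) ?_
  · refine Finset.measurable_fun_sum _ fun v _ => Measurable.indicator ?_ hset
    exact measurable_ite_mem measurable_id v
      ((continuous_phase ω).measurable.comp (measurable_pos v))
  · refine tendsto_pi_nhds.2 fun x => ?_
    by_cases hx : x.total = ∞
    · simp only [Set.indicator, Set.mem_ofPred_eq, hx, ne_eq, not_true_eq_false, if_false,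
        Finset.sum_const_zero, spectral_of_total_eq_top ω hx]
      exact tendsto_const_nhds
    · simp only [Set.indicator, Set.mem_ofPred_eq, hx, ne_eq, not_false_eq_true, if_true]
      exact hasSum_spectral ω hx

lemma norm_spectral_le (ω : ℝ) (x : TreeData) : ‖spectral ω x‖ ≤ x.total.toReal := by
  classical
  by_cases hx : x.total = ∞
  · rw [spectral_of_total_eq_top ω hx]; simp
  have h := ((summable_ite_mem_iff x fun v => norm_phase ω (x.pos v)).2 hx).norm
  refine (norm_tsum_le_tsum_norm h).trans (le_of_eq ?_)
  rw [total, vsum, ENNReal.tsum_toReal_eq]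
  · congr 1 with v
    split_ifs
    · simp [norm_phase]
    · simp
  · intro v; split_ifs <;> simp

lemma spectral_zero {x : TreeData} : spectral 0 x = (x.total.toReal : ℂ) := by
  classical
  by_cases hx : x.total = ∞
  · rw [spectral_of_total_eq_top 0 hx, hx]; simp
  rw [spectral, total, vsum, ENNReal.tsum_toReal_eq, Complex.ofReal_tsum]
  · congr 1 with v
    split_ifs <;> simp [phase_zero_left]
  · intro v; split_ifs <;> simp

/-- Decomposition at the root. -/
lemma spectral_eq (ω : ℝ) {x : TreeData} (hx : x.total ≠ ∞) :
    spectral ω x = 1 + ∑ i ∈ Finset.range (x []).1,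
      phase ω (x.branch i []).2 * spectral ω (x.branch i) := by
  classical
  have hs := (summable_ite_mem_iff x fun v => norm_phase ω (x.pos v)).2 hx
  have hinj : Function.Injective fun p : ℕ × List ℕ => p.1 :: p.2 := fun p q h => by
    obtain ⟨h1, h2⟩ := List.cons.inj h
    exact Prod.ext h1 h2
  have hs2 : Summable fun p : ℕ × List ℕ =>
      if x.Mem (p.1 :: p.2) then phase ω (x.pos (p.1 :: p.2)) else 0 := hs.comp_injective hinj
  rw [spectral, (hasSum_list (F := fun v => if x.Mem v then phase ω (x.pos v) else 0)
    hs2.hasSum).tsum_eq]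
  congr 1
  · simp [phase_zero]
  rw [hs2.tsum_prod, tsum_eq_sum (s := Finset.range (x []).1)]
  · refine Finset.sum_congr rfl fun i hi => ?_
    rw [spectral, ← tsum_mul_left]
    congr 1 with w
    rw [mem_cons, pos_cons, phase_add]
    simp only [Finset.mem_range.1 hi, true_and]
    split_ifs <;> simp
  · intro i hi
    simp only [mem_cons, Finset.mem_range.not.1 hi, false_and, if_false, tsum_zero]

end TreeData

/-! ### First and second moments of the cluster transform -/

section Spectrum

variable {m : ℝ≥0} {κ : Measure ℝ} [IsProbabilityMeasure κ]

lemma ae_total_ne_top (hm₀ : 0 < m) (hm : m < 1) : ∀ᵐ x ∂treeLaw m κ, x.total ≠ ∞ := by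
  filter_upwards [ae_lt_top (measurable_total.pow_const 3)
    (lintegral_total_pow_three_lt_top (κ := κ) hm₀ hm).ne] with x hx h
  simp [h] at hx

lemma integrable_total_pow (hm₀ : 0 < m) (hm : m < 1) {k : ℕ} (hk : k ≤ 3) :
    Integrable (fun x : TreeData => x.total.toReal ^ k) (treeLaw m κ) := by
  refine integrable_pow_of_pow_three measurable_total.ennreal_toReal
    (fun _ => ENNReal.toReal_nonneg) ?_ hk
  simpa [ENNReal.toReal_pow] using integrable_toReal_of_lintegral_ne_top
    (measurable_total.pow_const 3).aemeasurable
    (lintegral_total_pow_three_lt_top (κ := κ) hm₀ hm).ne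

lemma integrable_spectral (hm₀ : 0 < m) (hm : m < 1) (ω : ℝ) :
    Integrable (spectral ω) (treeLaw m κ) := by
  refine (integrable_total_pow (κ := κ) hm₀ hm (k := 1) (by simp)).mono'
    (measurable_spectral ω).aestronglyMeasurable (Eventually.of_forall fun x => ?_)
  simpa using norm_spectral_le ω x

lemma integrable_spectral_mul_conj (hm₀ : 0 < m) (hm : m < 1) (ω : ℝ) :
    Integrable (fun x => spectral ω x * (starRingEnd ℂ) (spectral ω x)) (treeLaw m κ) := by
  have hmeas := measurable_spectral ω
  refine (integrable_total_pow (κ := κ) hm₀ hm (k := 2) (by simp)).mono'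
    (by fun_prop) (Eventually.of_forall fun x => ?_)
  rw [norm_mul, RCLike.norm_conj, ← pow_two]
  exact pow_le_pow_left₀ (norm_nonneg _) (norm_spectral_le ω x) 2

/-- The sum over the subtree of a child, seen from its parent. -/
noncomputable def displacedSpectral (ω : ℝ) (x : TreeData) : ℂ :=
  phase ω (x []).2 * spectral ω x

lemma measurable_displacedSpectral (ω : ℝ) : Measurable (displacedSpectral ω) :=
  ((continuous_phase ω).measurable.comp (measurable_snd.comp (measurable_pi_apply _))).mul
    (measurable_spectral ω)

lemma integrable_displacedSpectral (hm₀ : 0 < m) (hm : m < 1) (ω : ℝ) :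
    Integrable (displacedSpectral ω) (treeLaw m κ) := by
  refine (integrable_spectral (κ := κ) hm₀ hm ω).norm.mono'
    (measurable_displacedSpectral ω).aestronglyMeasurable (Eventually.of_forall fun x => ?_)
  rw [displacedSpectral, norm_mul, norm_phase, one_mul]

lemma displacedSpectral_mul_conj (ω : ℝ) (x : TreeData) :
    displacedSpectral ω x * (starRingEnd ℂ) (displacedSpectral ω x) =
      spectral ω x * (starRingEnd ℂ) (spectral ω x) := by
  have h : phase ω (x []).2 * (starRingEnd ℂ) (phase ω (x []).2) = 1 := by
    rw [star_phase, ← phase_add, add_neg_cancel, phase_zero]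
  rw [displacedSpectral, map_mul]
  linear_combination (spectral ω x * (starRingEnd ℂ) (spectral ω x)) * h

/-- The sum over the cluster, in terms of the offspring number and the subtrees. -/
noncomputable def rootSum (ω : ℝ) (q : ℕ × (ℕ → TreeData)) : ℂ :=
  1 + ∑ i ∈ Finset.range q.1, displacedSpectral ω (q.2 i)

lemma measurable_rootSum (ω : ℝ) : Measurable (rootSum ω) :=
  measurable_from_prod_countable_right fun k => by
    change Measurable fun T : ℕ → TreeData =>
      1 + ∑ i ∈ Finset.range k, displacedSpectral ω (T i)
    exact measurable_const.add (Finset.measurable_fun_sum _ fun i _ =>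
      (measurable_displacedSpectral ω).comp (measurable_pi_apply i))

lemma spectral_ae_eq (hm₀ : 0 < m) (hm : m < 1) (ω : ℝ) :
    ∀ᵐ x ∂treeLaw m κ, spectral ω x = rootSum ω ((x []).1, x.branch) := by
  filter_upwards [ae_total_ne_top (κ := κ) hm₀ hm] with x hx
  exact spectral_eq ω hx

/-- The displacement stored at the root is not used by its own tree; it is independent of the
offspring number and of the branches, which determine `spectral` almost surely. -/
lemma treeLaw_map_displacement :
    (treeLaw m κ).map (fun x => ((x []).2, ((x []).1, x.branch))) =
      κ.prod ((poissonMeasure m).prod (Measure.infinitePi fun _ : ℕ => treeLaw m κ)) := by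
  set Q := Measure.infinitePi fun _ : ℕ => treeLaw m κ with hQ
  have h1 : MeasurePreserving (fun x : TreeData => (x [], x.branch)) (treeLaw m κ)
      (((poissonMeasure m).prod κ).prod Q) := ⟨measurable_root_branches, treeLaw_map_root_branches⟩
  have h2 : MeasurePreserving (Prod.map Prod.swap id) (((poissonMeasure m).prod κ).prod Q)
      ((κ.prod (poissonMeasure m)).prod Q) :=
    (Measure.measurePreserving_swap).prod (MeasurePreserving.id Q)
  have h3 := measurePreserving_prodAssoc κ (poissonMeasure m) Q
  exact ((h3.comp h2).comp h1).map_eq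

lemma integral_displacedSpectral (hm₀ : 0 < m) (hm : m < 1) (ω : ℝ) :
    ∫ x, displacedSpectral ω x ∂treeLaw m κ =
      (∫ y, phase ω y ∂κ) * ∫ x, spectral ω x ∂treeLaw m κ := by
  set Q := Measure.infinitePi fun _ : ℕ => treeLaw m κ with hQ
  have hmeas : Measurable fun x : TreeData => ((x []).2, ((x []).1, x.branch)) :=
    (measurable_snd.comp (measurable_pi_apply _)).prodMk
      ((measurable_fst.comp (measurable_pi_apply _)).prodMk
        (measurable_pi_iff.2 fun i => measurable_branch i))
  have hG := measurable_rootSum ω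
  have e1 : ∫ x, displacedSpectral ω x ∂treeLaw m κ =
      ∫ q, phase ω q.1 * rootSum ω q.2 ∂(κ.prod ((poissonMeasure m).prod Q)) := by
    have hF : Measurable fun q : ℝ × ℕ × (ℕ → TreeData) => phase ω q.1 * rootSum ω q.2 :=
      ((continuous_phase ω).measurable.comp measurable_fst).mul (hG.comp measurable_snd)
    rw [← treeLaw_map_displacement, integral_map hmeas.aemeasurable hF.aestronglyMeasurable]
    refine integral_congr_ae ?_
    filter_upwards [spectral_ae_eq (κ := κ) hm₀ hm ω] with x hx
    rw [displacedSpectral, hx]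
  -- The factor `1` puts the undisplaced mean in the same product form, so both integrals factor and
  -- share the integral of `rootSum`.
  have e2 : ∫ x, spectral ω x ∂treeLaw m κ =
      ∫ q, 1 * rootSum ω q.2 ∂(κ.prod ((poissonMeasure m).prod Q)) := by
    have hF : Measurable fun q : ℝ × ℕ × (ℕ → TreeData) => 1 * rootSum ω q.2 :=
      measurable_const.mul (hG.comp measurable_snd)
    rw [← treeLaw_map_displacement, integral_map hmeas.aemeasurable hF.aestronglyMeasurable]
    refine integral_congr_ae ?_
    filter_upwards [spectral_ae_eq (κ := κ) hm₀ hm ω] with x hx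
    rw [hx, one_mul]
  rw [e1, e2, integral_prod_mul (phase ω) (rootSum ω), integral_prod_mul (fun _ => 1) (rootSum ω)]
  simp

lemma measurePreserving_offspring_branches :
    MeasurePreserving (fun x : TreeData => ((x []).1, x.branch)) (treeLaw m κ)
      ((poissonMeasure m).prod (Measure.infinitePi fun _ : ℕ => treeLaw m κ)) := by
  have h1 : MeasurePreserving (fun x : TreeData => ((x []).2, ((x []).1, x.branch)))
      (treeLaw m κ) _ := ⟨(measurable_snd.comp (measurable_pi_apply _)).prodMk
      ((measurable_fst.comp (measurable_pi_apply _)).prodMk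
        (measurable_pi_iff.2 fun i => measurable_branch i)), treeLaw_map_displacement⟩
  exact measurePreserving_snd.comp h1

lemma integral_treeLaw_root {E : Type*} [NormedAddCommGroup E] [NormedSpace ℝ E]
    {F : ℕ × (ℕ → TreeData) → E} (hF : StronglyMeasurable F)
    (hI : Integrable (fun x : TreeData => F ((x []).1, x.branch)) (treeLaw m κ)) :
    ∫ x, F ((x []).1, x.branch) ∂treeLaw m κ =
      ∫ n, ∫ T, F (n, T) ∂(Measure.infinitePi fun _ : ℕ => treeLaw m κ) ∂poissonMeasure m := by
  have hmp := measurePreserving_offspring_branches (m := m) (κ := κ)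
  have hF' : AEStronglyMeasurable F
    ((treeLaw m κ).map fun x : TreeData => ((x []).1, x.branch)) := hF.aestronglyMeasurable
  rw [← integral_map hmp.measurable.aemeasurable hF', hmp.map_eq, integral_prod]
  rw [← hmp.map_eq]
  exact (integrable_map_measure hF' hmp.measurable.aemeasurable).2 hI

lemma integral_eval_branches {φ : TreeData → ℂ} (hφ : Measurable φ) (i : ℕ) :
    ∫ T, φ (T i) ∂(Measure.infinitePi fun _ : ℕ => treeLaw m κ) = ∫ x, φ x ∂treeLaw m κ := by
  have hmp := measurePreserving_eval_infinitePi (fun _ : ℕ => treeLaw m κ) i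
  have h := integral_map (μ := Measure.infinitePi fun _ : ℕ => treeLaw m κ)
    hmp.measurable.aemeasurable hφ.aestronglyMeasurable
  rw [hmp.map_eq] at h
  exact h.symm

lemma integrable_eval_branches {φ : TreeData → ℂ}
    (hI : Integrable φ (treeLaw m κ)) (i : ℕ) :
    Integrable (fun T : ℕ → TreeData => φ (T i))
      (Measure.infinitePi fun _ : ℕ => treeLaw m κ) :=
  (measurePreserving_eval_infinitePi (fun _ : ℕ => treeLaw m κ) i).integrable_comp_of_integrable hI

/-- Mean of the Fourier transform of the cluster. -/
theorem integral_spectral (hm₀ : 0 < m) (hm : m < 1) (ω : ℝ) :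
    (∫ x, spectral ω x ∂treeLaw m κ) =
      1 + m * ((∫ y, phase ω y ∂κ) * ∫ x, spectral ω x ∂treeLaw m κ) := by
  have hS := integrable_spectral (κ := κ) hm₀ hm ω
  have hae := spectral_ae_eq (κ := κ) hm₀ hm ω
  rw [← integral_displacedSpectral hm₀ hm]
  nth_rewrite 1 [integral_congr_ae hae]
  rw [integral_treeLaw_root (measurable_rootSum ω).stronglyMeasurable (hS.congr hae)]
  have hD := integrable_displacedSpectral (κ := κ) hm₀ hm ω
  -- Given `n` children the mean is affine in `n`, so only the Poisson mean enters.
  have h : ∀ n, ∫ T, rootSum ω (n, T) ∂(Measure.infinitePi fun _ : ℕ => treeLaw m κ) =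
      1 + n * (∫ x, displacedSpectral ω x ∂treeLaw m κ) + n * (n - 1) * 0 := fun n => by
    simp only [rootSum]
    rw [integral_add (integrable_const _)
      (integrable_finsetSum _ fun i _ => integrable_eval_branches hD i),
      integral_finsetSum _ fun i _ => integrable_eval_branches hD i]
    simp [integral_eval_branches (measurable_displacedSpectral ω)]
  simp_rw [h]
  rw [integral_poisson_affine]
  simp

/-- Distinct branches are independent, so the expectation factors; for the same branch the
unimodular displacement phase cancels. -/
lemma integral_displaced_mul_conj (hm₀ : 0 < m) (hm : m < 1) (ω : ℝ) (i j : ℕ) :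
    Integrable (fun T : ℕ → TreeData => displacedSpectral ω (T i) *
        (starRingEnd ℂ) (displacedSpectral ω (T j)))
      (Measure.infinitePi fun _ : ℕ => treeLaw m κ) ∧
    ∫ T, displacedSpectral ω (T i) * (starRingEnd ℂ) (displacedSpectral ω (T j))
        ∂(Measure.infinitePi fun _ : ℕ => treeLaw m κ) =
      if i = j then ∫ x, spectral ω x * (starRingEnd ℂ) (spectral ω x) ∂treeLaw m κ else
        (∫ x, displacedSpectral ω x ∂treeLaw m κ) *
          (starRingEnd ℂ) (∫ x, displacedSpectral ω x ∂treeLaw m κ) := by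
  have hD := integrable_displacedSpectral (κ := κ) hm₀ hm ω
  have hmeas := measurable_displacedSpectral ω
  have hmeasc : Measurable fun x => (starRingEnd ℂ) (displacedSpectral ω x) := by fun_prop
  by_cases hij : i = j
  · subst hij
    simp only [displacedSpectral_mul_conj, if_true]
    have hS := measurable_spectral ω
    exact ⟨integrable_eval_branches (integrable_spectral_mul_conj hm₀ hm ω) i,
      integral_eval_branches (φ := fun x => spectral ω x * (starRingEnd ℂ) (spectral ω x))
        (by fun_prop) i⟩
  · rw [if_neg hij]
    have hDc : Integrable (fun x => (starRingEnd ℂ) (displacedSpectral ω x)) (treeLaw m κ) :=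
      hD.norm.mono' hmeasc.aestronglyMeasurable (Eventually.of_forall fun x => by simp)
    have hind : IndepFun (fun T : ℕ → TreeData => displacedSpectral ω (T i))
        (fun T : ℕ → TreeData => (starRingEnd ℂ) (displacedSpectral ω (T j)))
        (Measure.infinitePi fun _ : ℕ => treeLaw m κ) :=
      (((iIndepFun_infinitePi (P := fun _ : ℕ => treeLaw m κ) (X := fun _ x => x)
        fun _ => measurable_id).indepFun hij).comp hmeas hmeasc)
    refine ⟨hind.integrable_mul (integrable_eval_branches hD i)
      (integrable_eval_branches hDc j), ?_⟩
    rw [hind.integral_fun_mul_eq_mul_integral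
      (integrable_eval_branches hD i).aestronglyMeasurable
      (integrable_eval_branches hDc j).aestronglyMeasurable,
      integral_eval_branches hmeas, integral_eval_branches hmeasc, integral_conj]

/-- Second moment of the Fourier transform of the cluster. -/
theorem integral_spectral_mul_conj (hm₀ : 0 < m) (hm : m < 1) (ω : ℝ) :
    (∫ x, spectral ω x * (starRingEnd ℂ) (spectral ω x) ∂treeLaw m κ) =
      (∫ x, spectral ω x ∂treeLaw m κ) * (starRingEnd ℂ) (∫ x, spectral ω x ∂treeLaw m κ) +
        m * ∫ x, spectral ω x * (starRingEnd ℂ) (spectral ω x) ∂treeLaw m κ := by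
  have hS := integrable_spectral_mul_conj (κ := κ) hm₀ hm ω
  have hae := spectral_ae_eq (κ := κ) hm₀ hm ω
  set q := ∫ x, spectral ω x * (starRingEnd ℂ) (spectral ω x) ∂treeLaw m κ with hq
  have hmean : ∫ x, spectral ω x ∂treeLaw m κ =
      1 + m * ∫ x, displacedSpectral ω x ∂treeLaw m κ := by
    rw [integral_displacedSpectral hm₀ hm]
    exact integral_spectral hm₀ hm ω
  rw [hmean]
  set z := ∫ x, displacedSpectral ω x ∂treeLaw m κ with hz
  have hae' : ∀ᵐ x ∂treeLaw m κ, spectral ω x * (starRingEnd ℂ) (spectral ω x) =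
      (fun p => rootSum ω p * (starRingEnd ℂ) (rootSum ω p)) ((x []).1, x.branch) :=
    hae.mono fun x hx => by dsimp only; rw [hx]
  have hR := measurable_rootSum ω
  have hmeasF : Measurable fun p => rootSum ω p * (starRingEnd ℂ) (rootSum ω p) := by fun_prop
  have e1 : q = ∫ n, ∫ T, rootSum ω (n, T) * (starRingEnd ℂ) (rootSum ω (n, T))
      ∂(Measure.infinitePi fun _ : ℕ => treeLaw m κ) ∂poissonMeasure m := by
    rw [hq, integral_congr_ae hae']
    exact integral_treeLaw_root hmeasF.stronglyMeasurable (hS.congr hae')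
  have hD := integrable_displacedSpectral (κ := κ) hm₀ hm ω
  have hmeas := measurable_displacedSpectral ω
  have hmeasc : Measurable fun x => (starRingEnd ℂ) (displacedSpectral ω x) := by fun_prop
  have hDc : Integrable (fun x => (starRingEnd ℂ) (displacedSpectral ω x)) (treeLaw m κ) :=
    hD.norm.mono' hmeasc.aestronglyMeasurable (Eventually.of_forall fun x => by simp)
  -- Expanding the squared modulus of `1 + ∑ᵢ Dᵢ` gives `n` diagonal terms with mean `q` and `n (n -
  -- 1)` off-diagonal terms with mean `z * conj z`.
  have h : ∀ n : ℕ, ∫ T, rootSum ω (n, T) * (starRingEnd ℂ) (rootSum ω (n, T))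
      ∂(Measure.infinitePi fun _ : ℕ => treeLaw m κ) =
      1 + n * (z + (starRingEnd ℂ) z + q) + n * (n - 1) * (z * (starRingEnd ℂ) z) := fun n => by
    have hexp : ∀ T : ℕ → TreeData, rootSum ω (n, T) * (starRingEnd ℂ) (rootSum ω (n, T)) =
        1 + ∑ i ∈ Finset.range n, displacedSpectral ω (T i) +
          ∑ i ∈ Finset.range n, (starRingEnd ℂ) (displacedSpectral ω (T i)) +
          ∑ i ∈ Finset.range n, ∑ j ∈ Finset.range n, displacedSpectral ω (T i) *
            (starRingEnd ℂ) (displacedSpectral ω (T j)) := fun T => by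
      rw [← Finset.sum_mul_sum]
      simp only [rootSum, map_add, map_one, map_sum]
      ring
    simp_rw [hexp]
    have i1 := integrable_finsetSum (Finset.range n) fun i _ => integrable_eval_branches hD i
    have i2 := integrable_finsetSum (Finset.range n) fun i _ => integrable_eval_branches hDc i
    have i4 : ∀ i ∈ Finset.range n, Integrable (fun T : ℕ → TreeData =>
        ∑ j ∈ Finset.range n, displacedSpectral ω (T i) *
          (starRingEnd ℂ) (displacedSpectral ω (T j)))
        (Measure.infinitePi fun _ : ℕ => treeLaw m κ) := fun i _ =>
      integrable_finsetSum _ fun j _ => (integral_displaced_mul_conj hm₀ hm ω i j).1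
    have i3 := integrable_finsetSum (Finset.range n) i4
    have j1 : Integrable (fun T : ℕ → TreeData => 1 + ∑ i ∈ Finset.range n,
      displacedSpectral ω (T i)) (Measure.infinitePi fun _ : ℕ => treeLaw m κ) :=
      (integrable_const _).add i1
    have j2 : Integrable (fun T : ℕ → TreeData => 1 + ∑ i ∈ Finset.range n,
      displacedSpectral ω (T i) + ∑ i ∈ Finset.range n,
      (starRingEnd ℂ) (displacedSpectral ω (T i)))
      (Measure.infinitePi fun _ : ℕ => treeLaw m κ) := j1.add i2
    rw [integral_add j2 i3, integral_add j1 i2, integral_add (integrable_const _) i1,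
      integral_finsetSum _ fun i _ => integrable_eval_branches hD i,
      integral_finsetSum _ fun i _ => integrable_eval_branches hDc i,
      integral_finsetSum _ i4]
    have hsum : ∀ i ∈ Finset.range n, ∫ T, ∑ j ∈ Finset.range n, displacedSpectral ω (T i) *
          (starRingEnd ℂ) (displacedSpectral ω (T j))
          ∂(Measure.infinitePi fun _ : ℕ => treeLaw m κ) =
        q + (n - 1) * (z * (starRingEnd ℂ) z) := fun i hi => by
      rw [integral_finsetSum _ fun j _ => (integral_displaced_mul_conj hm₀ hm ω i j).1]
      simp_rw [(integral_displaced_mul_conj (κ := κ) hm₀ hm ω i _).2, ← hz, ← hq]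
      rw [← Finset.add_sum_erase _ _ hi, if_pos rfl, Finset.sum_congr rfl (g := fun _ =>
        z * (starRingEnd ℂ) z) fun j hj => if_neg (Finset.ne_of_mem_erase hj).symm,
        Finset.sum_const, Finset.card_erase_of_mem hi, Finset.card_range, nsmul_eq_mul,
        Nat.cast_pred (Nat.zero_lt_of_lt (Finset.mem_range.1 hi))]
    rw [Finset.sum_congr rfl hsum]
    simp only [integral_eval_branches hmeas, integral_eval_branches hmeasc, integral_conj,
      Finset.sum_const, Finset.card_range, nsmul_eq_mul, integral_const, probReal_univ, one_smul,
      ← hz]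
    ring
  -- The Poisson average is `1 + m (z + conj z + q) + m² z conj z`, which is `(1 + m z) conj(1 + m
  -- z) + m q`: the second factorial moment `m²` is exactly what completes the square.
  simp_rw [h] at e1
  rw [integral_poisson_affine] at e1
  simp only [map_add, map_mul, map_one, Complex.conj_ofReal]
  linear_combination e1

end Spectrum

/-! ### Uniqueness of reduced measures -/

section Uniqueness

/-- The change of variables `(t, τ₁, τ₂) ↦ (t, t + τ₁, t + τ₂)`. -/
def shear (p : ℝ × ℝ × ℝ) : ℝ × ℝ × ℝ := (p.1, p.1 + p.2.1, p.1 + p.2.2)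

lemma measurable_shear : Measurable shear := by unfold shear; fun_prop

lemma measurable_measure_shear (G : Measure (ℝ × ℝ)) [SFinite G] {B C : Set ℝ}
    (hB : MeasurableSet B) (hC : MeasurableSet C) :
    Measurable fun t : ℝ => G {τ | t + τ.1 ∈ B ∧ t + τ.2 ∈ C} := by
  have hs : MeasurableSet {p : ℝ × ℝ × ℝ | p.1 + p.2.1 ∈ B ∧ p.1 + p.2.2 ∈ C} :=
    (measurableSet_preimage (by fun_prop) hB).inter (measurableSet_preimage (by fun_prop) hC)
  exact measurable_measure_prodMk_left hs

lemma measurableSet_shear (t : ℝ) {B C : Set ℝ} (hB : MeasurableSet B) (hC : MeasurableSet C) :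
    MeasurableSet {τ : ℝ × ℝ | t + τ.1 ∈ B ∧ t + τ.2 ∈ C} :=
  (measurableSet_preimage (by fun_prop : Measurable fun τ : ℝ × ℝ => t + τ.1) hB).inter
    (measurableSet_preimage (by fun_prop : Measurable fun τ : ℝ × ℝ => t + τ.2) hC)

lemma integrableOn_measure_shear (G : Measure (ℝ × ℝ)) [IsFiniteMeasure G] {A B C : Set ℝ}
    (bA : Bornology.IsBounded A) (hB : MeasurableSet B) (hC : MeasurableSet C) :
    IntegrableOn (fun t : ℝ => G.real {τ | t + τ.1 ∈ B ∧ t + τ.2 ∈ C}) A := by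
  have : IsFiniteMeasure (volume.restrict A) := ⟨by simpa using bA.measure_lt_top⟩
  refine (integrable_const (G.real univ)).mono'
    (measurable_measure_shear G hB hC).ennreal_toReal.aestronglyMeasurable
    (Eventually.of_forall fun t => ?_)
  rw [Real.norm_of_nonneg measureReal_nonneg]
  exact measureReal_mono (subset_univ _)

lemma setIntegral_measure_shear (G : Measure (ℝ × ℝ)) [IsFiniteMeasure G] {A B C : Set ℝ}
    (hB : MeasurableSet B) (hC : MeasurableSet C) :
    ∫ t in A, G.real {τ | t + τ.1 ∈ B ∧ t + τ.2 ∈ C} =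
      (∫⁻ t in A, G {τ | t + τ.1 ∈ B ∧ t + τ.2 ∈ C}).toReal :=
  integral_toReal (measurable_measure_shear G hB hC).aemeasurable
    (Eventually.of_forall fun _ => measure_lt_top _ _)

lemma map_shear_apply (G : Measure (ℝ × ℝ)) [SFinite G] (μ : Measure ℝ) [SFinite μ]
    {A B C : Set ℝ} (hA : MeasurableSet A) (hB : MeasurableSet B) (hC : MeasurableSet C) :
    ((μ.prod G).map shear) (A ×ˢ B ×ˢ C) =
      ∫⁻ t in A, G {τ | t + τ.1 ∈ B ∧ t + τ.2 ∈ C} ∂μ := by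
  have hs := measurable_shear (hA.prod (hB.prod hC))
  rw [Measure.map_apply measurable_shear (hA.prod (hB.prod hC)), Measure.prod_apply hs,
    ← lintegral_indicator hA]
  congr 1 with t
  by_cases ht : t ∈ A
  · rw [indicator_of_mem ht]
    congr 1 with τ
    simp [shear, ht]
  · rw [indicator_of_notMem ht]
    convert! measure_empty (μ := G)
    ext τ
    simp [shear, ht]

/-- A finite measure on the plane is determined by its averaged shifts. -/
lemma Measure.ext_of_shear {G G' : Measure (ℝ × ℝ)} [IsFiniteMeasure G] [IsFiniteMeasure G']
    (h : ∀ A B C : Set ℝ, MeasurableSet A → MeasurableSet B → MeasurableSet C →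
      Bornology.IsBounded A → Bornology.IsBounded B → Bornology.IsBounded C →
      ∫⁻ t in A, G {τ | t + τ.1 ∈ B ∧ t + τ.2 ∈ C} =
        ∫⁻ t in A, G' {τ | t + τ.1 ∈ B ∧ t + τ.2 ∈ C}) : G = G' := by
  -- Restricting the base point to an interval of length one makes `μ.prod G` a finite measure whose
  -- second marginal is `G` itself, recovered after undoing the shear.
  set μ : Measure ℝ := volume.restrict (Icc 0 1) with hμ
  have hμ1 : μ univ = 1 := by simp [hμ]
  have : IsProbabilityMeasure μ := ⟨hμ1⟩
  have hQ : (μ.prod G).map shear = (μ.prod G').map shear := by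
    refine Measure.ext_prod₃ fun {A B C} hA hB hC => ?_
    have hmono : ∀ (B : Set ℝ), Monotone fun n : ℕ => B ∩ Icc (-(n : ℝ)) n := fun B i j hij => by
      have : (i : ℝ) ≤ j := by exact_mod_cast hij
      exact inter_subset_inter_right _ (Icc_subset_Icc (by linarith) this)
    have hU : ⋃ n : ℕ, A ×ˢ (B ∩ Icc (-(n : ℝ)) n) ×ˢ (C ∩ Icc (-(n : ℝ)) n) = A ×ˢ B ×ˢ C := by
      refine subset_antisymm (iUnion_subset fun n => prod_mono_right
        (prod_mono inter_subset_left inter_subset_left)) ?_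
      rintro ⟨a, b, c⟩ ⟨ha, hb, hc⟩
      obtain ⟨n, hn⟩ := exists_nat_ge (max |b| |c|)
      exact mem_iUnion.2 ⟨n, ha, ⟨hb, abs_le.1 ((le_max_left _ _).trans hn)⟩,
        hc, abs_le.1 ((le_max_right _ _).trans hn)⟩
    have hM : Monotone fun n : ℕ =>
        A ×ˢ (B ∩ Icc (-(n : ℝ)) n) ×ˢ (C ∩ Icc (-(n : ℝ)) n) := fun i j hij =>
      prod_mono_right (prod_mono (hmono B hij) (hmono C hij))
    rw [← hU]
    refine tendsto_nhds_unique (tendsto_measure_iUnion_atTop hM) ?_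
    have heq : ∀ n : ℕ, ((μ.prod G).map shear)
        (A ×ˢ (B ∩ Icc (-(n : ℝ)) n) ×ˢ (C ∩ Icc (-(n : ℝ)) n)) = ((μ.prod G').map shear)
        (A ×ˢ (B ∩ Icc (-(n : ℝ)) n) ×ˢ (C ∩ Icc (-(n : ℝ)) n)) := fun n => by
      have hB' := hB.inter (measurableSet_Icc (a := -(n : ℝ)) (b := n))
      have hC' := hC.inter (measurableSet_Icc (a := -(n : ℝ)) (b := n))
      rw [map_shear_apply G μ hA hB' hC', map_shear_apply G' μ hA hB' hC', hμ,
        Measure.restrict_restrict hA]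
      have bI : Bornology.IsBounded (Icc (-(n : ℝ)) n) := Metric.isBounded_Icc _ _
      exact h _ _ _ (hA.inter measurableSet_Icc) hB' hC'
        ((Metric.isBounded_Icc 0 1).subset inter_subset_right) (bI.subset inter_subset_right)
        (bI.subset inter_subset_right)
    simp only [Function.comp_def, heq]
    exact tendsto_measure_iUnion_atTop hM
  have hun : Measurable fun q : ℝ × ℝ × ℝ => ((q.2.1 - q.1, q.2.2 - q.1) : ℝ × ℝ) := by fun_prop
  have hsnd : ∀ H : Measure (ℝ × ℝ), IsFiniteMeasure H →
      (((μ.prod H).map shear).map fun q : ℝ × ℝ × ℝ => ((q.2.1 - q.1, q.2.2 - q.1) : ℝ × ℝ)) = H :=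
    fun H _ => by
      rw [Measure.map_map hun measurable_shear]
      have : ((fun q : ℝ × ℝ × ℝ => ((q.2.1 - q.1, q.2.2 - q.1) : ℝ × ℝ)) ∘ shear) = Prod.snd := by
        ext p <;> simp [shear]
      rw [this, Measure.map_snd_prod, hμ1, one_smul]
  rw [← hsnd G inferInstance, hQ, hsnd G' inferInstance]

/-- A finite signed measure on the plane is determined by its averaged shifts. -/
lemma SignedMeasure.ext_of_shear {γ γ' : SignedMeasure (ℝ × ℝ)}
    (h : ∀ A B C : Set ℝ, MeasurableSet A → MeasurableSet B → MeasurableSet C →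
      Bornology.IsBounded A → Bornology.IsBounded B → Bornology.IsBounded C →
      ∫ t in A, γ {τ | t + τ.1 ∈ B ∧ t + τ.2 ∈ C} =
        ∫ t in A, γ' {τ | t + τ.1 ∈ B ∧ t + τ.2 ∈ C}) : γ = γ' := by
  have hj : ∀ γ : SignedMeasure (ℝ × ℝ),
      γ = γ.toJordanDecomposition.posPart.toSignedMeasure -
        γ.toJordanDecomposition.negPart.toSignedMeasure := fun γ =>
    (SignedMeasure.toSignedMeasure_toJordanDecomposition γ).symm
  set p := γ.toJordanDecomposition.posPart
  set n := γ.toJordanDecomposition.negPart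
  set p' := γ'.toJordanDecomposition.posPart
  set n' := γ'.toJordanDecomposition.negPart
  -- Moving the negative parts across turns the equality of signed measures into one of finite
  -- positive measures.
  have key : p + n' = p' + n := by
    refine Measure.ext_of_shear fun A B C hA hB hC bA bB bC => ?_
    have hfin : ∀ H : Measure (ℝ × ℝ), IsFiniteMeasure H →
        ∫⁻ t in A, H {τ | t + τ.1 ∈ B ∧ t + τ.2 ∈ C} ≠ ∞ := fun H _ => by
      refine ((lintegral_mono fun t => measure_mono (subset_univ _)).trans_lt ?_).ne
      · simpa using ENNReal.mul_lt_top (measure_lt_top H univ) bA.measure_lt_top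
    rw [← ENNReal.toReal_eq_toReal_iff' (hfin _ inferInstance) (hfin _ inferInstance),
      ← setIntegral_measure_shear _ hB hC, ← setIntegral_measure_shear _ hB hC]
    have hsplit : ∀ γ : SignedMeasure (ℝ × ℝ), ∫ t in A, γ {τ | t + τ.1 ∈ B ∧ t + τ.2 ∈ C} =
        (∫ t in A, γ.toJordanDecomposition.posPart.real {τ | t + τ.1 ∈ B ∧ t + τ.2 ∈ C}) -
        ∫ t in A, γ.toJordanDecomposition.negPart.real {τ | t + τ.1 ∈ B ∧ t + τ.2 ∈ C} :=
      fun γ => by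
        rw [← integral_sub (integrableOn_measure_shear _ bA hB hC)
          (integrableOn_measure_shear _ bA hB hC)]
        congr 1 with t
        conv_lhs => rw [hj γ]
        exact Measure.toSignedMeasure_sub_apply (measurableSet_shear t hB hC)
    have hadd : ∀ H K : Measure (ℝ × ℝ), IsFiniteMeasure H → IsFiniteMeasure K →
        ∫ t in A, (H + K).real {τ | t + τ.1 ∈ B ∧ t + τ.2 ∈ C} =
        (∫ t in A, H.real {τ | t + τ.1 ∈ B ∧ t + τ.2 ∈ C}) +
        ∫ t in A, K.real {τ | t + τ.1 ∈ B ∧ t + τ.2 ∈ C} := fun H K _ _ => by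
      rw [← integral_add (integrableOn_measure_shear _ bA hB hC)
        (integrableOn_measure_shear _ bA hB hC)]
      congr 1 with t
      exact measureReal_add_apply
    have h1 := h A B C hA hB hC bA bB bC
    rw [hsplit γ, hsplit γ'] at h1
    rw [hadd p n' inferInstance inferInstance, hadd p' n inferInstance inferInstance]
    linarith
  have h2 := Measure.toSignedMeasure_congr key
  rw [Measure.toSignedMeasure_add, Measure.toSignedMeasure_add] at h2
  rw [hj γ, hj γ', sub_eq_sub_iff_add_eq_add]
  exact h2

lemma IsReduced3.unique {M : Set ℝ → Set ℝ → Set ℝ → ℝ} {γ γ' : SignedMeasure (ℝ × ℝ)}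
    (h : IsReduced3 M γ) (h' : IsReduced3 M γ') : γ = γ' :=
  SignedMeasure.ext_of_shear fun A B C hA hB hC bA bB bC =>
    (h A B C hA hB hC bA bB bC).symm.trans (h' A B C hA hB hC bA bB bC)

/-- Pushing `γ` to the diagonal of the plane turns it into a reduced measure of `M A (B ∩ C)`, which
brings the claim back to `IsReduced3.unique`. -/
lemma IsReduced2.unique {M : Set ℝ → Set ℝ → ℝ} {γ γ' : SignedMeasure ℝ}
    (h : IsReduced2 M γ) (h' : IsReduced2 M γ') : γ = γ' := by
  have hd : Measurable fun τ : ℝ => (τ, τ) := by fun_prop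
  have hmap : ∀ {γ : SignedMeasure ℝ}, IsReduced2 M γ →
      IsReduced3 (fun A B C => M A (B ∩ C)) (γ.map fun τ => (τ, τ)) :=
    fun {γ} h A B C hA hB hC bA bB bC => by
      beta_reduce
      rw [h A (B ∩ C) hA (hB.inter hC) bA (bB.subset inter_subset_left)]
      congr 1 with t
      rw [VectorMeasure.map_apply γ hd (measurableSet_shear t hB hC)]
      rfl
  have h1 := (hmap h).unique (hmap h')
  ext B hB
  have h2 := congrArg (fun γ : SignedMeasure (ℝ × ℝ) => γ (Prod.fst ⁻¹' B)) h1
  rw [VectorMeasure.map_apply γ hd (measurable_fst hB),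
    VectorMeasure.map_apply γ' hd (measurable_fst hB)] at h2
  exact h2

end Uniqueness

/-! ### Superpositions of image laws -/

section SumLaw

variable {ι X Y : Type*} [Countable ι] [MeasurableSpace X] [MeasurableSpace Y] {μ : Measure X}
  {S : ι → Set X} {T : ι → X → Y}

/-- The superposition of the laws of `T i` on the events `S i`. -/
noncomputable def sumLaw (μ : Measure X) (S : ι → Set X) (T : ι → X → Y) : Measure Y :=
  Measure.sum fun i => (μ.restrict (S i)).map (T i)

lemma lintegral_sumLaw (hS : ∀ i, MeasurableSet (S i)) (hT : ∀ i, Measurable (T i))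
    {g : Y → ℝ≥0∞} (hg : Measurable g) :
    ∫⁻ y, g y ∂sumLaw μ S T = ∫⁻ x, ∑' i, (S i).indicator (fun x => g (T i x)) x ∂μ := by
  have hm : ∀ i, Measurable ((S i).indicator fun x => g (T i x)) := fun i =>
    (hg.comp (hT i)).indicator (hS i)
  rw [sumLaw, lintegral_sum_measure, lintegral_tsum fun i => (hm i).aemeasurable]
  congr 1 with i
  rw [lintegral_map hg (hT i), lintegral_indicator (hS i)]

lemma sumLaw_univ (hS : ∀ i, MeasurableSet (S i)) (hT : ∀ i, Measurable (T i)) :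
    sumLaw μ S T univ = ∫⁻ x, ∑' i, (S i).indicator 1 x ∂μ := by
  have := lintegral_sumLaw (μ := μ) hS hT (g := fun _ => 1) measurable_const
  rw [lintegral_one] at this
  exact this

lemma integral_sumLaw [IsFiniteMeasure (sumLaw μ S T)] (hS : ∀ i, MeasurableSet (S i))
    (hT : ∀ i, Measurable (T i)) {g : Y → ℂ} (hg : Measurable g) (hb : ∀ y, ‖g y‖ ≤ 1) :
    ∫ y, g y ∂sumLaw μ S T = ∫ x, ∑' i, (S i).indicator (fun x => g (T i x)) x ∂μ := by
  have hI : Integrable g (sumLaw μ S T) :=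
    (integrable_const (1 : ℝ)).mono' hg.aestronglyMeasurable (Eventually.of_forall hb)
  have hm : ∀ i, Measurable ((S i).indicator fun x => g (T i x)) := fun i =>
    (hg.comp (hT i)).indicator (hS i)
  rw [integral_tsum fun i => (hm i).aestronglyMeasurable]
  · unfold sumLaw at hI ⊢
    rw [integral_sum_measure hI]
    congr 1 with i
    rw [integral_map (hT i).aemeasurable hg.aestronglyMeasurable, integral_indicator (hS i)]
  · rw [← lintegral_tsum fun i => (hm i).enorm.aemeasurable]
    refine ((lintegral_mono (g := fun x => ∑' i, (S i).indicator 1 x) fun x => ?_).trans_lt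
      (lt_of_eq_of_lt (sumLaw_univ hS hT).symm (measure_lt_top (sumLaw μ S T) univ))).ne
    refine ENNReal.tsum_le_tsum fun i => ?_
    by_cases hx : x ∈ S i
    · simp only [indicator_of_mem hx, Pi.one_apply]
      rw [← ofReal_norm, ← ENNReal.ofReal_one]
      exact ENNReal.ofReal_le_ofReal (hb _)
    · simp [indicator_of_notMem hx]

/-- For each `i` the shift by `p i x` is absorbed by translation invariance in `u`, and Tonelli does
the rest. With `p` the position of the first vertex, this separates the location of a pair or triple
from its displacements. -/
lemma lintegral_lintegral_sumLaw [SFinite μ] (hS : ∀ i, MeasurableSet (S i))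
    (hT : ∀ i, Measurable (T i)) (p : ι → X → ℝ) {G : ℝ × Y → ℝ≥0∞} (hG : Measurable G) :
    ∫⁻ x, ∑' i, (S i).indicator (fun x => ∫⁻ u, G (p i x + u, T i x)) x ∂μ =
      ∫⁻ t, ∫⁻ y, G (t, y) ∂sumLaw μ S T := by
  have hm : ∀ i, Measurable fun q : ℝ × X => (S i).indicator (fun x => G (q.1, T i x)) q.2 :=
    fun i => Measurable.indicator (s := Prod.snd ⁻¹' S i) (f := fun q : ℝ × X => G (q.1, T i q.2))
      (hG.comp (measurable_fst.prodMk ((hT i).comp measurable_snd))) (measurable_snd (hS i))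
  have h1 : ∀ t, ∫⁻ y, G (t, y) ∂sumLaw μ S T =
      ∫⁻ x, ∑' i, (S i).indicator (fun x => G (t, T i x)) x ∂μ := fun t =>
    lintegral_sumLaw hS hT (hG.comp measurable_prodMk_left)
  simp_rw [h1]
  rw [lintegral_lintegral_swap (Measurable.tsum hm).aemeasurable]
  congr 1 with x
  have hm' : ∀ i, Measurable fun t => (S i).indicator (fun x => G (t, T i x)) x := fun i =>
    (hm i).comp measurable_prodMk_right
  rw [lintegral_tsum fun i => (hm' i).aemeasurable]
  congr 1 with i
  by_cases hx : x ∈ S i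
  · simp only [indicator_of_mem hx]
    exact lintegral_add_left_eq_self (fun u => G (u, T i x)) (p i x)
  · simp [indicator_of_notMem hx]

omit [Countable ι] in
lemma sumLaw_map {Z : Type*} [MeasurableSpace Z] {φ : Y → Z} (hφ : Measurable φ)
    (hT : ∀ i, Measurable (T i)) :
    (sumLaw μ S T).map φ = sumLaw μ S fun i x => φ (T i x) := by
  unfold sumLaw
  rw [Measure.map_sum hφ.aemeasurable]
  congr 1 with i : 1
  rw [Measure.map_map hφ (hT i)]
  rfl

omit [Countable ι] in
lemma sumLaw_comp {R : X → X} (hR : MeasurePreserving R μ μ) (hS : ∀ i, MeasurableSet (S i))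
    (hT : ∀ i, Measurable (T i)) (hRS : ∀ i, R ⁻¹' S i = S i) :
    sumLaw μ S (fun i x => T i (R x)) = sumLaw μ S T := by
  unfold sumLaw
  congr 1 with i : 1
  have h := (hR.restrict_preimage (hS i))
  rw [hRS] at h
  rw [← h.map_eq, Measure.map_map (hT i) hR.measurable, h.map_eq]
  rfl

end SumLaw

/-! ### Displacement laws of pairs and triples of vertices -/

namespace TreeData

/-- Law of the displacements of pairs of vertices of a tree. -/
noncomputable def pairLaw (μ : Measure TreeData) : Measure ℝ :=
  sumLaw μ (fun q : List ℕ × List ℕ => {x | x.Mem q.1 ∧ x.Mem q.2})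
    fun q x => x.pos q.2 - x.pos q.1

/-- Law of the displacements of triples of vertices of a tree. -/
noncomputable def tripleLaw (μ : Measure TreeData) : Measure (ℝ × ℝ) :=
  sumLaw μ (fun q : List ℕ × List ℕ × List ℕ => {x | x.Mem q.1 ∧ x.Mem q.2.1 ∧ x.Mem q.2.2})
    fun q x => (x.pos q.2.1 - x.pos q.1, x.pos q.2.2 - x.pos q.1)

lemma measurableSet_mem₂ (q : List ℕ × List ℕ) :
    MeasurableSet {x : TreeData | x.Mem q.1 ∧ x.Mem q.2} :=
  (measurableSet_mem _).inter (measurableSet_mem _)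

lemma measurableSet_mem₃ (q : List ℕ × List ℕ × List ℕ) :
    MeasurableSet {x : TreeData | x.Mem q.1 ∧ x.Mem q.2.1 ∧ x.Mem q.2.2} :=
  (measurableSet_mem _).inter ((measurableSet_mem _).inter (measurableSet_mem _))

lemma measurable_pos_sub (v w : List ℕ) : Measurable fun x : TreeData => x.pos v - x.pos w :=
  (measurable_pos v).sub (measurable_pos w)

lemma measurable_pos_sub₃ (q : List ℕ × List ℕ × List ℕ) :
    Measurable fun x : TreeData => (x.pos q.2.1 - x.pos q.1, x.pos q.2.2 - x.pos q.1) :=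
  (measurable_pos_sub _ _).prodMk (measurable_pos_sub _ _)

end TreeData

lemma ENNReal.tsum_mul_tsum {α β : Type*} (f : α → ℝ≥0∞) (g : β → ℝ≥0∞) :
    (∑' a, f a) * ∑' b, g b = ∑' q : α × β, f q.1 * g q.2 := by
  rw [ENNReal.tsum_prod (f := fun a b => f a * g b), ← ENNReal.tsum_mul_right]
  simp_rw [ENNReal.tsum_mul_left]

/-! ### Products of cluster sums and displacement laws -/

section TreeLaw

variable {μ : Measure TreeData}

open Classical in
lemma vsum_mul_vsum (a b : ℝ → ℝ≥0∞) (x : TreeData) :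
    vsum a x * vsum b x = ∑' q : List ℕ × List ℕ,
      {x : TreeData | x.Mem q.1 ∧ x.Mem q.2}.indicator
        (fun x => a (x.pos q.1) * b (x.pos q.2)) x := by
  rw [vsum, vsum, ENNReal.tsum_mul_tsum]
  congr 1 with q
  simp only [indicator, mem_ofPred_eq]
  by_cases h1 : x.Mem q.1 <;> by_cases h2 : x.Mem q.2 <;> simp [h1, h2]

open Classical in
lemma vsum_mul_vsum_mul_vsum (a b c : ℝ → ℝ≥0∞) (x : TreeData) :
    vsum a x * (vsum b x * vsum c x) = ∑' q : List ℕ × List ℕ × List ℕ,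
      {x : TreeData | x.Mem q.1 ∧ x.Mem q.2.1 ∧ x.Mem q.2.2}.indicator
        (fun x => a (x.pos q.1) * (b (x.pos q.2.1) * c (x.pos q.2.2))) x := by
  rw [vsum, vsum, vsum, ENNReal.tsum_mul_tsum, ENNReal.tsum_mul_tsum]
  congr 1 with q
  simp only [indicator, mem_ofPred_eq]
  by_cases h1 : x.Mem q.1 <;> by_cases h2 : x.Mem q.2.1 <;> by_cases h3 : x.Mem q.2.2 <;>
    simp [h1, h2, h3]

lemma pairLaw_univ : pairLaw μ univ = ∫⁻ x, x.total ^ 2 ∂μ := by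
  rw [pairLaw, sumLaw_univ measurableSet_mem₂ fun q => measurable_pos_sub _ _]
  congr 1 with x
  rw [pow_two, total, vsum_mul_vsum]
  simp [Pi.one_def]

lemma tripleLaw_univ : tripleLaw μ univ = ∫⁻ x, x.total ^ 3 ∂μ := by
  rw [tripleLaw, sumLaw_univ measurableSet_mem₃ measurable_pos_sub₃]
  congr 1 with x
  rw [pow_succ', pow_two, total, vsum_mul_vsum_mul_vsum]
  simp [Pi.one_def]

/-- The product is a sum over ordered pairs of vertices. Integrating over the root position makes
the location `t` of the first vertex Lebesgue distributed and leaves only the displacement to the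
second. -/
lemma lintegral_clusterSum_mul [SFinite μ] {ν : ℝ} {a b : ℝ → ℝ≥0∞} (ha : Measurable a)
    (hb : Measurable b) :
    ∫⁻ p, clusterSum a p * clusterSum b p ∂clusterIntensity ν μ =
      ENNReal.ofReal ν * ∫⁻ t, ∫⁻ τ, a t * b (t + τ) ∂pairLaw μ := by
  have hF : Measurable fun p => clusterSum a p * clusterSum b p :=
    (measurable_clusterSum ha).mul (measurable_clusterSum hb)
  rw [lintegral_clusterIntensity hF, pairLaw, ← lintegral_lintegral_sumLaw measurableSet_mem₂ (fun q => measurable_pos_sub _ _)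
    (fun q x => x.pos q.1) (G := fun q => a q.1 * b (q.1 + q.2)) (by fun_prop)]
  congr 2 with x
  simp only [clusterSum, vsum_mul_vsum]
  rw [lintegral_tsum]
  · congr 1 with q
    by_cases hx : x.Mem q.1 ∧ x.Mem q.2
    · simp only [indicator, mem_ofPred_eq, hx, and_self, if_true]
      congr 1 with u
      congr 2
      ring
    · simp only [indicator, mem_ofPred_eq, hx, if_false, lintegral_zero]
  · intro q
    by_cases hx : x.Mem q.1 ∧ x.Mem q.2
    · simp only [indicator, mem_ofPred_eq, hx, and_self, if_true]
      fun_prop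
    · simp only [indicator, mem_ofPred_eq, hx, if_false]
      fun_prop

lemma lintegral_clusterSum_mul_mul [SFinite μ] {ν : ℝ} {a b c : ℝ → ℝ≥0∞} (ha : Measurable a)
    (hb : Measurable b) (hc : Measurable c) :
    ∫⁻ p, clusterSum a p * (clusterSum b p * clusterSum c p) ∂clusterIntensity ν μ =
      ENNReal.ofReal ν * ∫⁻ t, ∫⁻ τ, a t * (b (t + τ.1) * c (t + τ.2)) ∂tripleLaw μ := by
  have hF : Measurable fun p => clusterSum a p * (clusterSum b p * clusterSum c p) :=
    (measurable_clusterSum ha).mul ((measurable_clusterSum hb).mul (measurable_clusterSum hc))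
  rw [lintegral_clusterIntensity hF, tripleLaw, ← lintegral_lintegral_sumLaw measurableSet_mem₃ measurable_pos_sub₃
    (fun q x => x.pos q.1)
    (G := fun q => a q.1 * (b (q.1 + q.2.1) * c (q.1 + q.2.2))) (by fun_prop)]
  congr 2 with x
  simp only [clusterSum, vsum_mul_vsum_mul_vsum]
  rw [lintegral_tsum]
  · congr 1 with q
    by_cases hx : x.Mem q.1 ∧ x.Mem q.2.1 ∧ x.Mem q.2.2
    · simp only [indicator, mem_ofPred_eq, hx, and_self, if_true]
      congr 1 with u
      congr 3 <;> ring_nf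
    · simp only [indicator, mem_ofPred_eq, hx, if_false, lintegral_zero]
  · intro q
    by_cases hx : x.Mem q.1 ∧ x.Mem q.2.1 ∧ x.Mem q.2.2
    · simp only [indicator, mem_ofPred_eq, hx, and_self, if_true]
      fun_prop
    · simp only [indicator, mem_ofPred_eq, hx, if_false]
      fun_prop

lemma lintegral_pairLaw_indicator {G : Measure ℝ} {A B : Set ℝ} (hA : MeasurableSet A)
    (hB : MeasurableSet B) :
    ∫⁻ t, ∫⁻ τ, A.indicator 1 t * B.indicator 1 (t + τ) ∂G = ∫⁻ t in A, G {τ | t + τ ∈ B} := by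
  rw [← lintegral_indicator hA]
  congr 1 with t
  have hs : MeasurableSet {τ : ℝ | t + τ ∈ B} := measurableSet_preimage (by fun_prop) hB
  by_cases ht : t ∈ A
  · simp only [indicator_of_mem ht, Pi.one_apply, one_mul]
    exact lintegral_indicator_one hs
  · simp [indicator_of_notMem ht]

lemma lintegral_tripleLaw_indicator {G : Measure (ℝ × ℝ)} {A B C : Set ℝ} (hA : MeasurableSet A)
    (hB : MeasurableSet B) (hC : MeasurableSet C) :
    ∫⁻ t, ∫⁻ τ, A.indicator 1 t * (B.indicator 1 (t + τ.1) * C.indicator 1 (t + τ.2)) ∂G =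
      ∫⁻ t in A, G {τ | t + τ.1 ∈ B ∧ t + τ.2 ∈ C} := by
  rw [← lintegral_indicator hA]
  congr 1 with t
  by_cases ht : t ∈ A
  · simp only [indicator_of_mem ht, Pi.one_apply, one_mul]
    rw [← lintegral_indicator_one (measurableSet_shear t hB hC)]
    congr 1 with τ
    by_cases h1 : t + τ.1 ∈ B <;> by_cases h2 : t + τ.2 ∈ C <;> simp [indicator, h1, h2]
  · simp [indicator_of_notMem ht]

/-- The Fourier transform of the displacements of pairs. -/
lemma integral_phase_pairLaw {m : ℝ≥0} {κ : Measure ℝ} [IsProbabilityMeasure κ] (hm₀ : 0 < m)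
    (hm : m < 1) [IsFiniteMeasure (pairLaw (treeLaw m κ))] (ω : ℝ) :
    ∫ τ, phase ω τ ∂pairLaw (treeLaw m κ) =
      ∫ x, spectral ω x * (starRingEnd ℂ) (spectral ω x) ∂treeLaw m κ := by
  classical
  have : IsFiniteMeasure (sumLaw (treeLaw m κ)
      (fun q : List ℕ × List ℕ => {x | x.Mem q.1 ∧ x.Mem q.2})
      fun q x => x.pos q.2 - x.pos q.1) := ‹IsFiniteMeasure (pairLaw (treeLaw m κ))›
  rw [pairLaw, integral_sumLaw measurableSet_mem₂ (fun q => measurable_pos_sub _ _)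
    (continuous_phase ω).measurable fun y => (norm_phase ω y).le]
  refine integral_congr_ae ?_
  filter_upwards [ae_total_ne_top (κ := κ) hm₀ hm] with x hx
  have hs := (summable_ite_mem_iff x fun v => norm_phase ω (x.pos v)).2 hx
  have hs' := (summable_ite_mem_iff x fun v => norm_phase ω (-x.pos v)).2 hx
  -- The conjugate belongs to the first vertex of the pair, so the product of the two series is the
  -- sum of phases of `x.pos q.2 - x.pos q.1`.
  have hconj : (starRingEnd ℂ) (spectral ω x) =
      ∑' v, if x.Mem v then phase ω (-x.pos v) else 0 := by
    rw [spectral, Complex.conj_tsum]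
    congr 1 with v
    split_ifs
    · rw [star_phase]
    · simp
  rw [hconj, mul_comm, spectral, tsum_mul_tsum_of_summable_norm hs'.norm hs.norm]
  congr 1 with q
  simp only [indicator, mem_ofPred_eq]
  by_cases h1 : x.Mem q.1 <;> by_cases h2 : x.Mem q.2 <;> simp [h1, h2, ← phase_add]
  rw [sub_eq_neg_add]

/-- Reflecting the tree preserves its law and membership of vertices, and negates every
displacement. This symmetry is the source of the real third-order transforms. -/
lemma tripleLaw_map_neg {m : ℝ≥0} {κ : Measure ℝ} [IsProbabilityMeasure κ]
    (hκ : κ.map (fun x => -x) = κ) :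
    (tripleLaw (treeLaw m κ)).map (fun τ => -τ) = tripleLaw (treeLaw m κ) := by
  have hR : MeasurePreserving reflect (treeLaw m κ) (treeLaw m κ) :=
    ⟨measurable_reflect, treeLaw_map_reflect hκ⟩
  rw [tripleLaw, sumLaw_map measurable_neg measurable_pos_sub₃]
  rw [← sumLaw_comp hR measurableSet_mem₃ (T := fun q x =>
    (x.pos q.2.1 - x.pos q.1, x.pos q.2.2 - x.pos q.1)) measurable_pos_sub₃ (fun _ => rfl)]
  congr 1
  ext q x <;> simp only [pos_reflect, Prod.fst_neg, Prod.snd_neg] <;> ring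

end TreeLaw

/-! ### Closed form of the spectrum and finiteness of the reduced measures -/

section Spectrum

variable {ν m : ℝ} {f : ℝ → ℝ}

lemma IsProbDensity.norm_fourierR_le (hf : IsProbDensity f) (ω : ℝ) : ‖fourierR f ω‖ ≤ 1 := by
  have := hf.isProbabilityMeasure
  rw [fourierR_eq_integral_densityMeasure hf]
  refine (norm_integral_le_of_norm_le_const (C := 1)
    (Eventually.of_forall fun y => (norm_phase ω y).le)).trans ?_
  simp

lemma one_sub_le_norm {z : ℂ} (hm₀ : 0 < m) (hz : ‖z‖ ≤ 1) : 1 - m ≤ ‖1 - m * z‖ := by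
  have h1 := norm_sub_norm_le (1 : ℂ) (m * z)
  rw [norm_one, norm_mul, Complex.norm_real, Real.norm_of_nonneg hm₀.le] at h1
  nlinarith

lemma fourierR_zero (hf : IsProbDensity f) : fourierR f 0 = 1 := by
  have := hf.isProbabilityMeasure
  rw [fourierR_eq_integral_densityMeasure hf]
  simp [phase_zero_left]

lemma integral_spectral_offspringLaw (hf : IsProbDensity f) (hm₀ : 0 < m) (hm₁ : m < 1) (ω : ℝ) :
    (∫ x, spectral ω x ∂offspringLaw m f) * (1 - m * fourierR f ω) = 1 := by
  have := hf.isProbabilityMeasure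
  have h := integral_spectral (κ := densityMeasure f) (m := m.toNNReal) (by simpa using hm₀)
    (by rw [← NNReal.coe_lt_coe, Real.coe_toNNReal _ hm₀.le]; simpa using hm₁) ω
  rw [← fourierR_eq_integral_densityMeasure hf, Real.coe_toNNReal _ hm₀.le] at h
  linear_combination h

/-- The second-moment recursion reads `(1 - m) E|S|² = |E S|²`, and `E S` is the inverse of `1 - m
f̂`. -/
lemma integral_spectral_mul_conj_offspringLaw (hf : IsProbDensity f) (hm₀ : 0 < m) (hm₁ : m < 1)
    (ω : ℝ) :
    (∫ x, spectral ω x * (starRingEnd ℂ) (spectral ω x) ∂offspringLaw m f) =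
      ((1 / (1 - m) / ‖1 - m * fourierR f ω‖ ^ 2 : ℝ) : ℂ) := by
  have := hf.isProbabilityMeasure
  have h := integral_spectral_mul_conj (κ := densityMeasure f) (m := m.toNNReal)
    (by simpa using hm₀)
    (by rw [← NNReal.coe_lt_coe, Real.coe_toNNReal _ hm₀.le]; simpa using hm₁) ω
  have h1 := integral_spectral_offspringLaw hf hm₀ hm₁ ω
  rw [Real.coe_toNNReal _ hm₀.le] at h
  set z : ℂ := 1 - m * fourierR f ω with hz
  set a := ∫ x, spectral ω x ∂offspringLaw m f
  set q := ∫ x, spectral ω x * (starRingEnd ℂ) (spectral ω x) ∂offspringLaw m f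
  have h2 : (starRingEnd ℂ) a * (starRingEnd ℂ) z = 1 := by rw [← map_mul, h1, map_one]
  have hz0 : z ≠ 0 := right_ne_zero_of_mul_eq_one h1
  have hzn : z * (starRingEnd ℂ) z = ((‖z‖ ^ 2 : ℝ) : ℂ) := by
    rw [Complex.mul_conj, Complex.normSq_eq_norm_sq]
  have hzn0 : ((‖z‖ ^ 2 : ℝ) : ℂ) ≠ 0 := by
    simpa using hz0
  have hm1 : ((1 : ℂ) - m) ≠ 0 := by
    rw [← Complex.ofReal_one, ← Complex.ofReal_sub]
    exact Complex.ofReal_ne_zero.2 (by linarith)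
  push_cast at hzn hzn0 ⊢
  rw [eq_div_iff hzn0, eq_div_iff hm1, ← hzn]
  linear_combination (z * (starRingEnd ℂ) z) * h + (starRingEnd ℂ) a * (starRingEnd ℂ) z * h1 + h2

/-- The mean number of vertices of the family tree. -/
lemma lintegral_total (hf : IsProbDensity f) (hm₀ : 0 < m) (hm₁ : m < 1) :
    ∫⁻ x, x.total ∂offspringLaw m f = ENNReal.ofReal (1 / (1 - m)) := by
  have := hf.isProbabilityMeasure
  -- At frequency zero the cluster transform counts the vertices, and `f̂(0) = 1`.
  have h := integral_spectral_offspringLaw hf hm₀ hm₁ 0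
  simp_rw [spectral_zero] at h
  rw [fourierR_zero hf, mul_one, integral_complex_ofReal] at h
  have h1 : (∫ x, x.total.toReal ∂offspringLaw m f) * (1 - m) = 1 := by exact_mod_cast h
  have hm : 0 < m.toNNReal := by simpa using hm₀
  have hm' : m.toNNReal < 1 := by
    rw [← NNReal.coe_lt_coe, Real.coe_toNNReal _ hm₀.le]; simpa using hm₁
  have hI := integrable_total_pow (κ := densityMeasure f) hm hm' (k := 1) (by simp)
  simp only [pow_one] at hI
  rw [← eq_div_iff (by linarith)] at h1
  rw [← h1, ofReal_integral_eq_lintegral_ofReal hI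
    (Eventually.of_forall fun _ => ENNReal.toReal_nonneg)]
  refine lintegral_congr_ae ?_
  filter_upwards [ae_total_ne_top (κ := densityMeasure f) hm hm'] with x hx
  rw [ENNReal.ofReal_toReal hx]

/-- The reduced covariance measure of the cluster process. -/
noncomputable def pairMeasure (ν m : ℝ) (f : ℝ → ℝ) : Measure ℝ :=
  ENNReal.ofReal ν • pairLaw (offspringLaw m f)

/-- The reduced complete third cumulant measure of the cluster process. -/
noncomputable def tripleMeasure (ν m : ℝ) (f : ℝ → ℝ) : Measure (ℝ × ℝ) :=
  ENNReal.ofReal ν • tripleLaw (offspringLaw m f)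

lemma IsProbDensity.isFiniteMeasure_tripleMeasure (hf : IsProbDensity f) (hm₀ : 0 < m)
    (hm₁ : m < 1) : IsFiniteMeasure (tripleMeasure ν m f) := by
  refine ⟨?_⟩
  rw [tripleMeasure, Measure.smul_apply, smul_eq_mul, tripleLaw_univ]
  exact ENNReal.mul_lt_top (by simp) (hf.offspringLaw_total hm₀ hm₁)

lemma IsProbDensity.isFiniteMeasure_pairLaw (hf : IsProbDensity f) (hm₀ : 0 < m)
    (hm₁ : m < 1) : IsFiniteMeasure (pairLaw (offspringLaw m f)) := by
  refine ⟨?_⟩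
  rw [pairLaw_univ]
  refine (lintegral_mono fun x => ?_).trans_lt (hf.offspringLaw_total hm₀ hm₁)
  exact pow_le_pow_right₀ (one_le_total x) (by simp)

lemma IsProbDensity.isFiniteMeasure_pairMeasure (hf : IsProbDensity f) (hm₀ : 0 < m)
    (hm₁ : m < 1) : IsFiniteMeasure (pairMeasure ν m f) := by
  have := hf.isFiniteMeasure_pairLaw hm₀ hm₁
  refine ⟨?_⟩
  rw [pairMeasure, Measure.smul_apply, smul_eq_mul]
  exact ENNReal.mul_lt_top (by simp) (measure_lt_top _ _)

lemma integral_phase_pairMeasure (hf : IsProbDensity f) (hν : 0 < ν) (hm₀ : 0 < m) (hm₁ : m < 1)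
    (ω : ℝ) :
    ∫ τ, phase ω τ ∂pairMeasure ν m f =
      ((ν / (1 - m) / ‖1 - m * fourierR f ω‖ ^ 2 : ℝ) : ℂ) := by
  have := hf.isProbabilityMeasure
  have := hf.isFiniteMeasure_pairLaw hm₀ hm₁
  rw [pairMeasure, integral_smul_measure, integral_phase_pairLaw (by simpa using hm₀)
    (by rw [← NNReal.coe_lt_coe, Real.coe_toNNReal _ hm₀.le]; simpa using hm₁) ω,
    integral_spectral_mul_conj_offspringLaw hf hm₀ hm₁, ENNReal.toReal_ofReal hν.le,
    Complex.real_smul]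
  push_cast
  ring

end Spectrum

/-! ### Intensity and reduced cumulant measures of the process -/

section ClusterMoments

variable {Ω : Type*} [MeasurableSpace Ω] {P : Measure Ω} [IsProbabilityMeasure P] {ν m : ℝ}
  {f : ℝ → ℝ} {U : ℕ → Ω → ℝ} {ξ : ℕ → List ℕ → Ω → ℕ} {D : ℕ → List ℕ → Ω → ℝ}

/-- The mean count is `ν |A|` times the mean total progeny `1 / (1 - m)`. Bounded sets come first
because the moment formula is proved for integrable test functions. -/
lemma IsBranchingData.lintegral_apply_of_isBounded (hf : IsProbDensity f)
    (h : IsBranchingData P ν m f U ξ D) (hν : 0 < ν) (hm₀ : 0 < m) (hm₁ : m < 1) {A : Set ℝ}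
    (hA : MeasurableSet A) (bA : Bornology.IsBounded A) :
    ∫⁻ ω, clusterProcess U ξ D ω A ∂P = ENNReal.ofReal (ν / (1 - m)) * volume A := by
  have := hf.isProbabilityMeasure
  have tA := isTestFun_indicator hA bA
  have hmom := (h.moments hf hm₀ hm₁ tA).2.1
  have hμ := hf.offspringLaw_total hm₀ hm₁
  have i1 := h.integrable_linStat_pow hf hm₀ hm₁ tA (k := 1) (by simp)
  have i2 := integrable_clusterStat_pow (ν := ν) hμ tA (k := 0) (by simp)
  simp only [pow_one, zero_add] at i1 i2
  have e1 : ∫⁻ ω, clusterProcess U ξ D ω A ∂P =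
      ENNReal.ofReal (∫ ω, linStat (clusterProcess U ξ D ω) (A.indicator 1) ∂P) := by
    rw [ofReal_integral_eq_lintegral_ofReal i1 (Eventually.of_forall fun _ => linStat_nonneg _ _)]
    refine lintegral_congr_ae ?_
    filter_upwards [h.ae_lintegral_lt_top hf hm₀ hm₁ tA] with ω hω
    rw [linStat, ENNReal.ofReal_toReal hω.ne, lintegral_indicator_one hA]
  have e2 : ENNReal.ofReal (∫ p, clusterStat (A.indicator 1) p
      ∂clusterIntensity ν (offspringLaw m f)) =
      ∫⁻ p, clusterSum (A.indicator 1) p ∂clusterIntensity ν (offspringLaw m f) := by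
    rw [ofReal_integral_eq_lintegral_ofReal i2
      (Eventually.of_forall fun _ => ENNReal.toReal_nonneg)]
    refine lintegral_congr_ae ?_
    filter_upwards [ae_clusterSum_lt_top (ν := ν) hμ tA] with p hp
    rw [clusterStat, ENNReal.ofReal_toReal hp.ne]
  rw [e1, hmom, e2, lintegral_clusterIntensity (measurable_clusterSum tA.measurable)]
  simp_rw [lintegral_vsum_shift tA.measurable, lintegral_indicator_one hA]
  rw [lintegral_mul_const _ measurable_total, lintegral_total hf hm₀ hm₁, ← mul_assoc,
    ← ENNReal.ofReal_mul hν.le, mul_one_div]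

theorem IsBranchingData.hasIntensity (hf : IsProbDensity f)
    (h : IsBranchingData P ν m f U ξ D) (hν : 0 < ν) (hm₀ : 0 < m) (hm₁ : m < 1) :
    HasIntensity P (clusterProcess U ξ D) (ν / (1 - m)) := by
  have hN := h.measurable_superposition
  refine ⟨hN.aemeasurable, fun A hA => ?_⟩
  have hmono : Monotone fun n : ℕ => A ∩ Icc (-(n : ℝ)) n := fun i j hij => by
    have : (i : ℝ) ≤ j := by exact_mod_cast hij
    exact inter_subset_inter_right _ (Icc_subset_Icc (by linarith) this)
  have hU : ⋃ n : ℕ, A ∩ Icc (-(n : ℝ)) n = A := by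
    rw [← inter_iUnion, inter_eq_left]
    intro x _
    obtain ⟨n, hn⟩ := exists_nat_ge |x|
    exact mem_iUnion.2 ⟨n, abs_le.1 hn⟩
  have hb : ∀ n : ℕ, (P.bind (clusterProcess U ξ D)) (A ∩ Icc (-(n : ℝ)) n) =
      (ENNReal.ofReal (ν / (1 - m)) • volume) (A ∩ Icc (-(n : ℝ)) n) := fun n => by
    have hAn := hA.inter (measurableSet_Icc (a := -(n : ℝ)) (b := n))
    rw [Measure.bind_apply hAn hN.aemeasurable,
      h.lintegral_apply_of_isBounded hf hν hm₀ hm₁ hAn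
        ((Metric.isBounded_Icc _ _).subset inter_subset_right)]
    rfl
  rw [← Measure.bind_apply hA hN.aemeasurable, ← smul_eq_mul, ← Measure.smul_apply, ← hU]
  refine tendsto_nhds_unique (tendsto_measure_iUnion_atTop hmono) ?_
  simp only [Function.comp_def, hb]
  exact tendsto_measure_iUnion_atTop hmono

lemma IsBranchingData.completeCumulant2_eq_lintegral (hf : IsProbDensity f)
    (h : IsBranchingData P ν m f U ξ D) (hm₀ : 0 < m) (hm₁ : m < 1) {A B : Set ℝ}
    (hA : MeasurableSet A) (hB : MeasurableSet B) (bA : Bornology.IsBounded A)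
    (bB : Bornology.IsBounded B) :
    completeCumulant2 P (clusterProcess U ξ D) A B =
      (∫⁻ t in A, pairMeasure ν m f {τ | t + τ ∈ B}).toReal := by
  have := hf.isProbabilityMeasure
  have hμ := hf.offspringLaw_total hm₀ hm₁
  have tA := isTestFun_indicator hA bA
  have tB := isTestFun_indicator hB bB
  rw [h.completeCumulant2_eq hf hm₀ hm₁ hA hB bA bB]
  simp_rw [clusterStat, ← ENNReal.toReal_mul]
  have hF : Measurable fun p => clusterSum (A.indicator 1) p * clusterSum (B.indicator 1) p :=
    (measurable_clusterSum tA.measurable).mul (measurable_clusterSum tB.measurable)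
  rw [integral_toReal hF.aemeasurable, lintegral_clusterSum_mul tA.measurable tB.measurable,
    lintegral_pairLaw_indicator hA hB]
  · simp_rw [pairMeasure, Measure.smul_apply, smul_eq_mul]
    rw [lintegral_const_mul' _ _ (by simp)]
  · filter_upwards [ae_clusterSum_lt_top (ν := ν) hμ tA, ae_clusterSum_lt_top (ν := ν) hμ tB]
      with p h1 h2
    exact ENNReal.mul_lt_top h1 h2

lemma IsBranchingData.completeCumulant3_eq_lintegral (hf : IsProbDensity f)
    (h : IsBranchingData P ν m f U ξ D) (hm₀ : 0 < m) (hm₁ : m < 1) {A B C : Set ℝ}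
    (hA : MeasurableSet A) (hB : MeasurableSet B) (hC : MeasurableSet C)
    (bA : Bornology.IsBounded A) (bB : Bornology.IsBounded B) (bC : Bornology.IsBounded C) :
    completeCumulant3 P (clusterProcess U ξ D) A B C =
      (∫⁻ t in A, tripleMeasure ν m f {τ | t + τ.1 ∈ B ∧ t + τ.2 ∈ C}).toReal := by
  have := hf.isProbabilityMeasure
  have hμ := hf.offspringLaw_total hm₀ hm₁
  have tA := isTestFun_indicator hA bA
  have tB := isTestFun_indicator hB bB
  have tC := isTestFun_indicator hC bC
  rw [h.completeCumulant3_eq hf hm₀ hm₁ hA hB hC bA bB bC]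
  simp_rw [clusterStat, mul_assoc, ← ENNReal.toReal_mul]
  have hF : Measurable fun p => clusterSum (A.indicator 1) p *
      (clusterSum (B.indicator 1) p * clusterSum (C.indicator 1) p) :=
    (measurable_clusterSum tA.measurable).mul
      ((measurable_clusterSum tB.measurable).mul (measurable_clusterSum tC.measurable))
  rw [integral_toReal hF.aemeasurable,
    lintegral_clusterSum_mul_mul tA.measurable tB.measurable tC.measurable,
    lintegral_tripleLaw_indicator hA hB hC]
  · simp_rw [tripleMeasure, Measure.smul_apply, smul_eq_mul]
    rw [lintegral_const_mul' _ _ (by simp)]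
  · filter_upwards [ae_clusterSum_lt_top (ν := ν) hμ tA, ae_clusterSum_lt_top (ν := ν) hμ tB,
      ae_clusterSum_lt_top (ν := ν) hμ tC] with p h1 h2 h3
    exact ENNReal.mul_lt_top h1 (ENNReal.mul_lt_top h2 h3)

theorem IsBranchingData.isReducedCovariance (hf : IsProbDensity f)
    (h : IsBranchingData P ν m f U ξ D) (hm₀ : 0 < m) (hm₁ : m < 1)
    [IsFiniteMeasure (pairMeasure ν m f)] :
    IsReducedCovariance P (clusterProcess U ξ D) (pairMeasure ν m f).toSignedMeasure := by
  refine ⟨h.hasFiniteMoments hf hm₀ hm₁ (by simp), fun A B hA hB bA bB => ?_⟩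
  have hs : MeasurableSet {p : ℝ × ℝ | p.1 + p.2 ∈ B} := measurableSet_preimage (by fun_prop) hB
  have hmeas : Measurable fun t : ℝ => pairMeasure ν m f {τ | t + τ ∈ B} :=
    measurable_measure_prodMk_left hs
  rw [h.completeCumulant2_eq_lintegral hf hm₀ hm₁ hA hB bA bB,
    ← integral_toReal hmeas.aemeasurable (Eventually.of_forall fun _ => measure_lt_top _ _)]
  congr 1 with t
  have hst : MeasurableSet {τ : ℝ | t + τ ∈ B} := measurableSet_preimage (by fun_prop) hB
  rw [Measure.toSignedMeasure_apply_measurable hst]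
  rfl

theorem IsBranchingData.isReducedCompleteThird (hf : IsProbDensity f)
    (h : IsBranchingData P ν m f U ξ D) (hm₀ : 0 < m) (hm₁ : m < 1)
    [IsFiniteMeasure (tripleMeasure ν m f)] :
    IsReducedCompleteThird P (clusterProcess U ξ D) (tripleMeasure ν m f).toSignedMeasure := by
  refine ⟨h.hasFiniteMoments hf hm₀ hm₁ le_rfl, fun A B C hA hB hC bA bB bC => ?_⟩
  rw [h.completeCumulant3_eq_lintegral hf hm₀ hm₁ hA hB hC bA bB bC,
    ← setIntegral_measure_shear _ hB hC]
  congr 1 with t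
  rw [Measure.toSignedMeasure_apply_measurable (measurableSet_shear t hB hC)]

end ClusterMoments

/-! ### Diagonal contributions as images of measures on the line -/

section Diagonals

variable {G : Measure ℝ} {A B C : Set ℝ}

/-- Coincidence of the first two points means that the first lag is zero, so the measure on the line
is placed on the axis `τ₁ = 0`. -/
lemma lintegral_diagonal_snd (hA : MeasurableSet A) (hB : MeasurableSet B)
    (hC : MeasurableSet C) :
    ∫⁻ t in A ∩ B, G {τ | t + τ ∈ C} =
      ∫⁻ t in A, (G.map fun τ => ((0, τ) : ℝ × ℝ)) {τ | t + τ.1 ∈ B ∧ t + τ.2 ∈ C} := by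
  rw [← lintegral_indicator hA, ← lintegral_indicator (hA.inter hB)]
  congr 1 with t
  by_cases ht : t ∈ A
  · rw [indicator_of_mem ht, Measure.map_apply (by fun_prop) (measurableSet_shear t hB hC)]
    by_cases ht' : t ∈ B
    · rw [indicator_of_mem (show t ∈ A ∩ B from ⟨ht, ht'⟩)]
      congr 1 with τ
      simp [ht']
    · rw [indicator_of_notMem fun h => ht' h.2]
      convert! (measure_empty (μ := G)).symm
      ext τ
      simp [ht']
  · rw [indicator_of_notMem ht, indicator_of_notMem fun h => ht h.1]

lemma lintegral_diagonal_fst (hA : MeasurableSet A) (hB : MeasurableSet B)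
    (hC : MeasurableSet C) :
    ∫⁻ t in A ∩ C, G {τ | t + τ ∈ B} =
      ∫⁻ t in A, (G.map fun τ => ((τ, 0) : ℝ × ℝ)) {τ | t + τ.1 ∈ B ∧ t + τ.2 ∈ C} := by
  rw [← lintegral_indicator hA, ← lintegral_indicator (hA.inter hC)]
  congr 1 with t
  by_cases ht : t ∈ A
  · rw [indicator_of_mem ht, Measure.map_apply (by fun_prop) (measurableSet_shear t hB hC)]
    by_cases ht' : t ∈ C
    · rw [indicator_of_mem (show t ∈ A ∩ C from ⟨ht, ht'⟩)]
      congr 1 with τ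
      simp [ht']
    · rw [indicator_of_notMem fun h => ht' h.2]
      convert! (measure_empty (μ := G)).symm
      ext τ
      simp [ht']
  · rw [indicator_of_notMem ht, indicator_of_notMem fun h => ht h.1]

lemma lintegral_diagonal (hB : MeasurableSet B) (hC : MeasurableSet C) :
    ∫⁻ t in A, G {τ | t + τ ∈ B ∩ C} =
      ∫⁻ t in A, (G.map fun τ => ((τ, τ) : ℝ × ℝ)) {τ | t + τ.1 ∈ B ∧ t + τ.2 ∈ C} := by
  congr 1 with t
  rw [Measure.map_apply (by fun_prop) (measurableSet_shear t hB hC)]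
  rfl

lemma lintegral_diagonal_dirac (hA : MeasurableSet A) (hB : MeasurableSet B)
    (hC : MeasurableSet C) (c : ℝ≥0∞) :
    c * volume (A ∩ B ∩ C) =
      ∫⁻ t in A, (c • Measure.dirac (0 : ℝ × ℝ)) {τ | t + τ.1 ∈ B ∧ t + τ.2 ∈ C} := by
  rw [← lintegral_indicator hA, ← lintegral_indicator_one ((hA.inter hB).inter hC),
    ← lintegral_const_mul _ (measurable_one.indicator ((hA.inter hB).inter hC))]
  congr 1 with t
  by_cases hA' : t ∈ A <;> by_cases hB' : t ∈ B <;> by_cases hC' : t ∈ C <;>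
    simp [indicator, hA', hB', hC', Measure.dirac_apply' _ (measurableSet_shear t hB hC)]

end Diagonals

/-! ### Fourier–Stieltjes transforms in the plane -/

section Transforms

/-- `e^{-i(ω₁τ₁ + ω₂τ₂)}`. -/
noncomputable def phase2 (ω₁ ω₂ : ℝ) (τ : ℝ × ℝ) : ℂ :=
  Complex.exp (-((ω₁ * τ.1 + ω₂ * τ.2 : ℝ) : ℂ) * Complex.I)

lemma phase2_eq (ω₁ ω₂ : ℝ) (τ : ℝ × ℝ) : phase2 ω₁ ω₂ τ = phase ω₁ τ.1 * phase ω₂ τ.2 := by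
  rw [phase2, phase, phase, ← Complex.exp_add]
  congr 1
  push_cast
  ring

lemma norm_phase2 (ω₁ ω₂ : ℝ) (τ : ℝ × ℝ) : ‖phase2 ω₁ ω₂ τ‖ = 1 := by
  rw [phase2_eq, norm_mul, norm_phase, norm_phase, one_mul]

lemma star_phase2 (ω₁ ω₂ : ℝ) (τ : ℝ × ℝ) :
    (starRingEnd ℂ) (phase2 ω₁ ω₂ τ) = phase2 ω₁ ω₂ (-τ) := by
  simp only [phase2_eq, map_mul, star_phase, Prod.fst_neg, Prod.snd_neg]

lemma continuous_phase2 (ω₁ ω₂ : ℝ) : Continuous (phase2 ω₁ ω₂) := by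
  unfold phase2; fun_prop

lemma vectorMeasure_integrable_phase2 (G : Measure (ℝ × ℝ)) [IsFiniteMeasure G] (ω₁ ω₂ : ℝ) :
    G.toSignedMeasure.Integrable (phase2 ω₁ ω₂) := by
  change MeasureTheory.Integrable _ G.toSignedMeasure.variation
  rw [Measure.variation_toSignedMeasure]
  exact (integrable_const (1 : ℝ)).mono' (continuous_phase2 ω₁ ω₂).aestronglyMeasurable
    (Eventually.of_forall fun τ => (norm_phase2 ω₁ ω₂ τ).le)

lemma fourierStieltjes_toSignedMeasure (G : Measure ℝ) [IsFiniteMeasure G] (ω : ℝ) :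
    fourierStieltjes G.toSignedMeasure ω = ∫ τ, phase ω τ ∂G :=
  VectorMeasure.integral_toSignedMeasure

lemma fourierStieltjes2_toSignedMeasure (G : Measure (ℝ × ℝ)) [IsFiniteMeasure G] (ω₁ ω₂ : ℝ) :
    fourierStieltjes2 G.toSignedMeasure ω₁ ω₂ = ∫ τ, phase2 ω₁ ω₂ τ ∂G :=
  VectorMeasure.integral_toSignedMeasure

/-- Conjugating the phase amounts to negating the lags, which leaves `G` invariant. -/
lemma im_integral_phase2_eq_zero {G : Measure (ℝ × ℝ)} (hG : G.map (fun τ => -τ) = G)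
    (ω₁ ω₂ : ℝ) : (∫ τ, phase2 ω₁ ω₂ τ ∂G).im = 0 := by
  refine Complex.conj_eq_iff_im.1 ?_
  rw [← integral_conj]
  simp_rw [star_phase2]
  conv_rhs => rw [← hG]
  rw [integral_map (by fun_prop) (continuous_phase2 ω₁ ω₂).aestronglyMeasurable]

/-- The signed measure is the difference of the finite measures with densities `c⁺` and `c⁻`; their
transforms recombine because `c⁺ - c⁻ = c`. -/
lemma fourierStieltjes2_withDensityᵥ {c : ℝ × ℝ → ℝ} (hc : Integrable c) (ω₁ ω₂ : ℝ) :
    fourierStieltjes2 (volume.withDensityᵥ c) ω₁ ω₂ = fourierR2 c ω₁ ω₂ := by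
  have h1 := isFiniteMeasure_withDensity_ofReal hc.2
  have h2 := isFiniteMeasure_withDensity_ofReal hc.neg.2
  have hI : ∀ c : ℝ × ℝ → ℝ, Integrable c →
      Integrable fun τ => (max (c τ) 0) • phase2 ω₁ ω₂ τ := fun c hc => by
    refine hc.norm.mono' ?_ (Eventually.of_forall fun τ => ?_)
    · exact (hc.1.sup aestronglyMeasurable_const).smul
        (continuous_phase2 ω₁ ω₂).aestronglyMeasurable
    · rw [norm_smul, norm_phase2, mul_one, Real.norm_of_nonneg (le_max_right _ _)]
      exact max_le (le_abs_self _) (abs_nonneg _)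
  have hW : ∀ c : ℝ × ℝ → ℝ, Integrable c →
      ∫ τ, phase2 ω₁ ω₂ τ ∂(volume.withDensity fun τ => ENNReal.ofReal (c τ)) =
        ∫ τ, (max (c τ) 0) • phase2 ω₁ ω₂ τ := fun c hc => by
    rw [integral_withDensity_eq_integral_toReal_smul₀ hc.1.aemeasurable.ennreal_ofReal (by simp)]
    simp_rw [ENNReal.toReal_ofReal']
  rw [withDensityᵥ_eq_withDensity_pos_part_sub_withDensity_neg_part hc]
  have e : fourierStieltjes2 ((volume.withDensity fun τ => ENNReal.ofReal (c τ)).toSignedMeasure -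
      (volume.withDensity fun τ => ENNReal.ofReal (-c τ)).toSignedMeasure) ω₁ ω₂ =
      fourierStieltjes2 (volume.withDensity fun τ => ENNReal.ofReal (c τ)).toSignedMeasure ω₁ ω₂ -
      fourierStieltjes2 (volume.withDensity fun τ => ENNReal.ofReal (-c τ)).toSignedMeasure
        ω₁ ω₂ :=
    VectorMeasure.integral_sub_vectorMeasure (vectorMeasure_integrable_phase2 _ _ _)
      (vectorMeasure_integrable_phase2 _ _ _)
  rw [e, fourierStieltjes2_toSignedMeasure, fourierStieltjes2_toSignedMeasure, hW c hc,
    hW (fun τ => -c τ) hc.neg, ← integral_sub (hI c hc) (hI (fun τ => -c τ) hc.neg), fourierR2]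
  congr 1 with τ
  rw [← sub_smul, show max (c τ) 0 - max (-c τ) 0 = c τ by
    rcases le_total 0 (c τ) with h | h
    · rw [max_eq_left h, max_eq_right (by linarith)]; ring
    · rw [max_eq_right h, max_eq_left (by linarith)]; ring, Complex.real_smul, mul_comm]
  rfl

end Transforms

/-! ### The factorial third cumulant measure -/

section FactorialThird

lemma integral_sub_add_add_add {S : Type*} [MeasurableSpace S] {μ : Measure S}
    {a b c d e : S → ℝ} (ha : Integrable a μ) (hb : Integrable b μ) (hc : Integrable c μ)
    (hd : Integrable d μ) (he : Integrable e μ) :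
    ∫ x, (a x - (b x + c x + d x) + e x) ∂μ =
      (∫ x, a x ∂μ) - ((∫ x, b x ∂μ) + (∫ x, c x ∂μ) + ∫ x, d x ∂μ) + ∫ x, e x ∂μ := by
  have h1 : Integrable (fun x => b x + c x) μ := hb.add hc
  have h2 : Integrable (fun x => b x + c x + d x) μ := h1.add hd
  have h3 : Integrable (fun x => a x - (b x + c x + d x)) μ := ha.sub h2
  rw [integral_add h3 he, integral_sub ha h2, integral_add h1 hd, integral_add hb hc]

variable {Ω : Type*} [MeasurableSpace Ω] {P : Measure Ω} [IsProbabilityMeasure P] {ν m : ℝ}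
  {f : ℝ → ℝ} {U : ℕ → Ω → ℝ} {ξ : ℕ → List ℕ → Ω → ℕ} {D : ℕ → List ℕ → Ω → ℝ}

/-- Contribution of the triples with coinciding vertices, outside the full diagonal. -/
noncomputable def diagonalMeasure (ν m : ℝ) (f : ℝ → ℝ) : Measure (ℝ × ℝ) :=
  (pairMeasure ν m f).map (fun τ => (0, τ)) + (pairMeasure ν m f).map (fun τ => (τ, 0)) +
    (pairMeasure ν m f).map (fun τ => (τ, τ))

/-- Contribution of the full diagonal. -/
noncomputable def fullDiagonalMeasure (ν m : ℝ) : Measure (ℝ × ℝ) :=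
  ENNReal.ofReal (2 * (ν / (1 - m))) • Measure.dirac 0

instance [IsFiniteMeasure (pairMeasure ν m f)] : IsFiniteMeasure (diagonalMeasure ν m f) := by
  unfold diagonalMeasure; infer_instance

instance : IsFiniteMeasure (fullDiagonalMeasure ν m) := by
  refine ⟨?_⟩
  rw [fullDiagonalMeasure, Measure.smul_apply, smul_eq_mul]
  exact ENNReal.mul_lt_top ENNReal.ofReal_lt_top (measure_lt_top _ _)

/-- The reduced factorial third cumulant measure of the cluster process. -/
noncomputable def factorialThird (ν m : ℝ) (f : ℝ → ℝ) [IsFiniteMeasure (pairMeasure ν m f)]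
    [IsFiniteMeasure (tripleMeasure ν m f)] : SignedMeasure (ℝ × ℝ) :=
  (tripleMeasure ν m f).toSignedMeasure - (diagonalMeasure ν m f).toSignedMeasure +
    (fullDiagonalMeasure ν m).toSignedMeasure

/-- Each covariance term in `factorialCumulant3_eq` reduces to an image of the pair measure, on one
of the two axes or on the diagonal; the mean count of `A ∩ B ∩ C` reduces to a point mass at the
origin. -/
theorem IsBranchingData.isReducedFactorialThird (hf : IsProbDensity f)
    (h : IsBranchingData P ν m f U ξ D) (hν : 0 < ν) (hm₀ : 0 < m) (hm₁ : m < 1)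
    [IsFiniteMeasure (pairMeasure ν m f)] [IsFiniteMeasure (tripleMeasure ν m f)] :
    IsReducedFactorialThird P (clusterProcess U ξ D) (factorialThird ν m f) := by
  refine ⟨h.hasFiniteMoments hf hm₀ hm₁ le_rfl, fun A B C hA hB hC bA bB bC => ?_⟩
  have bAB : Bornology.IsBounded (A ∩ B) := bA.subset inter_subset_left
  have bAC : Bornology.IsBounded (A ∩ C) := bA.subset inter_subset_left
  have bBC : Bornology.IsBounded (B ∩ C) := bB.subset inter_subset_left
  have bABC : Bornology.IsBounded (A ∩ B ∩ C) := bAB.subset inter_subset_left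
  have hlam : 0 ≤ ν / (1 - m) := div_nonneg hν.le (by linarith)
  have hmean : 2 * ∫ ω, (clusterProcess U ξ D ω).real (A ∩ B ∩ C) ∂P =
      ∫ t in A, (fullDiagonalMeasure ν m).real {τ | t + τ.1 ∈ B ∧ t + τ.2 ∈ C} := by
    have hABC := (hA.inter hB).inter hC
    have hmeas : Measurable fun ω => clusterProcess U ξ D ω (A ∩ B ∩ C) :=
      (Measure.measurable_coe hABC).comp h.measurable_superposition
    have hI := h.lintegral_apply_of_isBounded hf hν hm₀ hm₁ hABC bABC
    rw [setIntegral_measure_shear _ hB hC, fullDiagonalMeasure,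
      ← lintegral_diagonal_dirac hA hB hC]
    have e : ∫ ω, (clusterProcess U ξ D ω).real (A ∩ B ∩ C) ∂P =
        (∫⁻ ω, clusterProcess U ξ D ω (A ∩ B ∩ C) ∂P).toReal := by
      refine integral_toReal hmeas.aemeasurable (ae_lt_top hmeas ?_)
      rw [hI]
      exact ENNReal.mul_ne_top (by simp) bABC.measure_lt_top.ne
    rw [e, hI, ENNReal.toReal_mul, ENNReal.toReal_mul, ENNReal.toReal_ofReal hlam,
      ENNReal.toReal_ofReal (by positivity)]
    ring
  have hsplit : ∀ t, factorialThird ν m f {τ | t + τ.1 ∈ B ∧ t + τ.2 ∈ C} =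
      (tripleMeasure ν m f).real {τ | t + τ.1 ∈ B ∧ t + τ.2 ∈ C}
        - (((pairMeasure ν m f).map fun τ => ((0, τ) : ℝ × ℝ)).real
            {τ | t + τ.1 ∈ B ∧ t + τ.2 ∈ C} +
          ((pairMeasure ν m f).map fun τ => ((τ, 0) : ℝ × ℝ)).real
            {τ | t + τ.1 ∈ B ∧ t + τ.2 ∈ C} +
          ((pairMeasure ν m f).map fun τ => ((τ, τ) : ℝ × ℝ)).real
            {τ | t + τ.1 ∈ B ∧ t + τ.2 ∈ C})
        + (fullDiagonalMeasure ν m).real {τ | t + τ.1 ∈ B ∧ t + τ.2 ∈ C} := fun t => by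
    have hs := measurableSet_shear t hB hC
    rw [factorialThird, _root_.add_apply, _root_.sub_apply,
      Measure.toSignedMeasure_apply_measurable hs, Measure.toSignedMeasure_apply_measurable hs,
      Measure.toSignedMeasure_apply_measurable hs, diagonalMeasure, measureReal_add_apply,
      measureReal_add_apply]
  have i : ∀ G : Measure (ℝ × ℝ), IsFiniteMeasure G →
      Integrable (fun t : ℝ => G.real {τ | t + τ.1 ∈ B ∧ t + τ.2 ∈ C}) (volume.restrict A) :=
    fun G _ => integrableOn_measure_shear G bA hB hC
  simp_rw [hsplit]
  have i0 := i (tripleMeasure ν m f) inferInstance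
  have i1 := i ((pairMeasure ν m f).map fun τ => ((0, τ) : ℝ × ℝ)) inferInstance
  have i2 := i ((pairMeasure ν m f).map fun τ => ((τ, 0) : ℝ × ℝ)) inferInstance
  have i3 := i ((pairMeasure ν m f).map fun τ => ((τ, τ) : ℝ × ℝ)) inferInstance
  have i4 := i (fullDiagonalMeasure ν m) inferInstance
  rw [integral_sub_add_add_add i0 i1 i2 i3 i4, ← hmean,
    h.factorialCumulant3_eq hf hm₀ hm₁ hA hB hC bA bB bC,
    h.completeCumulant3_eq_lintegral hf hm₀ hm₁ hA hB hC bA bB bC,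
    h.completeCumulant2_eq_lintegral hf hm₀ hm₁ (hA.inter hB) hC bAB bC,
    h.completeCumulant2_eq_lintegral hf hm₀ hm₁ (hA.inter hC) hB bAC bB,
    h.completeCumulant2_eq_lintegral hf hm₀ hm₁ hA (hB.inter hC) bA bBC,
    lintegral_diagonal_snd hA hB hC, lintegral_diagonal_fst hA hB hC, lintegral_diagonal hB hC,
    ← setIntegral_measure_shear _ hB hC, ← setIntegral_measure_shear _ hB hC,
    ← setIntegral_measure_shear _ hB hC, ← setIntegral_measure_shear _ hB hC]
  ring

lemma integral_phase2_diagonalMeasure [IsFiniteMeasure (pairMeasure ν m f)] (ω₁ ω₂ : ℝ) :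
    ∫ τ, phase2 ω₁ ω₂ τ ∂diagonalMeasure ν m f =
      (∫ τ, phase ω₁ τ ∂pairMeasure ν m f) + (∫ τ, phase ω₂ τ ∂pairMeasure ν m f) +
        ∫ τ, phase (ω₁ + ω₂) τ ∂pairMeasure ν m f := by
  have hc := continuous_phase2 ω₁ ω₂
  have hi : ∀ G : Measure (ℝ × ℝ), IsFiniteMeasure G → Integrable (phase2 ω₁ ω₂) G := fun G _ =>
    (integrable_const (1 : ℝ)).mono' hc.aestronglyMeasurable
      (Eventually.of_forall fun τ => (norm_phase2 ω₁ ω₂ τ).le)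
  rw [diagonalMeasure, integral_add_measure (hi _ inferInstance) (hi _ inferInstance),
    integral_add_measure (hi _ inferInstance) (hi _ inferInstance),
    integral_map (by fun_prop) hc.aestronglyMeasurable,
    integral_map (by fun_prop) hc.aestronglyMeasurable,
    integral_map (by fun_prop) hc.aestronglyMeasurable]
  have h3 : ∀ τ : ℝ, phase2 ω₁ ω₂ (τ, τ) = phase (ω₁ + ω₂) τ := fun τ => by
    rw [phase2, phase]
    congr 1
    push_cast
    ring
  simp_rw [h3, phase2_eq, phase_zero, one_mul, mul_one]
  ring

/-- The transforms of the complete and the factorial third cumulant measures. -/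
theorem fourierStieltjes2_tripleMeasure (hν : 0 < ν) (hm₁ : m < 1)
    [IsFiniteMeasure (pairMeasure ν m f)] [IsFiniteMeasure (tripleMeasure ν m f)] (ω₁ ω₂ : ℝ) :
    fourierStieltjes2 (tripleMeasure ν m f).toSignedMeasure ω₁ ω₂ =
      fourierStieltjes2 (factorialThird ν m f) ω₁ ω₂ +
        (fourierStieltjes (pairMeasure ν m f).toSignedMeasure ω₁ +
          fourierStieltjes (pairMeasure ν m f).toSignedMeasure ω₂ +
          fourierStieltjes (pairMeasure ν m f).toSignedMeasure (ω₁ + ω₂)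
          - 2 * ((ν / (1 - m) : ℝ) : ℂ)) := by
  have hi : ∀ G : Measure (ℝ × ℝ), ∀ _ : IsFiniteMeasure G,
    G.toSignedMeasure.Integrable (phase2 ω₁ ω₂) := fun G _ =>
    vectorMeasure_integrable_phase2 G ω₁ ω₂
  have e : fourierStieltjes2 (factorialThird ν m f) ω₁ ω₂ =
      fourierStieltjes2 (tripleMeasure ν m f).toSignedMeasure ω₁ ω₂ -
      fourierStieltjes2 (diagonalMeasure ν m f).toSignedMeasure ω₁ ω₂ +
      fourierStieltjes2 (fullDiagonalMeasure ν m).toSignedMeasure ω₁ ω₂ := by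
    have h1 := VectorMeasure.integral_add_vectorMeasure (B := (ContinuousLinearMap.lsmul ℝ ℝ).flip)
      ((hi (tripleMeasure ν m f) inferInstance).sub_vectorMeasure
        (hi (diagonalMeasure ν m f) inferInstance)) (hi (fullDiagonalMeasure ν m) inferInstance)
    rw [VectorMeasure.integral_sub_vectorMeasure (hi (tripleMeasure ν m f) inferInstance)
        (hi (diagonalMeasure ν m f) inferInstance)] at h1
    exact h1
  have hd : ∫ τ, phase2 ω₁ ω₂ τ ∂fullDiagonalMeasure ν m = 2 * ((ν / (1 - m) : ℝ) : ℂ) := by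
    have hlam : 0 ≤ ν / (1 - m) := div_nonneg hν.le (by linarith)
    rw [fullDiagonalMeasure, integral_smul_measure, integral_dirac,
      ENNReal.toReal_ofReal (by positivity)]
    simp [phase2]
  rw [e, fourierStieltjes2_toSignedMeasure (diagonalMeasure ν m f),
    fourierStieltjes2_toSignedMeasure (fullDiagonalMeasure ν m), hd,
    integral_phase2_diagonalMeasure, fourierStieltjes_toSignedMeasure,
    fourierStieltjes_toSignedMeasure, fourierStieltjes_toSignedMeasure]
  ring

lemma im_fourierStieltjes2_tripleMeasure (hf : IsEvenProbDensity f)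
    [IsFiniteMeasure (tripleMeasure ν m f)] (ω₁ ω₂ : ℝ) :
    (fourierStieltjes2 (tripleMeasure ν m f).toSignedMeasure ω₁ ω₂).im = 0 := by
  have := hf.1.isProbabilityMeasure
  rw [fourierStieltjes2_toSignedMeasure]
  refine im_integral_phase2_eq_zero ?_ ω₁ ω₂
  rw [tripleMeasure, Measure.map_smul, tripleLaw_map_neg hf.map_neg]

end FactorialThird

/-! ### Consequences for arbitrary reduced measures -/

section Consequences

variable {Ω : Type*} [MeasurableSpace Ω] {P : Measure Ω} [IsProbabilityMeasure P] {ν m : ℝ}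
  {f : ℝ → ℝ} {U : ℕ → Ω → ℝ} {ξ : ℕ → List ℕ → Ω → ℕ} {D : ℕ → List ℕ → Ω → ℝ}

/-- The reduced second and third cumulant measures of the cluster process exist. -/
theorem IsBranchingData.exists_reduced (hf : IsProbDensity f)
    (h : IsBranchingData P ν m f U ξ D) (hν : 0 < ν) (hm₀ : 0 < m) (hm₁ : m < 1) :
    ∃ γ₂ γ₃ κ₃, IsReducedCovariance P (clusterProcess U ξ D) γ₂ ∧
      IsReducedCompleteThird P (clusterProcess U ξ D) γ₃ ∧
      IsReducedFactorialThird P (clusterProcess U ξ D) κ₃ := by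
  have := hf.isFiniteMeasure_pairMeasure (ν := ν) hm₀ hm₁
  have := hf.isFiniteMeasure_tripleMeasure (ν := ν) hm₀ hm₁
  exact ⟨_, _, _, h.isReducedCovariance hf hm₀ hm₁, h.isReducedCompleteThird hf hm₀ hm₁,
    h.isReducedFactorialThird hf hν hm₀ hm₁⟩

/-- The full Bartlett spectrum. -/
theorem IsReducedCovariance.fourierStieltjes_eq {γ : SignedMeasure ℝ}
    (hγ : IsReducedCovariance P (clusterProcess U ξ D) γ) (hf : IsProbDensity f)
    (h : IsBranchingData P ν m f U ξ D) (hν : 0 < ν) (hm₀ : 0 < m) (hm₁ : m < 1) (ω : ℝ) :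
    fourierStieltjes γ ω = ((ν / (1 - m) / ‖1 - m * fourierR f ω‖ ^ 2 : ℝ) : ℂ) := by
  have := hf.isFiniteMeasure_pairMeasure (ν := ν) hm₀ hm₁
  rw [hγ.2.unique (h.isReducedCovariance hf hm₀ hm₁).2, fourierStieltjes_toSignedMeasure,
    integral_phase_pairMeasure hf hν hm₀ hm₁]

/-- For an even offspring density the third-order transforms are real. -/
theorem IsBranchingData.third_order (hf : IsEvenProbDensity f)
    (h : IsBranchingData P ν m f U ξ D) (hν : 0 < ν) (hm₀ : 0 < m) (hm₁ : m < 1)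
    {γ₂ : SignedMeasure ℝ} {γ₃ κ₃ : SignedMeasure (ℝ × ℝ)}
    (h₂ : IsReducedCovariance P (clusterProcess U ξ D) γ₂)
    (h₃ : IsReducedCompleteThird P (clusterProcess U ξ D) γ₃)
    (hκ : IsReducedFactorialThird P (clusterProcess U ξ D) κ₃) :
    (∀ ω₁ ω₂, (fourierStieltjes2 γ₃ ω₁ ω₂).im = 0) ∧
      (∀ ω₁ ω₂, (fourierStieltjes2 κ₃ ω₁ ω₂).im = 0) ∧
      (∀ c₃ : ℝ × ℝ → ℝ, Integrable c₃ → κ₃ = volume.withDensityᵥ c₃ →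
        ∀ ω₁ ω₂, (fourierR2 c₃ ω₁ ω₂).im = 0) ∧
      (∀ ω, (fourierStieltjes γ₂ ω).im = 0) ∧
      (∀ ω₁ ω₂, fourierStieltjes2 γ₃ ω₁ ω₂ = fourierStieltjes2 κ₃ ω₁ ω₂ +
        (fourierStieltjes γ₂ ω₁ + fourierStieltjes γ₂ ω₂ + fourierStieltjes γ₂ (ω₁ + ω₂)
          - 2 * ((ν / (1 - m) : ℝ) : ℂ))) := by
  have := hf.1.isFiniteMeasure_pairMeasure (ν := ν) hm₀ hm₁
  have := hf.1.isFiniteMeasure_tripleMeasure (ν := ν) hm₀ hm₁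
  have g₂ : ∀ ω, (fourierStieltjes γ₂ ω).im = 0 := fun ω => by
    rw [h₂.fourierStieltjes_eq hf.1 h hν hm₀ hm₁, Complex.ofReal_im]
  have e : ∀ ω₁ ω₂, fourierStieltjes2 γ₃ ω₁ ω₂ = fourierStieltjes2 κ₃ ω₁ ω₂ +
      (fourierStieltjes γ₂ ω₁ + fourierStieltjes γ₂ ω₂ + fourierStieltjes γ₂ (ω₁ + ω₂)
        - 2 * ((ν / (1 - m) : ℝ) : ℂ)) := fun ω₁ ω₂ => by
    rw [h₂.2.unique (h.isReducedCovariance hf.1 hm₀ hm₁).2,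
      h₃.2.unique (h.isReducedCompleteThird hf.1 hm₀ hm₁).2,
      hκ.2.unique (h.isReducedFactorialThird hf.1 hν hm₀ hm₁).2]
    exact fourierStieltjes2_tripleMeasure hν hm₁ ω₁ ω₂
  have g₃ : ∀ ω₁ ω₂, (fourierStieltjes2 γ₃ ω₁ ω₂).im = 0 := fun ω₁ ω₂ => by
    rw [h₃.2.unique (h.isReducedCompleteThird hf.1 hm₀ hm₁).2]
    exact im_fourierStieltjes2_tripleMeasure hf ω₁ ω₂
  -- The diagonal terms are real because `γ₂` has a real transform, so the factorial transform
  -- inherits reality from the complete one.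
  have k₃ : ∀ ω₁ ω₂, (fourierStieltjes2 κ₃ ω₁ ω₂).im = 0 := fun ω₁ ω₂ => by
    have h1 := congrArg Complex.im (e ω₁ ω₂)
    have h0 : (2 * ((ν / (1 - m) : ℝ) : ℂ)).im = 0 := by
      rw [Complex.mul_im, Complex.ofReal_im]; simp
    rw [g₃, Complex.add_im, Complex.sub_im, Complex.add_im, Complex.add_im, g₂, g₂, g₂, h0] at h1
    simpa using h1.symm
  refine ⟨g₃, k₃, fun c₃ hc hκc ω₁ ω₂ => ?_, g₂, e⟩
  rw [← fourierStieltjes2_withDensityᵥ hc, ← hκc]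
  exact k₃ ω₁ ω₂

/-- Processes with the same modulus of `1 - m f̂` have the same reduced covariance measure. -/
theorem pairMeasure_congr {φ : ℝ → ℝ} (hf : IsProbDensity f) (hφ : IsProbDensity φ) (hν : 0 < ν)
    (hm₀ : 0 < m) (hm₁ : m < 1)
    (heq : ∀ ω, ‖1 - m * fourierR φ ω‖ ^ 2 = ‖1 - m * fourierR f ω‖ ^ 2) :
    pairMeasure ν m φ = pairMeasure ν m f := by
  have := hf.isFiniteMeasure_pairMeasure (ν := ν) hm₀ hm₁
  have := hφ.isFiniteMeasure_pairMeasure (ν := ν) hm₀ hm₁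
  refine Measure.ext_of_charFun (funext fun t => ?_)
  have e : ∀ x : ℝ, Complex.exp (t * x * Complex.I) = phase (-t) x := fun x => by
    rw [phase]
    congr 1
    push_cast
    ring
  simp_rw [charFun_apply_real, e]
  rw [integral_phase_pairMeasure hf hν hm₀ hm₁, integral_phase_pairMeasure hφ hν hm₀ hm₁, heq]

end Consequences

/-! ### The square-root series and its weights -/

section CatalanSeries

/-- The Taylor coefficients `catalan k / 2^{2k+1}` of `1 - √(1 - z)`. -/
noncomputable def sqrtCoeff (k : ℕ) : ℝ := catalan k / 2 ^ (2 * k + 1)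

lemma sqrtCoeff_nonneg (k : ℕ) : 0 ≤ sqrtCoeff k := by unfold sqrtCoeff; positivity

lemma sqrtCoeff_eq (k : ℕ) :
    sqrtCoeff k = ((2 * k).factorial : ℝ) /
      (2 ^ (2 * k + 1) * ((k + 1).factorial : ℝ) * (k.factorial : ℝ)) := by
  have h1 : ((k : ℝ) + 1) * catalan k = k.centralBinom := by
    exact_mod_cast succ_mul_catalan_eq_centralBinom k
  have h2 : (k.centralBinom : ℝ) * (k.factorial * k.factorial) = (2 * k).factorial := by
    have h := Nat.choose_mul_factorial_mul_factorial (n := 2 * k) (k := k) (by omega)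
    rw [show 2 * k - k = k by omega, mul_assoc] at h
    rw [Nat.centralBinom_eq_two_mul_choose]
    exact_mod_cast h
  have hf : ((k + 1).factorial : ℝ) = (k + 1) * k.factorial := by
    rw [Nat.factorial_succ]; push_cast; ring
  have hk : (k.factorial : ℝ) ≠ 0 := by positivity
  rw [sqrtCoeff, hf, ← h2, ← h1]
  field_simp

lemma sqrtCoeff_pos (k : ℕ) : 0 < sqrtCoeff k := by rw [sqrtCoeff_eq]; positivity

/-- The remainder `centralBinom n / 4 ^ n` telescopes. Its nonnegativity bounds the partial sums by
`1`, which gives convergence up to the boundary `|z| = 1`. -/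
lemma sum_sqrtCoeff (n : ℕ) :
    ∑ k ∈ Finset.range n, sqrtCoeff k = 1 - n.centralBinom / 4 ^ n := by
  induction n with
  | zero => simp
  | succ n ih =>
    have h1 : ((n : ℝ) + 1) * catalan n = n.centralBinom := by
      exact_mod_cast succ_mul_catalan_eq_centralBinom n
    have h2 : ((n : ℝ) + 1) * (n + 1).centralBinom = 2 * (2 * n + 1) * n.centralBinom := by
      exact_mod_cast Nat.succ_mul_centralBinom_succ n
    have hn : (n : ℝ) + 1 ≠ 0 := by positivity
    have h4 : (2 : ℝ) ^ (2 * n + 1) = 2 * 4 ^ n := by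
      rw [pow_succ, pow_mul]; norm_num; ring
    have h3 : ((n + 1).centralBinom : ℝ) = 2 * (2 * n + 1) * catalan n := by
      rw [← h1] at h2
      exact mul_left_cancel₀ hn (by linear_combination h2)
    rw [Finset.sum_range_succ, ih, sqrtCoeff, h4, pow_succ, h3, ← h1]
    field_simp
    ring

lemma sum_sqrtCoeff_le (n : ℕ) : ∑ k ∈ Finset.range n, sqrtCoeff k ≤ 1 := by
  rw [sum_sqrtCoeff]
  have : (0 : ℝ) ≤ n.centralBinom / 4 ^ n := by positivity
  linarith

lemma summable_sqrtCoeff : Summable sqrtCoeff :=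
  summable_of_sum_range_le sqrtCoeff_nonneg sum_sqrtCoeff_le

/-- The convolution recursion of the Catalan numbers, rescaled: it is the coefficient form of `S² =
2 S - z` for `S = ∑ sqrtCoeff k * z ^ (k + 1)`. -/
lemma sum_antidiagonal_sqrtCoeff (k : ℕ) :
    ∑ p ∈ Finset.HasAntidiagonal.antidiagonal k, sqrtCoeff p.1 * sqrtCoeff p.2 = 2 * sqrtCoeff (k + 1) := by
  have h : (∑ p ∈ Finset.HasAntidiagonal.antidiagonal k, (catalan p.1 : ℝ) * catalan p.2) = catalan (k + 1) := by
    rw [catalan_succ']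
    push_cast
    rfl
  have h2 : ∀ p ∈ Finset.HasAntidiagonal.antidiagonal k, sqrtCoeff p.1 * sqrtCoeff p.2 =
      (catalan p.1 * catalan p.2) * (2 / 2 ^ (2 * (k + 1) + 1)) := fun p hp => by
    rw [← Finset.HasAntidiagonal.mem_antidiagonal.1 hp, sqrtCoeff, sqrtCoeff]
    field_simp
    ring
  rw [Finset.sum_congr rfl h2, ← Finset.sum_mul, h, sqrtCoeff]
  ring

lemma summable_sqrtCoeff_mul_pow {z : ℝ} (hz : |z| ≤ 1) :
    Summable fun k => ‖sqrtCoeff k * z ^ (k + 1)‖ := by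
  refine summable_sqrtCoeff.of_nonneg_of_le (fun _ => norm_nonneg _) fun k => ?_
  rw [norm_mul, norm_pow, Real.norm_of_nonneg (sqrtCoeff_nonneg k)]
  exact mul_le_of_le_one_right (sqrtCoeff_nonneg k) (pow_le_one₀ (norm_nonneg _) hz)

/-- The binomial series of the square root. -/
theorem hasSum_sqrtCoeff_mul_pow {z : ℝ} (hz : |z| ≤ 1) :
    HasSum (fun k => sqrtCoeff k * z ^ (k + 1)) (1 - √(1 - z)) := by
  have hn := summable_sqrtCoeff_mul_pow hz
  have hs : Summable fun k => sqrtCoeff k * z ^ (k + 1) := hn.of_norm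
  set S := ∑' k, sqrtCoeff k * z ^ (k + 1) with hS
  -- The equation `(1 - S)² = 1 - z` leaves two candidates; `S ≤ 1` selects the one with the
  -- positive square root.
  have hle : S ≤ 1 := by
    refine (hs.tsum_le_tsum (fun k => ?_) summable_sqrtCoeff).trans
      (Real.tsum_le_of_sum_range_le sqrtCoeff_nonneg sum_sqrtCoeff_le)
    refine (le_abs_self _).trans ?_
    rw [abs_mul, abs_pow, abs_of_nonneg (sqrtCoeff_nonneg k)]
    exact mul_le_of_le_one_right (sqrtCoeff_nonneg k) (pow_le_one₀ (abs_nonneg _) hz)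
  have hsq : S * S = 2 * S - z := by
    rw [hS, tsum_mul_tsum_eq_tsum_sum_antidiagonal_of_summable_norm hn hn]
    have h1 : ∀ k, ∑ p ∈ Finset.HasAntidiagonal.antidiagonal k,
        sqrtCoeff p.1 * z ^ (p.1 + 1) * (sqrtCoeff p.2 * z ^ (p.2 + 1)) =
        2 * (sqrtCoeff (k + 1) * z ^ (k + 1 + 1)) := fun k => by
      rw [← mul_assoc, ← sum_antidiagonal_sqrtCoeff, Finset.sum_mul]
      refine Finset.sum_congr rfl fun p hp => ?_
      rw [← Finset.HasAntidiagonal.mem_antidiagonal.1 hp]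
      ring
    simp_rw [h1]
    rw [tsum_mul_left, hs.tsum_eq_zero_add]
    simp [sqrtCoeff]
    ring
  have : √(1 - z) = 1 - S := by
    rw [show 1 - z = (1 - S) ^ 2 by linear_combination -hsq]
    exact Real.sqrt_sq (by linarith)
  rw [this, sub_sub_cancel]
  exact hs.hasSum

variable {m : ℝ}

lemma catalanWeight_succ (k : ℕ) :
    catalanWeight m (k + 1) = sqrtCoeff k * (m * (2 - m)) ^ (k + 1) / m := by
  rw [catalanWeight, sqrtCoeff_eq, show 2 * (k + 1) - 2 = 2 * k by omega,
    show 2 * (k + 1) - 1 = 2 * k + 1 by omega, Nat.add_sub_cancel, mul_div_assoc]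

lemma catalanWeight_pos (hm₀ : 0 < m) (hm₁ : m < 1) {n : ℕ} (hn : 1 ≤ n) :
    0 < catalanWeight m n := by
  obtain ⟨k, rfl⟩ := Nat.exists_eq_add_of_le' hn
  rw [catalanWeight_succ]
  have h1 := sqrtCoeff_pos k
  have h2 : 0 < 2 - m := by linarith
  positivity

lemma abs_weight_le (hm₀ : 0 < m) (hm₁ : m < 1) {y : ℝ} (hy : |y| ≤ 1) :
    |m * (2 - m) * y| ≤ 1 := by
  have h2 : 0 ≤ m * (2 - m) := mul_nonneg hm₀.le (by linarith)
  rw [abs_mul, abs_of_nonneg h2]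
  have : m * (2 - m) ≤ 1 := by nlinarith [sq_nonneg (1 - m)]
  exact mul_le_one₀ this (abs_nonneg _) hy

/-- The generating function of the weights. -/
theorem hasSum_catalanWeight_mul_pow (hm₀ : 0 < m) (hm₁ : m < 1) {y : ℝ} (hy : |y| ≤ 1) :
    HasSum (fun n : ℕ => catalanWeight m (n + 1) * y ^ (n + 1))
      ((1 - √(1 - m * (2 - m) * y)) / m) := by
  convert! (hasSum_sqrtCoeff_mul_pow (abs_weight_le hm₀ hm₁ hy)).div_const m using 2 with n
  rw [catalanWeight_succ, mul_pow (m * (2 - m)) y]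
  ring

/-- At `y = 1` the radicand is `1 - m (2 - m) = (1 - m)²`, so the generating function takes the
value `1`. -/
theorem hasSum_catalanWeight (hm₀ : 0 < m) (hm₁ : m < 1) :
    HasSum (fun n : ℕ => catalanWeight m (n + 1)) 1 := by
  have h := hasSum_catalanWeight_mul_pow hm₀ hm₁ (y := 1) (by simp)
  rw [show 1 - m * (2 - m) * 1 = (1 - m) ^ 2 by ring, Real.sqrt_sq (by linarith),
    sub_sub_cancel, div_self hm₀.ne'] at h
  simpa using h

end CatalanSeries

/-! ### The symmetric kernel and its transform -/

section Rho

variable {m : ℝ} {h : ℝ → ℝ}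

/-- The autocorrelation `∫ h(t) h(t - x) dt`. -/
noncomputable def autocorr (h : ℝ → ℝ) : ℝ → ℝ :=
  h ⋆[ContinuousLinearMap.mul ℝ ℝ, volume] fun y => h (-y)

lemma autocorr_apply (h : ℝ → ℝ) (x : ℝ) : autocorr h x = ∫ t, h t * h (t - x) := by
  rw [autocorr, convolution_def]
  simp

lemma autocorr_neg (h : ℝ → ℝ) (x : ℝ) : autocorr h (-x) = autocorr h x := by
  rw [autocorr_apply, autocorr_apply, ← integral_sub_right_eq_self _ x]
  simp [mul_comm]

lemma measurable_autocorr (hh : Measurable h) : Measurable (autocorr h) := by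
  have h1 : StronglyMeasurable fun p : ℝ × ℝ => h p.2 * h (p.2 - p.1) :=
    (by fun_prop : Measurable fun p : ℝ × ℝ => h p.2 * h (p.2 - p.1)).stronglyMeasurable
  have h2 := h1.integral_prod_right' (ν := volume)
  convert! h2.measurable using 1
  ext x
  exact autocorr_apply h x

lemma integrable_autocorr (hh : IsProbDensity h) : Integrable (autocorr h) :=
  hh.integrable.integrable_convolution (ContinuousLinearMap.mul ℝ ℝ) hh.integrable.comp_neg

lemma integrable_phase_mul {f : ℝ → ℝ} (hf : Integrable f) (ω : ℝ) :
    Integrable fun x => phase ω x * (f x : ℂ) := by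
  refine hf.norm.mono' ((continuous_phase ω).aestronglyMeasurable.mul
    (Complex.continuous_ofReal.comp_aestronglyMeasurable hf.1)) (Eventually.of_forall fun x => ?_)
  rw [norm_mul, norm_phase, one_mul, Complex.norm_real]

lemma fourierR_comp_neg (f : ℝ → ℝ) (ω : ℝ) :
    fourierR (fun x => f (-x)) ω = (starRingEnd ℂ) (fourierR f ω) := by
  rw [fourierR, fourierR, ← integral_conj, ← integral_neg_eq_self]
  congr 1 with x
  rw [map_mul, neg_neg, Complex.conj_ofReal]
  congr 1
  exact (star_phase ω x).symm

/-- The phase is multiplicative along `x = t + (x - t)`, so modulating a convolution is the same as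
convolving the modulated factors; its integral is the product of their integrals. -/
lemma fourierR_autocorr (hh : IsProbDensity h) (ω : ℝ) :
    fourierR (autocorr h) ω = fourierR h ω * (starRingEnd ℂ) (fourierR h ω) := by
  have h1 := integrable_phase_mul hh.integrable ω
  have h2 := integrable_phase_mul hh.integrable.comp_neg ω
  have h3 := integral_convolution (ContinuousLinearMap.mul ℝ ℂ) h1 h2
  rw [← fourierR_comp_neg]
  refine Eq.trans ?_ h3
  rw [fourierR]
  congr 1 with x
  rw [autocorr, convolution_def, convolution_def, ← integral_complex_ofReal, ← integral_const_mul]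
  congr 1 with t
  have e : phase ω x = phase ω t * phase ω (x - t) := by rw [← phase_add]; congr 1; ring
  change phase ω x * _ = _
  rw [e]
  simp only [ContinuousLinearMap.mul_apply']
  push_cast
  ring

lemma rhoKernel_eq (m : ℝ) (h : ℝ → ℝ) (x : ℝ) :
    rhoKernel m h x = (h |x| - m * autocorr h x) / (2 - m) := rfl

lemma rhoKernel_neg (m : ℝ) (h : ℝ → ℝ) (x : ℝ) : rhoKernel m h (-x) = rhoKernel m h x := by
  rw [rhoKernel_eq, rhoKernel_eq, abs_neg, autocorr_neg]

lemma measurable_rhoKernel (hh : Measurable h) : Measurable (rhoKernel m h) := by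
  have := measurable_autocorr hh
  change Measurable fun x => (h |x| - m * autocorr h x) / (2 - m)
  exact ((hh.comp measurable_norm).sub (this.const_mul m)).div_const _

variable (h_onesided : ∀ x, x < 0 → h x = 0)

include h_onesided in
-- Away from the origin at most one of `h x` and `h (-x)` is nonzero, so their sum is `h |x|`.
lemma rhoKernel_ae_eq : rhoKernel m h =ᵐ[volume] fun x =>
    (h x + h (-x) - m * autocorr h x) / (2 - m) := by
  filter_upwards [Measure.ae_ne volume (0 : ℝ)] with x hx
  rw [rhoKernel_eq]
  rcases lt_or_gt_of_ne hx with h0 | h0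
  · rw [abs_of_neg h0, h_onesided x h0, zero_add]
  · rw [abs_of_pos h0, h_onesided (-x) (by linarith), add_zero]

include h_onesided in
lemma integrable_rhoKernel (hh : IsProbDensity h) : Integrable (rhoKernel m h) := by
  refine Integrable.congr ?_ (rhoKernel_ae_eq h_onesided).symm
  exact ((hh.integrable.add hh.integrable.comp_neg).sub
    ((integrable_autocorr hh).const_mul m)).div_const _

include h_onesided in
/-- The transform of `ρ_h`. -/
lemma fourierR_rhoKernel (hh : IsProbDensity h) (ω : ℝ) :
    fourierR (rhoKernel m h) ω = (fourierR h ω + (starRingEnd ℂ) (fourierR h ω) -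
      m * (fourierR h ω * (starRingEnd ℂ) (fourierR h ω))) / (2 - m) := by
  have h1 := integrable_phase_mul hh.integrable ω
  have h2 := integrable_phase_mul hh.integrable.comp_neg ω
  have h3 := (integrable_phase_mul (integrable_autocorr hh) ω).const_mul (m : ℂ)
  have e : ∀ f : ℝ → ℝ, fourierR f ω = ∫ x, phase ω x * (f x : ℂ) := fun f => rfl
  have h12 : Integrable fun x => phase ω x * (h x : ℂ) + phase ω x * ((h (-x) : ℝ) : ℂ) :=
    h1.add h2
  rw [← fourierR_autocorr hh, ← fourierR_comp_neg, e, e, e, e, ← integral_add h1 h2,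
    ← integral_const_mul, ← integral_sub h12 h3, ← integral_div]
  refine integral_congr_ae ?_
  filter_upwards [rhoKernel_ae_eq (m := m) h_onesided] with x hx
  rw [hx]
  push_cast
  ring

include h_onesided in
-- This is the expansion `(1 - m ĥ)(1 - m conj ĥ) = 1 - m (ĥ + conj ĥ - m |ĥ|²)`; the kernel `ρ_h`
-- is designed to have the bracket as its transform, up to the factor `2 - m`.
lemma one_sub_fourierR_rhoKernel (hh : IsProbDensity h) (hm₁ : m < 1) (ω : ℝ) :
    1 - m * (2 - m) * fourierR (rhoKernel m h) ω =
      ((‖1 - m * fourierR h ω‖ ^ 2 : ℝ) : ℂ) := by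
  have h2 : (2 : ℂ) - m ≠ 0 := by
    have : ((2 - m : ℝ) : ℂ) ≠ 0 := Complex.ofReal_ne_zero.2 (by linarith)
    simpa using this
  rw [← Complex.normSq_eq_norm_sq, ← Complex.mul_conj, fourierR_rhoKernel h_onesided hh]
  simp only [map_sub, map_mul, map_one, Complex.conj_ofReal]
  field_simp
  ring

include h_onesided in
lemma fourierR_rhoKernel_eq_re (hh : IsProbDensity h) (hm₀ : 0 < m) (hm₁ : m < 1) (ω : ℝ) :
    (fourierR (rhoKernel m h) ω).im = 0 ∧
      1 - m * (2 - m) * (fourierR (rhoKernel m h) ω).re = ‖1 - m * fourierR h ω‖ ^ 2 := by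
  have e := one_sub_fourierR_rhoKernel h_onesided hh hm₁ ω
  have e' : 1 - ((m * (2 - m) : ℝ) : ℂ) * fourierR (rhoKernel m h) ω =
      ((‖1 - m * fourierR h ω‖ ^ 2 : ℝ) : ℂ) := by
    rw [← e]; push_cast; ring
  have him := congrArg Complex.im e'
  have hre := congrArg Complex.re e'
  rw [Complex.sub_im, Complex.one_im, Complex.im_ofReal_mul, Complex.ofReal_im] at him
  rw [Complex.sub_re, Complex.one_re, Complex.re_ofReal_mul, Complex.ofReal_re] at hre
  have hne : m * (2 - m) ≠ 0 := (mul_pos hm₀ (by linarith)).ne'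
  refine ⟨?_, hre⟩
  simpa [hne] using him

include h_onesided in
lemma integral_rhoKernel (hh : IsProbDensity h) (hm₁ : m < 1) : ∫ x, rhoKernel m h x = 1 := by
  have h0 := fourierR_rhoKernel (m := m) h_onesided hh 0
  rw [fourierR_zero hh] at h0
  have e : fourierR (rhoKernel m h) 0 = ((∫ x, rhoKernel m h x : ℝ) : ℂ) := by
    rw [fourierR, ← integral_complex_ofReal]
    simp
  have h2 : (2 : ℂ) - m ≠ 0 := by
    have : ((2 - m : ℝ) : ℂ) ≠ 0 := Complex.ofReal_ne_zero.2 (by linarith)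
    simpa using this
  rw [e, map_one, mul_one, mul_one, one_add_one_eq_two, div_self h2] at h0
  exact_mod_cast h0

include h_onesided in
/-- A density which decreases on the half-line dominates its autocorrelation. -/
lemma autocorr_le (hh : IsProbDensity h) {g : ℝ → ℝ} (hg : AntitoneOn g (Ioi 0))
    (hhg : ∀ᵐ x, 0 < x → h x = g x) {x : ℝ} (hx : 0 < x) (hxg : h x = g x) :
    autocorr h x ≤ h x := by
  have hI : Integrable fun t => h x * h (t - x) := (hh.integrable.comp_sub_right x).const_mul _
  -- For `t < x` the factor `h (t - x)` vanishes; for `t > x` monotonicity gives `h t ≤ h x` almost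
  -- everywhere.
  have hle : ∀ᵐ t, h t * h (t - x) ≤ h x * h (t - x) := by
    filter_upwards [hhg, Measure.ae_ne volume x] with t ht htx
    rcases lt_or_gt_of_ne htx with h0 | h0
    · rw [h_onesided (t - x) (by linarith), mul_zero, mul_zero]
    · have ht0 : 0 < t := hx.trans h0
      refine mul_le_mul_of_nonneg_right ?_ (hh.nonneg _)
      rw [ht ht0, hxg]
      exact hg hx ht0 h0.le
  rw [autocorr_apply]
  calc ∫ t, h t * h (t - x) ≤ ∫ t, h x * h (t - x) := by
        refine integral_mono_of_nonneg (Eventually.of_forall fun t =>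
          mul_nonneg (hh.nonneg _) (hh.nonneg _)) hI hle
    _ = h x := by
        rw [integral_const_mul, integral_sub_right_eq_self h x, hh.integral_eq_one, mul_one]

include h_onesided in
-- For `x > 0` the autocorrelation is at most `h x` and `m < 1`; evenness covers `x < 0`.
lemma rhoKernel_nonneg (hh : IsProbDensity h) (hm₀ : 0 < m) (hm₁ : m < 1) {g : ℝ → ℝ}
    (hg : AntitoneOn g (Ioi 0)) (hhg : ∀ᵐ x, 0 < x → h x = g x) :
    ∀ᵐ x, 0 ≤ rhoKernel m h x := by
  have key : ∀ x, 0 < x → h x = g x → 0 ≤ rhoKernel m h x := fun x hx hxg => by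
    have h1 := autocorr_le h_onesided hh hg hhg hx hxg
    rw [rhoKernel_eq, abs_of_pos hx]
    refine div_nonneg ?_ (by linarith)
    have := hh.nonneg x
    nlinarith
  have hneg : ∀ᵐ x : ℝ, 0 < -x → h (-x) = g (-x) :=
    (Measure.measurePreserving_neg (volume : Measure ℝ)).quasiMeasurePreserving.ae hhg
  filter_upwards [hhg, hneg, Measure.ae_ne volume (0 : ℝ)] with x h1 h2 h0
  rcases lt_or_gt_of_ne h0 with h3 | h3
  · rw [← rhoKernel_neg]
    exact key (-x) (by linarith) (h2 (by linarith))
  · exact key x h3 (h1 h3)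

include h_onesided in
theorem exists_isEvenRepresentative (hh : IsProbDensity h) (hm₀ : 0 < m) (hm₁ : m < 1)
    (h_monotone : ∃ g : ℝ → ℝ, AntitoneOn g (Ioi 0) ∧ h =ᵐ[volume.restrict (Ioi 0)] g) :
    ∃ r, IsEvenRepresentative m h r := by
  obtain ⟨g, hg, hhg⟩ := h_monotone
  have hhg' : ∀ᵐ x, 0 < x → h x = g x := (ae_restrict_iff' measurableSet_Ioi).1 hhg
  -- Truncation at zero makes nonnegativity hold everywhere and keeps exact evenness.
  have hae : (fun x => max (rhoKernel m h x) 0) =ᵐ[volume] rhoKernel m h := by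
    filter_upwards [rhoKernel_nonneg h_onesided hh hm₀ hm₁ hg hhg'] with x hx
    exact max_eq_left hx
  refine ⟨fun x => max (rhoKernel m h x) 0, ⟨⟨(measurable_rhoKernel hh.measurable).max
    measurable_const, fun x => le_max_right _ _,
    (integrable_rhoKernel h_onesided hh).congr hae.symm, ?_⟩, fun x => ?_⟩, hae⟩
  · rw [integral_congr_ae hae, integral_rhoKernel h_onesided hh hm₁]
  · simp only [rhoKernel_neg]

end Rho

/-! ### The law of the random sum -/

section RandomSum

variable {m : ℝ}

lemma charFun_eq_integral_phase (μ : Measure ℝ) (t : ℝ) : charFun μ t = ∫ x, phase (-t) x ∂μ := by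
  rw [charFun_apply_real]
  congr 1 with x
  rw [phase]
  congr 1
  push_cast
  ring

lemma integral_phase_eq_charFun (μ : Measure ℝ) (ω : ℝ) : ∫ x, phase ω x ∂μ = charFun μ (-ω) := by
  rw [charFun_eq_integral_phase, neg_neg]

/-- Convolution powers. -/
noncomputable def convPow (μ : Measure ℝ) : ℕ → Measure ℝ
  | 0 => Measure.dirac 0
  | n + 1 => (convPow μ n).conv μ

instance (μ : Measure ℝ) [IsProbabilityMeasure μ] (n : ℕ) :
    IsProbabilityMeasure (convPow μ n) := by
  induction n with
  | zero => unfold convPow; infer_instance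
  | succ n ih => unfold convPow; infer_instance

lemma integral_phase_convPow (μ : Measure ℝ) [IsProbabilityMeasure μ] (ω : ℝ) (n : ℕ) :
    ∫ x, phase ω x ∂convPow μ n = (∫ x, phase ω x ∂μ) ^ n := by
  induction n with
  | zero => simp [convPow, phase_zero]
  | succ n ih =>
    rw [convPow, integral_phase_eq_charFun, charFun_conv, ← integral_phase_eq_charFun,
      ← integral_phase_eq_charFun, ih, pow_succ]

/-- Law of a random sum with Catalan weights. -/
noncomputable def compoundLaw (m : ℝ) (μ : Measure ℝ) : Measure ℝ :=
  Measure.sum fun n : ℕ => ENNReal.ofReal (catalanWeight m (n + 1)) • convPow μ (n + 1)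

lemma tsum_ofReal_catalanWeight (hm₀ : 0 < m) (hm₁ : m < 1) :
    ∑' n : ℕ, ENNReal.ofReal (catalanWeight m (n + 1)) = 1 := by
  rw [← ENNReal.ofReal_tsum_of_nonneg
    (fun n => (catalanWeight_pos hm₀ hm₁ (Nat.le_add_left 1 n)).le)
    (hasSum_catalanWeight hm₀ hm₁).summable, (hasSum_catalanWeight hm₀ hm₁).tsum_eq,
    ENNReal.ofReal_one]

lemma isProbabilityMeasure_compoundLaw (hm₀ : 0 < m) (hm₁ : m < 1) (μ : Measure ℝ)
    [IsProbabilityMeasure μ] : IsProbabilityMeasure (compoundLaw m μ) := by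
  refine ⟨?_⟩
  rw [compoundLaw, Measure.sum_apply _ MeasurableSet.univ]
  simp [tsum_ofReal_catalanWeight hm₀ hm₁]

/-- The mixture starts at one summand, so the atom `convPow μ 0` does not occur and every term is a
convolution with `μ`. -/
lemma compoundLaw_absolutelyContinuous {μ : Measure ℝ} [IsProbabilityMeasure μ]
    (hμ : μ ≪ volume) : compoundLaw m μ ≪ volume := by
  refine Measure.AbsolutelyContinuous.mk fun s hs h => ?_
  rw [compoundLaw, Measure.sum_apply _ hs, ENNReal.tsum_eq_zero]
  intro n
  have h1 : convPow μ (n + 1) ≪ volume := Measure.conv_absolutelyContinuous hμ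
  rw [Measure.smul_apply, h1 h, smul_zero]

/-- Convolution powers become powers of the transform `y`, so the mixture is the generating function
of the weights at `y`. -/
lemma integral_phase_compoundLaw (hm₀ : 0 < m) (hm₁ : m < 1) {μ : Measure ℝ}
    [IsProbabilityMeasure μ] {ω y : ℝ} (hy : ∫ x, phase ω x ∂μ = y) :
    ∫ x, phase ω x ∂compoundLaw m μ = (((1 - √(1 - m * (2 - m) * y)) / m : ℝ) : ℂ) := by
  have hprob := isProbabilityMeasure_compoundLaw hm₀ hm₁ μ
  have hy1 : |y| ≤ 1 := by
    rw [← Real.norm_eq_abs, ← Complex.norm_real, ← hy]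
    refine (norm_integral_le_of_norm_le_const (C := 1)
      (Eventually.of_forall fun x => (norm_phase ω x).le)).trans ?_
    simp
  have hI : Integrable (phase ω) (compoundLaw m μ) :=
    (integrable_const (1 : ℝ)).mono' (continuous_phase ω).aestronglyMeasurable
      (Eventually.of_forall fun x => (norm_phase ω x).le)
  unfold compoundLaw at hI ⊢
  refine (hasSum_integral_measure hI).unique ?_
  convert! (hasSum_catalanWeight_mul_pow hm₀ hm₁ hy1).mapL Complex.ofRealCLM using 2 with n
  rw [integral_smul_measure, integral_phase_convPow, hy,
    ENNReal.toReal_ofReal (catalanWeight_pos hm₀ hm₁ (Nat.le_add_left 1 n)).le]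
  simp

variable {Ω : Type*} [MeasurableSpace Ω] {P : Measure Ω} [IsProbabilityMeasure P] {r : ℝ → ℝ}
  {K : Ω → ℕ} {Y : ℕ → Ω → ℝ}

lemma IsRandomSumData.map_sum (h : IsRandomSumData P m r K Y) (n : ℕ) :
    P.map (fun ω => ∑ k ∈ Finset.range n, Y k ω) = convPow (densityMeasure r) n := by
  induction n with
  | zero => simp [convPow]
  | succ n ih =>
    have hind := h.indep_Y.indepFun_finsetSum_of_notMem h.measurable_Y
      (s := Finset.range n) (i := n) Finset.notMem_range_self
    have e2 : (∑ k ∈ Finset.range n, Y k) = fun ω => ∑ k ∈ Finset.range n, Y k ω := by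
      ext ω
      simp
    have hm : Measurable (∑ k ∈ Finset.range n, Y k) := by
      rw [e2]
      exact Finset.measurable_sum _ fun k _ => h.measurable_Y k
    have e := hind.map_add_eq_map_conv_map hm (h.measurable_Y n)
    have e1 : (fun ω => ∑ k ∈ Finset.range (n + 1), Y k ω) =
        (∑ k ∈ Finset.range n, Y k) + Y n := by
      ext ω
      simp [Finset.sum_range_succ]
    rw [e1, e, e2, ih, h.law_Y, convPow]

/-- Law of the random sum. -/
theorem IsRandomSumData.map_randomSum (h : IsRandomSumData P m r K Y) (hm₀ : 0 < m)
    (hm₁ : m < 1) :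
    P.map (fun ω => ∑ k ∈ Finset.range (K ω), Y k ω) = compoundLaw m (densityMeasure r) := by
  have hS : ∀ n, Measurable fun y : ℕ → ℝ => ∑ k ∈ Finset.range n, y k := fun n => by fun_prop
  have hF : Measurable fun q : ℕ × (ℕ → ℝ) => ∑ k ∈ Finset.range q.1, q.2 k :=
    measurable_from_prod_countable_right hS
  have hYm : Measurable fun ω k => Y k ω := measurable_pi_iff.2 h.measurable_Y
  have hsum : Measurable fun ω => ∑ k ∈ Finset.range (K ω), Y k ω :=
    hF.comp (h.measurable_K.prodMk hYm)
  have hcover : ∀ s : Set Ω, MeasurableSet s → P s = ∑' n, P ({ω | K ω = n} ∩ s) := fun s hs => by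
    rw [← measure_iUnion]
    · congr 1
      ext ω
      simp
    · intro i j hij
      refine Set.disjoint_left.2 fun ω h1 h2 => hij ?_
      exact h1.1.symm.trans h2.1
    · exact fun n => (h.measurable_K (measurableSet_singleton n)).inter hs
  -- The data prescribe the law of `K` only on `n ≥ 1`; since those weights already sum to one, `K`
  -- is almost surely nonzero.
  have h0 : P {ω | K ω = 0} = 0 := by
    have h1 := hcover univ MeasurableSet.univ
    simp only [inter_univ] at h1
    rw [measure_univ, tsum_eq_zero_add' ENNReal.summable] at h1
    have h2 : ∑' n : ℕ, P {ω | K ω = n + 1} = 1 := by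
      rw [← tsum_ofReal_catalanWeight hm₀ hm₁]
      congr 1 with n
      exact h.law_K (n + 1) (Nat.le_add_left 1 n)
    rw [h2] at h1
    exact (ENNReal.add_left_inj ENNReal.one_ne_top).1 (h1.symm.trans (zero_add 1).symm)
  ext A hA
  rw [Measure.map_apply hsum hA, hcover _ (hsum hA), tsum_eq_zero_add' ENNReal.summable,
    measure_mono_null inter_subset_left h0, zero_add, compoundLaw, Measure.sum_apply _ hA]
  congr 1 with n
  have e : {ω | K ω = n + 1} ∩ (fun ω => ∑ k ∈ Finset.range (K ω), Y k ω) ⁻¹' A =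
      K ⁻¹' {n + 1} ∩ (fun ω k => Y k ω) ⁻¹'
        ((fun y : ℕ → ℝ => ∑ k ∈ Finset.range (n + 1), y k) ⁻¹' A) := by
    ext ω
    constructor
    · rintro ⟨h1, h2⟩
      refine ⟨h1, ?_⟩
      have h1' : K ω = n + 1 := h1
      rw [mem_preimage, h1'] at h2
      exact h2
    · rintro ⟨h1, h2⟩
      refine ⟨h1, ?_⟩
      have h1' : K ω = n + 1 := h1
      rw [mem_preimage, h1']
      exact h2
  have hmeas : Measurable fun ω => ∑ k ∈ Finset.range (n + 1), Y k ω := (hS (n + 1)).comp hYm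
  have e' : (fun ω k => Y k ω) ⁻¹' ((fun y : ℕ → ℝ => ∑ k ∈ Finset.range (n + 1), y k) ⁻¹' A) =
    (fun ω => ∑ k ∈ Finset.range (n + 1), Y k ω) ⁻¹' A := rfl
  rw [e, h.indep_K_Y.measure_inter_preimage_eq_mul _ _ (measurableSet_singleton _) (hS _ hA),
    Measure.smul_apply, ← h.map_sum, Measure.map_apply hmeas hA, smul_eq_mul, e']
  congr 1
  exact h.law_K (n + 1) (Nat.le_add_left 1 n)

end RandomSum

/-! ### Even densities of symmetric laws -/

section EvenDensity

/-- A symmetric absolutely continuous probability measure has an even density. -/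
lemma exists_isEvenProbDensity {μ : Measure ℝ} [IsProbabilityMeasure μ] (hac : μ ≪ volume)
    (hsymm : μ.map (fun x => -x) = μ) : ∃ φ, IsEvenProbDensity φ ∧ densityMeasure φ = μ := by
  set d := μ.rnDeriv volume with hd
  have hdm : Measurable d := Measure.measurable_rnDeriv _ _
  have hd1 : ∫⁻ x, d x = 1 := by
    rw [hd, Measure.lintegral_rnDeriv hac, measure_univ]
  have hdμ : volume.withDensity d = μ := Measure.withDensity_rnDeriv_eq _ _ hac
  have hdn : Measurable fun x => d (-x) := hdm.comp measurable_neg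
  have hdneg : (fun x => d (-x)) =ᵐ[volume] d := by
    have hneg : volume.withDensity (fun x => d (-x)) = volume.withDensity d := by
      rw [hdμ]
      conv_rhs => rw [← hsymm]
      refine Measure.ext_of_lintegral _ fun g hg => ?_
      have hg' : Measurable fun x => g (-x) := hg.comp measurable_neg
      have hdg : Measurable fun x => d x * g (-x) := hdm.mul hg'
      rw [lintegral_map hg measurable_neg, ← hdμ,
        lintegral_withDensity_eq_lintegral_mul _ hdn hg,
        lintegral_withDensity_eq_lintegral_mul _ hdm hg']
      simpa using (Measure.measurePreserving_neg (volume : Measure ℝ)).lintegral_comp hdg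
    refine (withDensity_eq_iff hdn.aemeasurable hdm.aemeasurable ?_).1 hneg
    rw [(Measure.measurePreserving_neg (volume : Measure ℝ)).lintegral_comp hdm, hd1]
    exact ENNReal.one_ne_top
  have hfin : ∀ᵐ x, d x < ∞ := Measure.rnDeriv_lt_top _ _
  -- The Radon–Nikodym derivative is even only almost everywhere; averaging it with its reflection
  -- gives an everywhere even version of the same density.
  have hae : ∀ᵐ x, ENNReal.ofReal (((d x).toReal + (d (-x)).toReal) / 2) = d x := by
    filter_upwards [hdneg, hfin] with x h1 h2
    rw [h1, add_self_div_two, ENNReal.ofReal_toReal h2.ne]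
  have hdens : densityMeasure (fun x => ((d x).toReal + (d (-x)).toReal) / 2) = μ := by
    rw [densityMeasure, withDensity_congr_ae hae, hdμ]
  have hmeas : Measurable fun x => ((d x).toReal + (d (-x)).toReal) / 2 := by fun_prop
  have hnn : ∀ x, 0 ≤ ((d x).toReal + (d (-x)).toReal) / 2 := fun x => by positivity
  have hl : ∫⁻ x, ENNReal.ofReal (((d x).toReal + (d (-x)).toReal) / 2) = 1 := by
    rw [lintegral_congr_ae hae, hd1]
  refine ⟨_, ⟨⟨hmeas, hnn, ?_, ?_⟩, fun x => ?_⟩, hdens⟩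
  · refine (lintegral_ofReal_ne_top_iff_integrable hmeas.aestronglyMeasurable
      (Eventually.of_forall hnn)).1 ?_
    rw [hl]
    exact ENNReal.one_ne_top
  · rw [integral_eq_lintegral_of_nonneg_ae (Eventually.of_forall hnn) hmeas.aestronglyMeasurable,
      hl, ENNReal.toReal_one]
  · rw [neg_neg, add_comm]

variable {m : ℝ} {r : ℝ → ℝ}

lemma map_neg_eq_self_of_im_eq_zero {μ : Measure ℝ} [IsFiniteMeasure μ]
    (h : ∀ ω, (∫ x, phase ω x ∂μ).im = 0) : μ.map (fun x => -x) = μ := by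
  refine Measure.ext_of_charFun (funext fun t => ?_)
  rw [charFun_eq_integral_phase, charFun_eq_integral_phase,
    integral_map (by fun_prop) (continuous_phase _).aestronglyMeasurable,
    ← Complex.conj_eq_iff_im.2 (h (-t)), ← integral_conj]
  simp_rw [star_phase]

/-- The law of the random sum has an even density. -/
theorem exists_density_compoundLaw (hr : IsEvenProbDensity r) (hm₀ : 0 < m) (hm₁ : m < 1) :
    ∃ φ, IsEvenProbDensity φ ∧ densityMeasure φ = compoundLaw m (densityMeasure r) ∧
      ∀ ω, fourierR φ ω =
        (((1 - √(1 - m * (2 - m) * (fourierR r ω).re)) / m : ℝ) : ℂ) := by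
  have := hr.1.isProbabilityMeasure
  have := isProbabilityMeasure_compoundLaw hm₀ hm₁ (densityMeasure r)
  have hreal : ∀ ω, ∫ x, phase ω x ∂densityMeasure r = ((fourierR r ω).re : ℂ) := fun ω => by
    rw [← fourierR_eq_integral_densityMeasure hr.1]
    refine (Complex.conj_eq_iff_re.1 ?_).symm
    rw [← fourierR_comp_neg]
    simp_rw [hr.2]
  have hphase := fun ω => integral_phase_compoundLaw hm₀ hm₁ (hreal ω)
  have hac : densityMeasure r ≪ volume := withDensity_absolutelyContinuous volume _
  obtain ⟨φ, hφ, hφμ⟩ := exists_isEvenProbDensity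
    (compoundLaw_absolutelyContinuous (m := m) hac)
    (map_neg_eq_self_of_im_eq_zero (μ := compoundLaw m (densityMeasure r)) fun ω => by
      rw [hphase, Complex.ofReal_im])
  refine ⟨φ, hφ, hφμ, fun ω => ?_⟩
  rw [fourierR_eq_integral_densityMeasure hφ.1, hφμ, hphase]

end EvenDensity

end SpectralMatch

/-! ### Assembly of the spectral match -/

theorem mainTheorem5 (m : ℝ) (hm₀ : 0 < m) (hm₁ : m < 1)
    (h : ℝ → ℝ) (h_density : IsProbDensity h) (h_onesided : ∀ x, x < 0 → h x = 0)
    (h_monotone : ∃ g : ℝ → ℝ, AntitoneOn g (Set.Ioi 0) ∧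
      h =ᵐ[volume.restrict (Set.Ioi 0)] g) :
    -- `ρ_h` has an even probability density representative, and a real Fourier transform
    (∃ r, IsEvenRepresentative m h r) ∧
    (∀ ω, (fourierR (rhoKernel m h) ω).im = 0) ∧
    -- the weights `p_n` form a probability law
    (∀ n, 1 ≤ n → 0 < catalanWeight m n) ∧
    HasSum (fun n : ℕ => catalanWeight m (n + 1)) 1 ∧
    -- the square root in the transform formula is that of a positive real number
    (∀ ω, 1 - m * (2 - m) * fourierR (rhoKernel m h) ω =
      ((‖1 - m * fourierR h ω‖ ^ 2 : ℝ) : ℂ)) ∧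
    (∀ ω, (1 - m) ^ 2 ≤ ‖1 - m * fourierR h ω‖ ^ 2) ∧
    0 < (1 - m) ^ 2 ∧
    ∃ φ : ℝ → ℝ, IsEvenProbDensity φ ∧
      -- every such random sum has density `φ`
      (∀ (r : ℝ → ℝ), IsEvenRepresentative m h r →
        ∀ (Ω : Type*) [MeasurableSpace Ω] (P : Measure Ω) [IsProbabilityMeasure P]
          (K : Ω → ℕ) (Y : ℕ → Ω → ℝ), IsRandomSumData P m r K Y →
          P.map (fun ω => ∑ k ∈ Finset.range (K ω), Y k ω) = densityMeasure φ) ∧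
      (∀ ω, fourierR φ ω =
        (((1 - √(1 - m * (2 - m) * (fourierR (rhoKernel m h) ω).re)) / m : ℝ) : ℂ)) ∧
      (∀ ω, ‖1 - m * fourierR φ ω‖ ^ 2 = ‖1 - m * fourierR h ω‖ ^ 2) ∧
      -- the branching-cluster process with immigrant rate `ν` and offspring density `m φ`
      (∀ (ν : ℝ), 0 < ν →
        ∀ (Ω : Type*) [MeasurableSpace Ω] (P : Measure Ω) [IsProbabilityMeasure P]
          (U : ℕ → Ω → ℝ) (ξ : ℕ → List ℕ → Ω → ℕ) (D : ℕ → List ℕ → Ω → ℝ),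
        IsBranchingData P ν m φ U ξ D →
        IsStationaryProcess P (clusterProcess U ξ D) ∧
        IsReversibleProcess P (clusterProcess U ξ D) ∧
        (∃ γ₂ γ₃ κ₃, IsReducedCovariance P (clusterProcess U ξ D) γ₂ ∧
          IsReducedCompleteThird P (clusterProcess U ξ D) γ₃ ∧
          IsReducedFactorialThird P (clusterProcess U ξ D) κ₃) ∧
        (∀ γ₂ γ₃ κ₃, IsReducedCovariance P (clusterProcess U ξ D) γ₂ →
          IsReducedCompleteThird P (clusterProcess U ξ D) γ₃ →
          IsReducedFactorialThird P (clusterProcess U ξ D) κ₃ →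
          (∀ ω₁ ω₂, (fourierStieltjes2 γ₃ ω₁ ω₂).im = 0) ∧
          (∀ ω₁ ω₂, (fourierStieltjes2 κ₃ ω₁ ω₂).im = 0) ∧
          (∀ c₃ : ℝ × ℝ → ℝ, Integrable c₃ → κ₃ = volume.withDensityᵥ c₃ →
            ∀ ω₁ ω₂, (fourierR2 c₃ ω₁ ω₂).im = 0) ∧
          (∀ ω, (fourierStieltjes γ₂ ω).im = 0) ∧
          (∀ ω₁ ω₂, fourierStieltjes2 γ₃ ω₁ ω₂ = fourierStieltjes2 κ₃ ω₁ ω₂ +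
            (fourierStieltjes γ₂ ω₁ + fourierStieltjes γ₂ ω₂ + fourierStieltjes γ₂ (ω₁ + ω₂)
              - 2 * ((ν / (1 - m) : ℝ) : ℂ))))) ∧
      -- comparison with the one-sided process with offspring density `m h`
      (∀ (ν : ℝ), 0 < ν →
        ∀ (Ω : Type*) [MeasurableSpace Ω] (P : Measure Ω) [IsProbabilityMeasure P]
          (U : ℕ → Ω → ℝ) (ξ : ℕ → List ℕ → Ω → ℕ) (D : ℕ → List ℕ → Ω → ℝ)
          (Ω' : Type*) [MeasurableSpace Ω'] (P' : Measure Ω') [IsProbabilityMeasure P']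
          (U' : ℕ → Ω' → ℝ) (ξ' : ℕ → List ℕ → Ω' → ℕ) (D' : ℕ → List ℕ → Ω' → ℝ),
        IsBranchingData P ν m h U ξ D → IsBranchingData P' ν m φ U' ξ' D' →
        HasIntensity P (clusterProcess U ξ D) (ν / (1 - m)) ∧
        HasIntensity P' (clusterProcess U' ξ' D') (ν / (1 - m)) ∧
        (∃ γ, IsReducedCovariance P (clusterProcess U ξ D) γ ∧
          IsReducedCovariance P' (clusterProcess U' ξ' D') γ ∧
          ∀ ω, fourierStieltjes γ ω =
            ((ν / (1 - m) / ‖1 - m * fourierR h ω‖ ^ 2 : ℝ) : ℂ)) ∧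
        (∀ γ γ', IsReducedCovariance P (clusterProcess U ξ D) γ →
          IsReducedCovariance P' (clusterProcess U' ξ' D') γ' → γ = γ')) := by
  have hre := fourierR_rhoKernel_eq_re h_onesided h_density hm₀ hm₁
  have hbound : ∀ ω, 1 - m ≤ ‖1 - m * fourierR h ω‖ := fun ω =>
    one_sub_le_norm hm₀ (h_density.norm_fourierR_le ω)
  obtain ⟨r, hr⟩ := exists_isEvenRepresentative h_onesided h_density hm₀ hm₁ h_monotone
  have hrρ : fourierR r = fourierR (rhoKernel m h) := by
    funext ω
    refine integral_congr_ae ?_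
    filter_upwards [hr.2] with t ht
    rw [ht]
  obtain ⟨φ, hφ, hφμ, hφω⟩ := exists_density_compoundLaw hr.1 hm₀ hm₁
  rw [hrρ] at hφω
  -- The radicand is `‖1 - m ĥ‖²`, so `1 - m φ̂` equals the nonnegative real number `‖1 - m ĥ‖`
  -- itself.
  have hnorm : ∀ ω, ‖1 - m * fourierR φ ω‖ ^ 2 = ‖1 - m * fourierR h ω‖ ^ 2 := fun ω => by
    have e : 1 - (m : ℂ) * fourierR φ ω = ((‖1 - m * fourierR h ω‖ : ℝ) : ℂ) := by
      rw [hφω, (hre ω).2, Real.sqrt_sq (norm_nonneg _), ← Complex.ofReal_mul,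
        mul_div_cancel₀ _ hm₀.ne']
      push_cast
      ring
    rw [e, Complex.norm_real, norm_norm]
  refine ⟨⟨r, hr⟩, fun ω => (hre ω).1, fun n hn => catalanWeight_pos hm₀ hm₁ hn,
    hasSum_catalanWeight hm₀ hm₁, one_sub_fourierR_rhoKernel h_onesided h_density hm₁,
    fun ω => pow_le_pow_left₀ (sub_pos.2 hm₁).le (hbound ω) 2, pow_pos (sub_pos.2 hm₁) 2,
    φ, hφ, ?_, hφω, hnorm, ?_, ?_⟩
  · intro r' hr' Ω _ P _ K Y hKY
    have hrr : densityMeasure r' = densityMeasure r := by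
      refine withDensity_congr_ae ?_
      filter_upwards [hr.2, hr'.2] with x h1 h2
      rw [h1, h2]
    have := hr.1.1.isProbabilityMeasure
    rw [hKY.map_randomSum hm₀ hm₁, hrr, hφμ]
  · intro ν hν Ω _ P _ U ξ D hD
    exact ⟨hD.isStationaryProcess hφ.1, hD.isReversibleProcess hφ,
      hD.exists_reduced hφ.1 hν hm₀ hm₁, fun γ₂ γ₃ κ₃ h₂ h₃ hκ =>
        hD.third_order hφ hν hm₀ hm₁ h₂ h₃ hκ⟩
  · intro ν hν Ω _ P _ U ξ D Ω' _ P' _ U' ξ' D' hD hD'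
    have := h_density.isFiniteMeasure_pairMeasure (ν := ν) hm₀ hm₁
    have := hφ.1.isFiniteMeasure_pairMeasure (ν := ν) hm₀ hm₁
    have hγ := hD.isReducedCovariance h_density hm₀ hm₁
    have hγ' := hD'.isReducedCovariance hφ.1 hm₀ hm₁
    have heq : (pairMeasure ν m φ).toSignedMeasure = (pairMeasure ν m h).toSignedMeasure :=
      Measure.toSignedMeasure_congr (pairMeasure_congr h_density hφ.1 hν hm₀ hm₁ hnorm)
    exact ⟨hD.hasIntensity h_density hν hm₀ hm₁, hD'.hasIntensity hφ.1 hν hm₀ hm₁,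
      ⟨_, hγ, heq ▸ hγ', hγ.fourierStieltjes_eq h_density hD hν hm₀ hm₁⟩,
      fun γ γ' h₁ h₂ => (h₁.2.unique hγ.2).trans (heq.symm.trans (hγ'.2.unique h₂.2))⟩
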